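/- Matroids may be infinite (in the sense of Bruhn, Diestel, Kriesell, Pendavingh and Wollan). A matroid $M$ is a *minor* of $N$ if it is isomorphic to $N/C\setminus D$ for some sets $C,D$. A matroid $M$ with ground set $E$ is *binary* if it is representable over $\mathbb F_2$ by thin sums: for some set $A$ and vectors $\varphi_e\in\mathbb F_2^A$ ($e\in E$), a set $I\subseteq E$ is independent if and only if there is no nonzero $c\in\mathbb F_2^E$ with support in $I$ such that, for every $a\in A$, the sum $\sum_{e} c(e)\varphi_e(a)$ has only finitely many nonzero terms and equals $0$. The *order* of a partition $(X,E\setminus X)$ is $1$ plus the least number of elements that have to be deleted from the union of a basis of $X$ and a basis of $E\setminus X$ to obtain an independent set. The *branch-width* of a countable matroid is the least $k$ for which there are a (possibly infinite) tree of maximum degree at most $3$ and an injection of $E$ into its leaves (the vertex of a one-vertex tree counts as a leaf) such that, for every edge of the tree, the partition of $E$ induced by the two components left after removing that edge has order at most $k$. For a locally finite graph $G$ and a set $\Psi$ of ends of $G$, let $|G|_\Psi$ be the space obtained from the end compactification $|G|$ by deleting all ends outside $\Psi$. A $\Psi$-circuit is a set of edges whose closure in $|G|_\Psi$ is homeomorphic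 to the unit circle; a $\Psi^{\complement}$-bond is a minimal nonempty cut whose closure in $|G|_\Psi$ contains no end. A matroid on $E(G)$ is the $\Psi$-*matroid* of $G$ if its circuits are the $\Psi$-circuits and its cocircuits are the $\Psi^{\complement}$-bonds. Let $T_2$ be the infinite rooted binary tree, and let $T_2\times K_2$ be the graph consisting of two disjoint copies of $T_2$ with an edge between each vertex and its clone; its ends are identified with the points of $2^{\mathbb N}$ (the ends of $T_2$). **Corollary 1.5.** The countable binary matroids of branch-width at most $2$ are not well-quasi-ordered under the minor relation: there is a sequence $(M_n)_{n\in\mathbb N}$ of such matroids such that $M_i$ is not a minor of $M_j$ for any $i<j$. Moreover, the sequence can be chosen as follows. There are sets $\Psi_n\subseteq 2^{\mathbb N}$ ($n\in\mathbb N$), each of cardinality $2^{\aleph_0}$, such that for no $i<j$ there is a continuous injective map $f:2^{\mathbb N}\to 2^{\mathbb N}$ with $f(\Psi_i)\subseteq\Psi_j$, and such that for every $n$ the graph $T_2\times K_2$ has a $\Psi_n$-matroid $M_n$, these $M_n$ are countable binary matroids of branch-width at most $2$, and $M_i$ is not a minor of $M_j$ for any $i<j$. -/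

import Mathlib

open Set

noncomputable section

namespace InfMatroid

universe u v

/-! ### Isomorphism and minors of (possibly infinite) matroids -/

/-- Two matroids are isomorphic: there is a bijection of the ground sets which preserves and
reflects independence. -/
def Isomorphic {α : Type u} {β : Type v} (M : Matroid α) (N : Matroid β) : Prop :=
  ∃ φ : M.E ≃ N.E, ∀ I : Set M.E,
    M.Indep ((fun x : M.E => (x : α)) '' I) ↔ N.Indep ((fun x : M.E => (φ x : β)) '' I)

/-- The minor relation between matroids: `M` is isomorphic to some `N / C \ D`. -/
def MinorOf {α : Type u} {β : Type v} (M : Matroid α) (N : Matroid β) : Prop :=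
  ∃ N' : Matroid β, N'.IsMinor N ∧ Isomorphic M N'

/-! ### Binary matroids -/

/-- `c : α → k` is a thin dependence of the family `φ : α → k^A`: at every coordinate `a` the sum
`∑ₑ c e • φ e a` has only finitely many nonzero terms, and it is zero. -/
def IsThinDependence {α : Type u} {A : Type v} {k : Type*} [Field k]
    (φ : α → A → k) (c : α → k) : Prop :=
  ∀ a : A, {e : α | c e * φ e a ≠ 0}.Finite ∧ ∑ᶠ e, c e * φ e a = 0

/-- `M` is representable over `k` in the sense of infinite matroid theory (a thin sums matroid):
there is a family of vectors of some `k^A` such that the independent sets are the subsets of the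
ground set that support no nonzero thin dependence. For finite matroids this is the usual notion
of representability over `k`. -/
def IsThinSums {α : Type u} (k : Type*) [Field k] (M : Matroid α) : Prop :=
  ∃ (A : Type u) (φ : α → A → k), ∀ I : Set α, I ⊆ M.E →
    (M.Indep I ↔ ∀ c : α → k, Function.support c ⊆ I → IsThinDependence φ c → c = 0)

/-- Binary matroids: those representable over the field with two elements. -/
def IsBinary {α : Type u} (M : Matroid α) : Prop := IsThinSums (ZMod 2) M

/-! ### Branch-width -/

/-- The connectivity of the partition `(X, E \ X)`: the least number of elements that have to be
deleted from the union of a basis of `X` and a basis of `E \ X` in order to get an independent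
set. (For a finite matroid this is `r(X) + r(E \ X) - r(M)`.) -/
def connectivity {α : Type u} (M : Matroid α) (X : Set α) : ℕ∞ :=
  ⨅ (I : Set α) (J : Set α) (F : Set α) (_ : M.IsBasis I (M.E ∩ X)) (_ : M.IsBasis J (M.E \ X))
    (_ : M.Indep ((I ∪ J) \ F)), F.encard

/-- A branch-decomposition: a tree (possibly infinite) of maximum degree at most three, some of
whose leaves are labelled, bijectively, by the elements of the matroid. A single vertex counts as a
leaf of the one-vertex tree. -/
structure BranchDecomposition {α : Type u} (M : Matroid α) where
  /-- the nodes of the tree -/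
  Node : Type u
  /-- the tree -/
  tree : SimpleGraph Node
  isTree : tree.IsTree
  degree_le : ∀ t, (tree.neighborSet t).encard ≤ 3
  /-- the leaf labelled by an element of the matroid -/
  leaf : M.E → Node
  leaf_injective : Function.Injective leaf
  degree_leaf_le : ∀ e, (tree.neighborSet (leaf e)).encard ≤ 1

/-- The elements of the matroid on the side of `s` when the edge `st` of the tree is removed. -/
def BranchDecomposition.side {α : Type u} {M : Matroid α} (B : BranchDecomposition M)
    (s t : B.Node) : Set α :=
  {e | ∃ h : e ∈ M.E, (B.tree.deleteEdges {s(s, t)}).Reachable s (B.leaf ⟨e, h⟩)}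

/-- The width of a branch-decomposition: the largest order of a separation displayed by an edge of
the tree, where the order of a separation is its connectivity plus one. -/
def BranchDecomposition.width {α : Type u} {M : Matroid α} (B : BranchDecomposition M) : ℕ∞ :=
  ⨆ (s : B.Node) (t : B.Node) (_ : B.tree.Adj s t), (connectivity M (B.side s t) + 1)

/-- The branch-width of a matroid: the least width of a branch-decomposition. -/
def branchWidth {α : Type u} (M : Matroid α) : ℕ∞ :=
  ⨅ B : BranchDecomposition M, B.width

/-! ### The space `|G|` -/

variable {V : Type u}

/-- A point of the simplicial 1-complex of the graph `G`, in barycentric coordinates: a vertex or an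
inner point of an edge. -/
structure ComplexPoint (G : SimpleGraph V) where
  /-- the barycentric coordinates -/
  coord : V → ℝ
  mem_complex :
    (∃ v, coord v = 1 ∧ ∀ w, w ≠ v → coord w = 0) ∨
    (∃ v w, G.Adj v w ∧ 0 < coord v ∧ 0 < coord w ∧ coord v + coord w = 1 ∧
      ∀ x, x ≠ v → x ≠ w → coord x = 0)

/-- The points of `|G|`: the points of the 1-complex and the ends of `G`. -/
inductive Point (G : SimpleGraph V) : Type u
  | pt (x : ComplexPoint G) : Point G
  | atEnd (ω : G.end) : Point G

/-- The vertex set `C(S, ω)` of the component of `G - S` in which the end `ω` lives. -/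
def endComponent {G : SimpleGraph V} (S : Finset V) (ω : G.end) : Set V :=
  (ω.1 (Opposite.op S)).supp

/-- The basic open neighbourhood of the end `ω` given by the finite vertex set `S`: all vertices
and inner points of edges contained in or incident with `C(S, ω)`, and all ends that live in
`C(S, ω)`. -/
def endNhd {G : SimpleGraph V} (S : Finset V) (ω : G.end) : Set (Point G) :=
  {p | (∃ x, p = Point.pt x ∧ ∃ v ∈ endComponent S ω, x.coord v ≠ 0) ∨
    ∃ η, p = Point.atEnd η ∧ endComponent S η = endComponent S ω}

theorem endComponent_mono {G : SimpleGraph V} {S S' : Finset V} (h : S ⊆ S') (ω : G.end) :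
    endComponent S' ω ⊆ endComponent S ω := by
  have hω := ω.2 (CategoryTheory.opHomOfLE h)
  unfold endComponent
  rw [← hω]
  exact SimpleGraph.ComponentCompl.subset_hom _ h

theorem endComponent_nonempty {G : SimpleGraph V} (S : Finset V) (ω : G.end) :
    (endComponent S ω).Nonempty :=
  SimpleGraph.ComponentCompl.nonempty _

theorem endComponent_eq_of_subset {G : SimpleGraph V} {S S' : Finset V} (h : S ⊆ S')
    {ω η : G.end} (e : endComponent S' η = endComponent S' ω) :
    endComponent S η = endComponent S ω := by
  have e' : η.1 (Opposite.op S') = ω.1 (Opposite.op S') :=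
    SimpleGraph.ComponentCompl.supp_injective e
  have hω := ω.2 (CategoryTheory.opHomOfLE h)
  have hη := η.2 (CategoryTheory.opHomOfLE h)
  unfold endComponent
  rw [← hω, ← hη, e']

theorem endNhd_mono {G : SimpleGraph V} {S S' : Finset V} (h : S ⊆ S') (ω : G.end) :
    endNhd S' ω ⊆ endNhd S ω := by
  rintro p (⟨x, rfl, v, hv, hx⟩ | ⟨η, rfl, hη⟩)
  · exact Or.inl ⟨x, rfl, v, endComponent_mono h ω hv, hx⟩
  · exact Or.inr ⟨η, rfl, endComponent_eq_of_subset h hη⟩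

/-- The topology of `|G|`. The points of the 1-complex have their metric neighbourhoods (close to
any given point the maximum distance of the barycentric coordinates is the distance in the
complex), an end `ω` has the neighbourhoods `endNhd S ω`. -/
instance (G : SimpleGraph V) : TopologicalSpace (Point G) where
  IsOpen U :=
    (∀ x, Point.pt x ∈ U → ∃ ε : ℝ, 0 < ε ∧
      ∀ y : ComplexPoint G, (∀ v, |y.coord v - x.coord v| < ε) → Point.pt y ∈ U) ∧
    (∀ ω, Point.atEnd ω ∈ U → ∃ S : Finset V, endNhd S ω ⊆ U)
  isOpen_univ := ⟨fun _ _ => ⟨1, one_pos, fun _ _ => trivial⟩, fun _ _ => ⟨∅, subset_univ _⟩⟩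
  isOpen_inter := by
    classical
    rintro U W ⟨hU, hU'⟩ ⟨hW, hW'⟩
    refine ⟨fun x hx => ?_, fun ω hω => ?_⟩
    · obtain ⟨ε, hε, h⟩ := hU x hx.1
      obtain ⟨δ, hδ, h'⟩ := hW x hx.2
      exact ⟨min ε δ, lt_min hε hδ, fun y hy =>
        ⟨h y fun v => (hy v).trans_le (min_le_left _ _),
          h' y fun v => (hy v).trans_le (min_le_right _ _)⟩⟩
    · obtain ⟨S, h⟩ := hU' ω hω.1
      obtain ⟨S', h'⟩ := hW' ω hω.2
      exact ⟨S ∪ S', subset_inter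
        ((endNhd_mono Finset.subset_union_left ω).trans h)
        ((endNhd_mono Finset.subset_union_right ω).trans h')⟩
  isOpen_sUnion := by
    intro 𝒰 h𝒰
    refine ⟨fun x hx => ?_, fun ω hω => ?_⟩
    · obtain ⟨U, hU, hxU⟩ := hx
      obtain ⟨ε, hε, h⟩ := (h𝒰 U hU).1 x hxU
      exact ⟨ε, hε, fun y hy => ⟨U, hU, h y hy⟩⟩
    · obtain ⟨U, hU, hωU⟩ := hω
      obtain ⟨S, h⟩ := (h𝒰 U hU).2 ω hωU
      exact ⟨S, fun p hp => ⟨U, hU, h hp⟩⟩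

/-! ### `Ψ`-matroids of locally finite graphs -/

/-- The subspace `|G|_Ψ` of `|G|` obtained by removing all ends that are not in `Ψ`. -/
def psiSpace (G : SimpleGraph V) (Ψ : Set G.end) : Set (Point G) :=
  {p | ∀ ω, p = Point.atEnd ω → ω ∈ Ψ}

/-- The set of all inner points of the edges in `F`, as a subset of `|G|_Ψ`. -/
def edgePoints (G : SimpleGraph V) (Ψ : Set G.end) (F : Set (Sym2 V)) : Set (psiSpace G Ψ) :=
  {p | ∃ x : ComplexPoint G, p.1 = Point.pt x ∧ ∃ e ∈ F, ∀ v, x.coord v ≠ 0 ↔ v ∈ e}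

/-- The `Ψ`-circuits of a locally finite graph: the edge sets whose closure in `|G|_Ψ` is
homeomorphic to the unit circle. -/
def IsPsiCircuit (G : SimpleGraph V) (Ψ : Set G.end) (C : Set (Sym2 V)) : Prop :=
  C ⊆ G.edgeSet ∧ Nonempty (closure (edgePoints G Ψ C) ≃ₜ Circle)

/-- A cut: the set of all edges between a set of vertices and its complement. -/
def IsCut (G : SimpleGraph V) (b : Set (Sym2 V)) : Prop :=
  ∃ X : Set V, b = {e ∈ G.edgeSet | ∃ x ∈ X, ∃ y ∉ X, e = s(x, y)}

/-- An edge set is `Ψ`-bounded if its closure in `|G|_Ψ` contains no end. -/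
def IsPsiBounded (G : SimpleGraph V) (Ψ : Set G.end) (b : Set (Sym2 V)) : Prop :=
  ∀ p ∈ closure (edgePoints G Ψ b), ∀ ω, p.1 ≠ Point.atEnd ω

/-- The `Ψᶜ`-bonds: the minimal nonempty `Ψ`-bounded cuts. -/
def IsPsiBond (G : SimpleGraph V) (Ψ : Set G.end) (b : Set (Sym2 V)) : Prop :=
  Minimal (fun b => b.Nonempty ∧ IsCut G b ∧ IsPsiBounded G Ψ b) b

/-- `M` is the `Ψ`-matroid of the locally finite graph `G`: its ground set is the edge set, its
circuits are the `Ψ`-circuits and its cocircuits are the `Ψᶜ`-bonds. -/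
structure IsPsiMatroid (G : SimpleGraph V) (Ψ : Set G.end) (M : Matroid (Sym2 V)) : Prop where
  ground_eq : M.E = G.edgeSet
  isCircuit_iff : ∀ C, M.IsCircuit C ↔ IsPsiCircuit G Ψ C
  isCocircuit_iff : ∀ D, M.IsCocircuit D ↔ IsPsiBond G Ψ D

/-! ### The graph `T₂ × K₂` -/

/-- The infinite rooted binary tree `T₂`. Its vertices are the finite 0-1-sequences (written with
the last entry first), and every sequence is adjacent to its two extensions by one entry. -/
def binaryTree : SimpleGraph (List Bool) :=
  SimpleGraph.fromRel fun s t => ∃ b : Bool, t = b :: s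

/-- The graph `T₂ × K₂`: two copies of `T₂`, with an edge between each vertex and its clone. -/
def doubleTree : SimpleGraph (List Bool × Bool) :=
  binaryTree.boxProd (⊤ : SimpleGraph Bool)

/-- The initial segment of length `n` of an infinite 0-1-sequence, as a vertex of `T₂`. -/
def initialSegment (x : ℕ → Bool) : ℕ → List Bool
  | 0 => []
  | n + 1 => x n :: initialSegment x n

/-- The end of `T₂ × K₂` belonging to the infinite 0-1-sequence `x`: the one to which the two copies
of the ray of initial segments of `x` converge. -/
def IsEndOf (x : ℕ → Bool) (ω : doubleTree.end) : Prop :=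
  ∀ S : Finset (List Bool × Bool), ∀ᶠ n in Filter.atTop, ∀ i : Bool,
    (initialSegment x n, i) ∈ endComponent S ω

/-- A set of infinite 0-1-sequences, considered as a set of ends of `T₂ × K₂`. -/
def endsOf (Ψ : Set (ℕ → Bool)) : Set doubleTree.end :=
  {ω | ∃ x ∈ Ψ, IsEndOf x ω}

end InfMatroid

end

/-!
An edge of `T₂ × K₂` is a `side` (an edge of one of the two copies of `T₂`) or a `rung`. A *terminal*
is a vertex of `T₂` or a 0-1-sequence; its *leg* consists of the edges of both copies of the path
from the root towards it, together with the rung at its last vertex if it has one. The whole proof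
rests on an explicit description of the `Ψ`-matroid: its circuits are the symmetric differences of
two legs to different terminals, where the sequences are taken from `Ψ` (`circuits`).

*The matroid exists.* A nonempty cut is `Ψ`-bounded if it avoids a neighbourhood of every end in `Ψ`
(`boundedCuts`). The sets in `circuits` and in `boundedCuts` meet in finite sets of even size
(`circuit_inter_boundedCut`), for every edge `e` and every partition of the other edges into two
classes there is a circuit through `e` in one class plus `e` or a bounded cut through `e` in the
other (`circuits_or_boundedCuts`), and every set that contains no circuit is contained in a maximal
such subset of any larger set (`exists_maximal_of_circuits`). By `OrthogonalPair.matroid` these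
facts give a matroid `edgeMatroid Ψ`. Here `Ψ` is arbitrary: a set contains no circuit if and only if
each of its components has at most one terminal, and a maximal such set can be built from the root
upwards, so no determinacy assumption on `Ψ` is needed.

*It is the `Ψ`-matroid.* Every member of `circuits Ψ` is a circle through at most two ends, which is
parametrised explicitly (`isPsiCircuit_of_mem_circuits`). Conversely the edges of a circle are
dependent, since an independent set meets some bounded cut in a single edge, whereas a circle cannot
cross a cut only once (`IsPsiCircuit.inter_cut_ne_singleton`); and no circle properly contains
another (`IsPsiCircuit.eq_of_subset`). Bounded cuts are translated by `boundedCuts_iff`.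

*It is binary of branch-width at most two.* The incidences with the cocircuits represent it over
`ZMod 2` (`isBinary_of_even_inter`). For the partition of the edges at a vertex of `T₂` all legs agree
on one of the two sides with a fixed set, so that after deleting at most one element the union of two
bases contains no circuit (`exists_encard_le_one_indep`); the tree is `branchDecomposition`.

*No minors.* A minor relation between the matroids for `Ψ` and `Ψ'` yields an injection `ψ` of the
edges that maps every circuit to the trace of a circuit. For `x ∈ Ψ` the image of `rootCircuit x`
accumulates at an end, and this end lies in `Ψ'`, since it is the accumulation point of a circuit.
The map `accumulationEnd ψ` obtained so is injective, because two circuits that accumulate at the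
same end agree near it while `rootCircuit x` and `rootCircuit x'` have finite intersection. There are
only continuum many maps `ψ` and continuum many continuous maps, so the sets `Ψ n` can be chosen by
transfinite recursion such that none of these maps takes one into another (`exists_seq_not_mapsTo`).
-/

namespace InfMatroid

/-! ### Matroids from orthogonality -/

/-- Orthogonality data for a matroid on a whole type: a family `𝒞` of sets (to become dependent
sets containing all circuits) and a family `𝒟` (likewise for cocircuits), such that no member of
`𝒞` meets a member of `𝒟` in exactly one element, such that whenever `e ∉ P` one of the
families has a witness for `e` being spanned, or not being spanned, by `P`, and such that
independent sets extend to maximal ones inside every set. -/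
structure OrthogonalPair {α : Type*} (𝒞 𝒟 : Set (Set α)) : Prop where
  nonempty_left : ∀ C ∈ 𝒞, C.Nonempty
  nonempty_right : ∀ D ∈ 𝒟, D.Nonempty
  inter_ne : ∀ C ∈ 𝒞, ∀ D ∈ 𝒟, ∀ e, C ∩ D ≠ {e}
  exists_or : ∀ (P : Set α) (e : α), e ∉ P →
    (∃ C ∈ 𝒞, e ∈ C ∧ C ⊆ insert e P) ∨ ∃ D ∈ 𝒟, e ∈ D ∧ Disjoint D P
  exists_maximal : ∀ I X : Set α, I ⊆ X → (∀ C ∈ 𝒞, ¬ C ⊆ I) →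
    ∃ J, I ⊆ J ∧ J ⊆ X ∧ (∀ C ∈ 𝒞, ¬ C ⊆ J) ∧ ∀ e ∈ X \ J, ∃ C ∈ 𝒞, C ⊆ insert e J

namespace OrthogonalPair

variable {α : Type*} {𝒞 𝒟 : Set (Set α)}

theorem exists_inter_eq (h : OrthogonalPair 𝒞 𝒟) {I : Set α} (hI : ∀ C ∈ 𝒞, ¬ C ⊆ I) {e : α}
    (he : e ∈ I) : ∃ D ∈ 𝒟, D ∩ I = {e} := by
  rcases h.exists_or (I \ {e}) e (by simp) with ⟨C, hC, -, hCI⟩ | ⟨D, hD, heD, hdis⟩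
  · rw [insert_sdiff_singleton, insert_eq_of_mem he] at hCI
    exact absurd hCI (hI C hC)
  · refine ⟨D, hD, subset_antisymm (fun f hf => ?_) (by simp [heD, he])⟩
    by_contra hfe
    exact disjoint_left.1 hdis hf.1 ⟨hf.2, hfe⟩

/-- The matroid whose independent sets are the sets that include no member of `𝒞`. -/
protected def matroid (h : OrthogonalPair 𝒞 𝒟) : Matroid α :=
  IndepMatroid.matroid
  { E := univ
    Indep := fun I => ∀ C ∈ 𝒞, ¬ C ⊆ I
    indep_empty := fun C hC hC0 => (h.nonempty_left C hC).ne_empty (subset_empty_iff.1 hC0)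
    indep_subset := fun _ _ hJ hIJ C hC hCI => hJ C hC (hCI.trans hIJ)
    indep_aug := by
      intro I B hI hImax hB
      by_contra hcon
      push Not at hcon
      obtain ⟨J, hIJ, -, hJ, hJmax⟩ := h.exists_maximal I univ (subset_univ _) hI
      obtain ⟨f, hfJ, hfI⟩ : ∃ f ∈ J, f ∉ I := by
        by_contra hall
        push Not at hall
        refine hImax ⟨hI, fun K hK hIK e heK => ?_⟩
        by_contra heI
        have heq : J = I := subset_antisymm hall hIJ
        obtain ⟨C, hC, hCe⟩ := hJmax e ⟨trivial, by rwa [heq]⟩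
        exact hK C hC (hCe.trans (insert_subset heK (heq ▸ hIK)))
      -- A witness `D` that `f` is not spanned by `I`; it must meet the base `B`.
      have hIf : ∀ C ∈ 𝒞, ¬ C ⊆ insert f I :=
        fun C hC hCf => hJ C hC (hCf.trans (insert_subset hfJ hIJ))
      obtain ⟨D, hD, hDf⟩ := h.exists_inter_eq hIf (mem_insert f I)
      have hfD : f ∈ D := (hDf.ge rfl).1
      have hDI : ∀ e ∈ D, e ∉ I := fun e heD heI =>
        hfI ((hDf.le ⟨heD, mem_insert_of_mem _ heI⟩ : e = f) ▸ heI)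
      obtain ⟨e, heD, heB⟩ : ∃ e ∈ D, e ∈ B := by
        by_contra hall
        push Not at hall
        have hfB : f ∉ B := hall f hfD
        have hBf : ¬ ∀ C ∈ 𝒞, ¬ C ⊆ insert f B := fun hBf =>
          hfB (hB.2 hBf (subset_insert f B) (mem_insert f B))
        push Not at hBf
        obtain ⟨C, hC, hCB⟩ := hBf
        have hfC : f ∈ C := by
          by_contra hfC
          exact hB.1 C hC ((subset_insert_iff_of_notMem hfC).1 hCB)
        refine h.inter_ne C hC D hD f (subset_antisymm (fun x hx => ?_) (by simp [hfC, hfD]))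
        rcases hCB hx.1 with rfl | hxB
        · rfl
        · exact absurd hxB (hall x hx.2)
      obtain ⟨C, hC, hCe⟩ := hcon e ⟨heB, hDI e heD⟩
      have heC : e ∈ C := by
        by_contra heC
        exact hI C hC ((subset_insert_iff_of_notMem heC).1 hCe)
      refine h.inter_ne C hC D hD e (subset_antisymm (fun x hx => ?_) (by simp [heC, heD]))
      rcases hCe hx.1 with rfl | hxI
      · rfl
      · exact absurd hxI (hDI x hx.2)
    indep_maximal := by
      intro X _ I hI hIX
      obtain ⟨J, hIJ, hJX, hJ, hmax⟩ := h.exists_maximal I X hIX hI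
      refine ⟨J, hIJ, ⟨hJ, hJX⟩, fun K hK hJK e heK => ?_⟩
      by_contra heJ
      obtain ⟨C, hC, hCe⟩ := hmax e ⟨hK.2 heK, heJ⟩
      exact hK.1 C hC (hCe.trans (insert_subset heK hJK))
    subset_ground := fun _ _ => subset_univ _ }

variable (h : OrthogonalPair 𝒞 𝒟)

@[simp]
theorem matroid_ground : h.matroid.E = univ := rfl

theorem matroid_indep_iff {I : Set α} : h.matroid.Indep I ↔ ∀ C ∈ 𝒞, ¬ C ⊆ I := Iff.rfl

theorem matroid_dep_iff {X : Set α} : h.matroid.Dep X ↔ ∃ C ∈ 𝒞, C ⊆ X := by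
  rw [← Matroid.not_indep_iff (by simp), matroid_indep_iff]
  push Not
  rfl

theorem mem_of_isCircuit {C : Set α} (hC : h.matroid.IsCircuit C) : C ∈ 𝒞 := by
  obtain ⟨C', hC', hle⟩ := h.matroid_dep_iff.1 hC.dep
  rwa [← hC.eq_of_dep_subset (h.matroid_dep_iff.2 ⟨C', hC', Subset.rfl⟩) hle]

theorem not_spanning_compl_iff {K : Set α} :
    ¬ h.matroid.Spanning Kᶜ ↔ ∃ D ∈ 𝒟, D ⊆ K := by
  constructor
  · intro hns
    obtain ⟨J, hJ⟩ := h.matroid.exists_isBasis Kᶜ (by simp)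
    have hJb : ¬ h.matroid.IsBase J := fun hb =>
      hns ((Matroid.spanning_iff_exists_isBase_subset (by simp)).2 ⟨J, hb, hJ.subset⟩)
    obtain ⟨e, he, hJe⟩ := hJ.indep.exists_insert_of_not_isBase hJb
      (h.matroid.exists_isBase.choose_spec)
    obtain ⟨D, hD, hDe⟩ := h.exists_inter_eq (h.matroid_indep_iff.1 hJe) (mem_insert e J)
    have hDJ : ∀ f ∈ D, f ∉ J := fun f hf hfJ =>
      he.2 ((hDe.le ⟨hf, mem_insert_of_mem _ hfJ⟩ : f = e) ▸ hfJ)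
    refine ⟨D, hD, fun f hfD => ?_⟩
    by_contra hfK
    have hdep : ¬ h.matroid.Indep (insert f J) := fun hi =>
      hDJ f hfD (hJ.mem_of_insert_indep hfK hi)
    rw [matroid_indep_iff] at hdep
    push Not at hdep
    obtain ⟨C, hC, hCf⟩ := hdep
    have hfC : f ∈ C := by
      by_contra hfC
      exact hJ.indep C hC ((subset_insert_iff_of_notMem hfC).1 hCf)
    refine h.inter_ne C hC D hD f (subset_antisymm (fun x hx => ?_) (by simp [hfC, hfD]))
    rcases hCf hx.1 with rfl | hxJ
    · rfl
    · exact absurd hxJ (hDJ x hx.2)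
  · rintro ⟨D, hD, hDK⟩ hs
    obtain ⟨B, hB, hBK⟩ := (Matroid.spanning_iff_exists_isBase_subset (by simp)).1 hs
    obtain ⟨e, he⟩ := h.nonempty_right D hD
    have hdep := hB.insert_dep ⟨by simp, fun heB => hBK heB (hDK he)⟩
    obtain ⟨C, hC, hCe⟩ := h.matroid_dep_iff.1 hdep
    have heC : e ∈ C := by
      by_contra heC
      exact hB.indep C hC ((subset_insert_iff_of_notMem heC).1 hCe)
    refine h.inter_ne C hC D hD e (subset_antisymm (fun x hx => ?_) (by simp [heC, he]))
    rcases hCe hx.1 with rfl | hxB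
    · rfl
    · exact absurd (hDK hx.2) (hBK hxB)

theorem isCocircuit_iff {K : Set α} : h.matroid.IsCocircuit K ↔ Minimal (· ∈ 𝒟) K := by
  rw [Matroid.isCocircuit_iff_minimal_compl_nonspanning]
  have hfun : (fun X => ¬ h.matroid.Spanning (h.matroid.E \ X)) = fun X => ∃ D ∈ 𝒟, D ⊆ X := by
    ext X
    rw [matroid_ground, ← compl_eq_univ_sdiff, not_spanning_compl_iff]
  rw [hfun]
  constructor
  · rintro ⟨⟨D, hD, hDK⟩, hmin⟩
    have hKD : K = D := subset_antisymm (hmin ⟨D, hD, Subset.rfl⟩ hDK) hDK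
    exact ⟨hKD ▸ hD, fun D' hD' hle => hmin ⟨D', hD', Subset.rfl⟩ hle⟩
  · rintro ⟨hK, hmin⟩
    exact ⟨⟨K, hK, Subset.rfl⟩, fun X ⟨D, hD, hDX⟩ hXK => (hmin hD (hDX.trans hXK)).trans hDX⟩

end OrthogonalPair

/-! ### Diagonalisation -/

section Diagonalisation

open Cardinal

/-- Against at most continuum many partial injections `f a` (with domain `X a`) of a set `R` of size
continuum, there is a sequence of subsets of `R` of size continuum, none of which is mapped into
another by any of these injections. -/
theorem exists_seq_not_mapsTo {R ι : Type} (hR : #R = 𝔠) (hι : #ι ≤ 𝔠)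
    (X : ι → Set R) (f : ι → R → R) (hf : ∀ a, InjOn (f a) (X a)) :
    ∃ Ψ : ℕ → Set R, (∀ n, #(Ψ n) = 𝔠) ∧
      ∀ i j, i ≠ j → ∀ a, Ψ i ⊆ X a → ¬ MapsTo (f a) (Ψ i) (Ψ j) := by
  classical
  rcases isEmpty_or_nonempty ι with he | ⟨⟨a₀⟩⟩
  · exact ⟨fun _ => univ, fun _ => by simpa using hR, fun _ _ _ a => (he.false a).elim⟩
  -- Requirements: for `(r, a, n)` put a point into `Ψ n` that defeats `f a`; the factor `R` makes
  -- every `Ψ n` large.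
  let K : Type := R × ι × ℕ
  have hK : #K ≤ 𝔠 := by
    simp only [K, mk_prod, lift_id, hR, mk_nat]
    calc 𝔠 * (#ι * ℵ₀) ≤ 𝔠 * (𝔠 * ℵ₀) := by gcongr
      _ = 𝔠 := by rw [continuum_mul_aleph0, continuum_mul_self]
  obtain ⟨r, wo, hr⟩ := Cardinal.exists_ord_eq K
  have hlt : ∀ k : K, #{l // r l k} < 𝔠 := by
    intro k
    refine lt_of_lt_of_le ?_ hK
    rw [← Ordinal.card_typein (r := r)]
    exact Cardinal.lt_ord.1 (hr ▸ Ordinal.typein_lt_type r k)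
  have key : ∀ (k : K) (y : ∀ l, r l k → R), ∃ x : R,
      (∀ l hl, x ≠ y l hl) ∧ (∀ l hl, x ≠ f l.2.1 (y l hl)) ∧
      (x ∉ X k.2.1 ∨ ∀ l hl, f k.2.1 x ≠ y l hl) := by
    intro k y
    by_contra hcon
    push Not at hcon
    set A : Set R := range fun l : {l // r l k} => y l.1 l.2 with hA
    set B : Set R := range fun l : {l // r l k} => f l.1.2.1 (y l.1 l.2) with hB
    set T : Set R := X k.2.1 ∩ f k.2.1 ⁻¹' A with hT
    have hcov : (univ : Set R) ⊆ (A ∪ B) ∪ T := by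
      intro x _
      by_cases hxA : x ∈ A
      · exact Or.inl (Or.inl hxA)
      by_cases hxB : x ∈ B
      · exact Or.inl (Or.inr hxB)
      · obtain ⟨hx, l, hl, hle⟩ := hcon x (fun l hl h => hxA ⟨⟨l, hl⟩, h.symm⟩)
          (fun l hl h => hxB ⟨⟨l, hl⟩, h.symm⟩)
        exact Or.inr ⟨hx, ⟨l, hl⟩, hle.symm⟩
    have hAc : #A < 𝔠 := mk_range_le.trans_lt (hlt k)
    have hBc : #B < 𝔠 := mk_range_le.trans_lt (hlt k)
    have hTc : #T < 𝔠 := by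
      have himg : #(f k.2.1 '' T) = #T :=
        mk_image_eq_of_injOn _ _ ((hf k.2.1).mono inter_subset_left)
      rw [← himg]
      exact (mk_le_mk_of_subset (image_subset_iff.2 inter_subset_right)).trans_lt hAc
    have : #R < 𝔠 := by
      rw [← mk_univ]
      refine (mk_le_mk_of_subset hcov).trans_lt ((mk_union_le _ _).trans_lt ?_)
      refine add_lt_of_lt aleph0_le_continuum ((mk_union_le _ _).trans_lt ?_) hTc
      exact add_lt_of_lt aleph0_le_continuum hAc hBc
    exact this.ne hR
  choose F hF₁ hF₂ hF₃ using key
  let x : K → R := wo.wf.fix F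
  have hx : ∀ k, x k = F k fun l _ => x l := fun k => wo.wf.fix_eq F k
  have h₁ : ∀ k l, r l k → x k ≠ x l := fun k l hl => by rw [hx k]; exact hF₁ k _ l hl
  have h₂ : ∀ k l, r l k → x k ≠ f l.2.1 (x l) := fun k l hl => by rw [hx k]; exact hF₂ k _ l hl
  have h₃ : ∀ k, x k ∉ X k.2.1 ∨ ∀ l, r l k → f k.2.1 (x k) ≠ x l :=
    fun k => by rw [hx k]; exact hF₃ k _
  have hinj : Function.Injective x := by
    intro k l hkl
    rcases trichotomous_of r k l with h | h | h
    · exact absurd hkl.symm (h₁ l k h)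
    · exact h
    · exact absurd hkl (h₁ k l h)
  refine ⟨fun n => {z | ∃ k : K, k.2.2 = n ∧ x k = z}, fun n => ?_, fun i j hij a hX hmaps => ?_⟩
  · refine le_antisymm (hR ▸ mk_set_le _) ?_
    rw [← hR]
    refine mk_le_of_injective (f := fun y : R => ⟨x (y, a₀, n), (y, a₀, n), rfl, rfl⟩) ?_
    intro y y' hyy
    exact congrArg Prod.fst (hinj (Subtype.ext_iff.1 hyy))
  · obtain ⟨y⟩ : Nonempty R := by
      rw [← mk_ne_zero_iff, hR]
      exact continuum_ne_zero
    set k : K := (y, a, i) with hk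
    have hki : x k ∈ {z | ∃ k : K, k.2.2 = i ∧ x k = z} := ⟨k, rfl, rfl⟩
    obtain ⟨l, hlj, hl⟩ := hmaps hki
    rcases trichotomous_of r k l with h | h | h
    · exact h₂ l k h hl
    · exact hij (by rw [← hlj, ← h])
    · exact (h₃ k).elim (fun h' => h' (hX hki)) fun h' => h' l h hl.symm

/-- There are at most continuum many continuous self-maps of the Cantor space. -/
theorem mk_continuous_le :
    #{f : (ℕ → Bool) → (ℕ → Bool) // Continuous f} ≤ 𝔠 := by
  obtain ⟨D, hDc, hD⟩ := TopologicalSpace.exists_countable_dense (ℕ → Bool)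
  have hinj : Function.Injective
      fun (f : {f : (ℕ → Bool) → (ℕ → Bool) // Continuous f}) (d : D) => f.1 d := by
    intro f g hfg
    exact Subtype.ext (f.2.ext_on hD g.2 fun d hd => congrFun hfg ⟨d, hd⟩)
  refine (mk_le_of_injective hinj).trans ?_
  have : Countable D := hDc
  have h1 : #(ℕ → Bool) = 𝔠 := by simp
  rw [← power_def, h1]
  calc 𝔠 ^ #D ≤ 𝔠 ^ ℵ₀ := power_le_power_left continuum_ne_zero (mk_le_aleph0_iff.2 this)
    _ = 𝔠 := continuum_power_aleph0

end Diagonalisation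

/-! ### Initial segments -/

@[simp]
theorem length_initialSegment (x : ℕ → Bool) (n : ℕ) : (initialSegment x n).length = n := by
  induction n with
  | zero => rfl
  | succ n ih => simp [initialSegment, ih]

theorem initialSegment_suffix (x : ℕ → Bool) {m n : ℕ} (h : m ≤ n) :
    initialSegment x m <:+ initialSegment x n := by
  induction n, h using Nat.le_induction with
  | base => exact List.suffix_rfl
  | succ n _ ih => exact ih.trans (List.suffix_cons _ _)

theorem eq_initialSegment_of_suffix {x : ℕ → Bool} {n : ℕ} {p : List Bool}
    (h : p <:+ initialSegment x n) : p = initialSegment x p.length := by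
  have hle : p.length ≤ n := by simpa using h.length_le
  have h' := initialSegment_suffix x hle
  exact (List.suffix_of_suffix_length_le h h' (by simp)).eq_of_length (by simp)

/-! ### Terminals, legs and cuts -/

/-- The edges of `T₂ × K₂`: `side p b i` joins the vertices `(p, i)` and `(b :: p, i)` of the copy
`i` of `T₂`, and `rung v` joins the two clones of `v`. -/
inductive Edge : Type
  | side (p : List Bool) (b i : Bool) : Edge
  | rung (v : List Bool) : Edge

/-- A place where a path in `T₂` that starts at the root may stop: at a vertex (thought of as the
rung at that vertex) or at an end. -/
inductive Terminal : Type
  | vertex (v : List Bool) : Terminal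
  | seq (x : ℕ → Bool) : Terminal

namespace Terminal

/-- The vertices of `T₂` on the path from the root to a terminal. -/
def path : Terminal → Set (List Bool)
  | vertex v => {p | p <:+ v}
  | seq x => {p | p = initialSegment x p.length}

/-- The terminals available when the ends in `Ψ` are present. -/
def Valid (Ψ : Set (ℕ → Bool)) : Terminal → Prop
  | vertex _ => True
  | seq x => x ∈ Ψ

@[simp] theorem mem_path_vertex {p v : List Bool} : p ∈ (vertex v).path ↔ p <:+ v := Iff.rfl

theorem mem_path_seq {p : List Bool} {x : ℕ → Bool} :
    p ∈ (seq x).path ↔ p = initialSegment x p.length := Iff.rfl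

@[simp] theorem initialSegment_mem_path (x : ℕ → Bool) (n : ℕ) :
    initialSegment x n ∈ (seq x).path := by
  simp [mem_path_seq]

theorem mem_path_seq_iff_suffix {p : List Bool} {x : ℕ → Bool} {n : ℕ} (h : p.length ≤ n) :
    p ∈ (seq x).path ↔ p <:+ initialSegment x n := by
  refine ⟨fun hp => ?_, fun hp => eq_initialSegment_of_suffix hp⟩
  rw [mem_path_seq.1 hp]
  exact initialSegment_suffix x h

theorem mem_path_of_suffix {z : Terminal} {p q : List Bool} (hp : p ∈ z.path) (h : q <:+ p) :
    q ∈ z.path := by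
  cases z with
  | vertex v => exact h.trans hp
  | seq x =>
    rw [mem_path_seq] at hp
    rw [hp] at h
    exact eq_initialSegment_of_suffix h

@[simp] theorem nil_mem_path (z : Terminal) : [] ∈ z.path := by
  cases z with
  | vertex v => exact List.nil_suffix
  | seq x => rfl

theorem suffix_or_suffix {z : Terminal} {p q : List Bool} (hp : p ∈ z.path) (hq : q ∈ z.path) :
    p <:+ q ∨ q <:+ p := by
  cases z with
  | vertex v => exact List.suffix_or_suffix_of_suffix hp hq
  | seq x =>
    rw [mem_path_seq] at hp hq
    rw [hp, hq]
    exact (le_total _ _).imp (initialSegment_suffix x) (initialSegment_suffix x)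

theorem suffix_of_length_le {z : Terminal} {p q : List Bool} (hp : p ∈ z.path) (hq : q ∈ z.path)
    (h : p.length ≤ q.length) : p <:+ q := by
  rcases suffix_or_suffix hp hq with h' | h'
  · exact h'
  · rw [h'.eq_of_length_le h]

/-- The paths to two different terminals have a last common vertex. -/
theorem exists_meet {z z' : Terminal} (h : z ≠ z') :
    ∃ u, ∀ q, q ∈ z.path ∧ q ∈ z'.path ↔ q <:+ u := by
  obtain ⟨N, hN⟩ : ∃ N, ∀ q, q ∈ z.path ∧ q ∈ z'.path → q.length ≤ N := by
    rcases z with v | x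
    · exact ⟨v.length, fun q hq => hq.1.length_le⟩
    rcases z' with v | y
    · exact ⟨v.length, fun q hq => hq.2.length_le⟩
    · obtain ⟨n, hn⟩ : ∃ n, x n ≠ y n := by
        by_contra hcon
        push Not at hcon
        exact h (congrArg seq (funext hcon))
      refine ⟨n, fun q hq => ?_⟩
      by_contra hlt
      have hxq := mem_path_of_suffix hq.2 ((mem_path_seq_iff_suffix (x := x)
        (p := initialSegment x (n + 1)) (n := q.length) (by simp; omega)).1 (by simp) |>.trans
          (by rw [← mem_path_seq.1 hq.1]))
      rw [mem_path_seq, length_initialSegment] at hxq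
      exact hn (List.cons.inj hxq).1
  obtain ⟨u, hu, hmax⟩ : ∃ u ∈ z.path ∩ z'.path, ∀ q ∈ z.path ∩ z'.path, q.length ≤ u.length := by
    by_contra hcon
    push Not at hcon
    have : ∀ n, ∃ u ∈ z.path ∩ z'.path, n ≤ u.length := by
      intro n
      induction n with
      | zero => exact ⟨[], ⟨nil_mem_path z, nil_mem_path z'⟩, le_rfl⟩
      | succ n ih =>
        obtain ⟨u, hu, hle⟩ := ih
        obtain ⟨q, hq, hlt⟩ := hcon u hu
        exact ⟨q, hq, by omega⟩
    obtain ⟨u, hu, hle⟩ := this (N + 1)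
    have := hN u hu
    omega
  exact ⟨u, fun q => ⟨fun hq => suffix_of_length_le hq.1 hu.1 (hmax q hq),
    fun hq => ⟨mem_path_of_suffix hu.1 hq, mem_path_of_suffix hu.2 hq⟩⟩⟩

/-- The edges of both copies of the path from the root to a terminal, with the rung at its last
vertex if there is one. -/
def leg (z : Terminal) : Set Edge := {e |
  match e with
  | .side p b _ => b :: p ∈ z.path
  | .rung v => z = vertex v}

@[simp] theorem side_mem_leg {z : Terminal} {p : List Bool} {b i : Bool} :
    Edge.side p b i ∈ z.leg ↔ b :: p ∈ z.path := Iff.rfl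

@[simp] theorem rung_mem_leg {z : Terminal} {v : List Bool} :
    Edge.rung v ∈ z.leg ↔ z = vertex v := Iff.rfl

end Terminal

open Terminal

/-- The edges of both copies of the path from the root to the vertex `v`. -/
def stem (v : List Bool) : Set Edge := {e |
  match e with
  | .side p b _ => b :: p <:+ v
  | .rung _ => False}

@[simp] theorem side_mem_stem {v p : List Bool} {b i : Bool} :
    Edge.side p b i ∈ stem v ↔ b :: p <:+ v := Iff.rfl

@[simp] theorem rung_notMem_stem {v w : List Bool} : Edge.rung w ∉ stem v := id

theorem stem_mono {v w : List Bool} (h : v <:+ w) : stem v ⊆ stem w := by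
  rintro (⟨p, b, i⟩ | u) he
  · exact List.IsSuffix.trans he h
  · exact he

/-- The edges of the copies of `T₂` above `p`, with the rungs there and the edges that lead down
from `p`. -/
def above (p : List Bool) : Set Edge := {e |
  match e with
  | .side q b _ => p <:+ b :: q
  | .rung v => p <:+ v}

@[simp] theorem side_mem_above {p q : List Bool} {b i : Bool} :
    Edge.side q b i ∈ above p ↔ p <:+ b :: q := Iff.rfl

@[simp] theorem rung_mem_above {p v : List Bool} : Edge.rung v ∈ above p ↔ p <:+ v := Iff.rfl

/-- The cut of `T₂ × K₂` given by a 2-colouring of the vertices. -/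
def cut (Y : List Bool → Bool → Bool) : Set Edge := {e |
  match e with
  | .side p b i => Y p i ≠ Y (b :: p) i
  | .rung v => Y v false ≠ Y v true}

@[simp] theorem side_mem_cut {Y : List Bool → Bool → Bool} {p : List Bool} {b i : Bool} :
    Edge.side p b i ∈ cut Y ↔ Y p i ≠ Y (b :: p) i := Iff.rfl

@[simp] theorem rung_mem_cut {Y : List Bool → Bool → Bool} {v : List Bool} :
    Edge.rung v ∈ cut Y ↔ Y v false ≠ Y v true := Iff.rfl

/-- The set `D` of edges has no end in `Ψ` in its closure. -/
def Bounded (Ψ : Set (ℕ → Bool)) (D : Set Edge) : Prop :=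
  ∀ x ∈ Ψ, ∃ n, Disjoint D (above (initialSegment x n))

/-- The circuits of the `Ψ`-matroid: any two legs to different terminals form one. -/
def circuits (Ψ : Set (ℕ → Bool)) : Set (Set Edge) :=
  {C | ∃ z z' : Terminal, z.Valid Ψ ∧ z'.Valid Ψ ∧ z ≠ z' ∧ C = symmDiff z.leg z'.leg}

/-- The nonempty `Ψ`-bounded cuts, whose minimal members are the cocircuits of the
`Ψ`-matroid. -/
def boundedCuts (Ψ : Set (ℕ → Bool)) : Set (Set Edge) :=
  {D | D.Nonempty ∧ (∃ Y, D = cut Y) ∧ Bounded Ψ D}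

/-- The sets `A` and `B` differ only in elements of `I`. For legs and stems and a set `I` of edges
this expresses that they end in the same component of `I`. -/
def AgreeOff {α : Type*} (I A B : Set α) : Prop := ∀ e ∉ I, (e ∈ A ↔ e ∈ B)

namespace AgreeOff

variable {α : Type*} {I J A B C : Set α}

theorem refl (I A : Set α) : AgreeOff I A A := fun _ _ => Iff.rfl

theorem symm (h : AgreeOff I A B) : AgreeOff I B A := fun e he => (h e he).symm

theorem trans (h : AgreeOff I A B) (h' : AgreeOff I B C) : AgreeOff I A C :=
  fun e he => (h e he).trans (h' e he)

theorem mono (h : AgreeOff I A B) (hIJ : I ⊆ J) : AgreeOff J A B :=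
  fun e he => h e fun heI => he (hIJ heI)

theorem iff_symmDiff_subset : AgreeOff I A B ↔ symmDiff A B ⊆ I := by
  constructor
  · intro h e he
    by_contra heI
    rcases he with ⟨h1, h2⟩ | ⟨h1, h2⟩
    · exact h2 ((h e heI).1 h1)
    · exact h2 ((h e heI).2 h1)
  · intro h e heI
    by_contra hcon
    refine heI (h ?_)
    rw [mem_symmDiff]
    tauto

end AgreeOff

theorem agreeOff_stem_cons {I : Set Edge} {s : List Bool} {b : Bool} :
    AgreeOff I (stem (b :: s)) (stem s) ↔ ∀ i, Edge.side s b i ∈ I := by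
  constructor
  · intro h i
    by_contra hi
    have := ((h _ hi).1 (side_mem_stem.2 List.suffix_rfl)).length_le
    simp at this
  · rintro h (⟨p, c, i⟩ | v) he
    · simp only [side_mem_stem]
      refine ⟨fun hs => ?_, fun hs => hs.trans (List.suffix_cons _ _)⟩
      rcases List.suffix_cons_iff.1 hs with h' | h'
      · obtain ⟨rfl, rfl⟩ := List.cons.inj h'
        exact absurd (h i) he
      · exact h'
    · simp

/-- Between two vertices of a component of `I` that lie above each other there are only vertices of
that component. -/
theorem AgreeOff.stem_between {I A : Set Edge} {u p : List Bool} (hu : AgreeOff I (stem u) A)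
    (hpu : p <:+ u) (h : ∀ e ∈ A, e ∈ stem u → e ∈ stem p) : AgreeOff I (stem p) A :=
  fun e he => ⟨fun hp => (hu e he).1 (stem_mono hpu hp), fun hA => h e hA ((hu e he).2 hA)⟩

/-! ### Circuits meet bounded cuts evenly -/

theorem ncard_symmDiff_cast {α : Type*} {A B : Set α} (hA : A.Finite) (hB : B.Finite) :
    ((symmDiff A B).ncard : ZMod 2) = A.ncard + B.ncard := by
  have h1 : (symmDiff A B).ncard = (A \ B).ncard + (B \ A).ncard :=
    ncard_union_eq (disjoint_sdiff_sdiff) (hA.subset sdiff_subset) (hB.subset sdiff_subset)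
  have h2 := ncard_inter_add_ncard_sdiff_eq_ncard A B hA
  have h3 := ncard_inter_add_ncard_sdiff_eq_ncard B A hB
  rw [inter_comm] at h3
  have h4 : A.ncard + B.ncard = (symmDiff A B).ncard + 2 * (A ∩ B).ncard := by omega
  have h5 := congrArg (Nat.cast : ℕ → ZMod 2) h4
  push_cast at h5
  rw [h5, show (2 : ZMod 2) = 0 from rfl]
  ring

theorem ncard_square_inter_cut (Y : List Bool → Bool → Bool) (v : List Bool) (b : Bool) :
    ((({.side v b false, .side v b true, .rung v, .rung (b :: v)} : Set Edge) ∩ cut Y).ncard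
      : ZMod 2) = 0 := by
  classical
  have h : (({.side v b false, .side v b true, .rung v, .rung (b :: v)} : Set Edge) ∩ cut Y) =
      ↑(({.side v b false, .side v b true, .rung v, .rung (b :: v)} : Finset Edge).filter
        (· ∈ cut Y)) := by
    ext e
    simp
  rw [h, ncard_coe_finset, Finset.natCast_card_filter]
  rw [Finset.sum_insert (by simp), Finset.sum_insert (by simp), Finset.sum_insert (by simp),
    Finset.sum_singleton]
  simp only [side_mem_cut, rung_mem_cut]
  cases Y v false <;> cases Y v true <;> cases Y (b :: v) false <;> cases Y (b :: v) true <;> rfl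

/-- Every leg meets a bounded cut finitely, and the parity of the intersection depends only on the
colours of the two roots: each copy of the path crosses the cut with the parity of the colours of
its ends. -/
theorem ncard_leg_inter_cut {Ψ : Set (ℕ → Bool)} {Y : List Bool → Bool → Bool}
    (hY : Bounded Ψ (cut Y)) {z : Terminal} (hz : z.Valid Ψ) :
    (z.leg ∩ cut Y).Finite ∧
      ((z.leg ∩ cut Y).ncard : ZMod 2) = if Y [] false = Y [] true then 0 else 1 := by
  have hvertex : ∀ v, ((vertex v).leg ∩ cut Y).Finite ∧
      (((vertex v).leg ∩ cut Y).ncard : ZMod 2) = if Y [] false = Y [] true then 0 else 1 := by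
    intro v
    induction v with
    | nil =>
      have h : (vertex []).leg = {Edge.rung []} := by
        ext (⟨p, b, i⟩ | v)
        · simp
        · simp [eq_comm]
      rw [h]
      refine ⟨(finite_singleton _).subset inter_subset_left, ?_⟩
      split_ifs with h'
      · rw [singleton_inter_eq_empty.2 (by simpa using h')]
        simp
      · rw [inter_eq_left.2 (singleton_subset_iff.2 (by simpa using h'))]
        simp
    | cons b v ih =>
      have h : (vertex (b :: v)).leg = symmDiff (vertex v).leg
          {.side v b false, .side v b true, .rung v, .rung (b :: v)} := by
        ext (⟨p, c, i⟩ | w)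
        · by_cases hcp : c :: p = b :: v
          · obtain ⟨rfl, rfl⟩ := List.cons.inj hcp
            have hn : ¬ (c :: p <:+ p) := fun hs => by simpa using hs.length_le
            cases i <;> simp [mem_symmDiff, hn, List.suffix_rfl]
          · have hne : ¬ (p = v ∧ c = b) := fun h => hcp (by rw [h.1, h.2])
            have hs : c :: p <:+ b :: v ↔ c :: p <:+ v := by
              rw [List.suffix_cons_iff]
              simp [hcp]
            simp only [mem_symmDiff, side_mem_leg, mem_path_vertex, hs, mem_insert_iff,
              Edge.side.injEq, mem_singleton_iff, reduceCtorEq]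
            tauto
        · have hn : v ≠ b :: v := fun h => by simpa using congrArg List.length h
          simp only [mem_symmDiff, rung_mem_leg, vertex.injEq, mem_insert_iff, reduceCtorEq,
            Edge.rung.injEq, mem_singleton_iff, false_or]
          constructor
          · rintro rfl
            exact Or.inr ⟨Or.inr rfl, hn⟩
          · rintro (⟨rfl, h'⟩ | ⟨rfl | rfl, h'⟩)
            · exact absurd (Or.inl rfl) h'
            · exact absurd rfl h'
            · rfl
      have hfin : (({.side v b false, .side v b true, .rung v, .rung (b :: v)} : Set Edge) ∩
        cut Y).Finite := Finite.inter_of_left (by simp) _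
      rw [h, symmDiff_comm, inter_comm, inter_symmDiff_distrib_left, inter_comm, inter_comm (cut Y),
        ncard_symmDiff_cast hfin ih.1, ncard_square_inter_cut, zero_add]
      exact ⟨hfin.symmDiff ih.1, ih.2⟩
  rcases z with v | x
  · exact hvertex v
  · obtain ⟨n, hn⟩ := hY x hz
    -- Beyond level `n` neither the ray nor the rungs on it meet the cut.
    have h : (seq x).leg ∩ cut Y = (vertex (initialSegment x n)).leg ∩ cut Y := by
      ext e
      refine and_congr_left fun heY => ?_
      have he := disjoint_left.1 hn heY
      rcases e with ⟨p, b, i⟩ | w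
      · have he' : ¬ initialSegment x n <:+ b :: p := he
        simp only [side_mem_leg, mem_path_vertex]
        refine ⟨fun hp => ?_, fun hp => eq_initialSegment_of_suffix hp⟩
        exact (suffix_or_suffix hp (initialSegment_mem_path x n)).resolve_right he'
      · simp only [rung_mem_leg, reduceCtorEq, vertex.injEq, false_iff]
        rintro rfl
        exact he List.suffix_rfl
    rw [h]
    exact hvertex _

theorem circuit_inter_boundedCut {Ψ : Set (ℕ → Bool)} {C D : Set Edge} (hC : C ∈ circuits Ψ)
    (hD : D ∈ boundedCuts Ψ) : (C ∩ D).Finite ∧ ((C ∩ D).ncard : ZMod 2) = 0 := by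
  obtain ⟨z, z', hz, hz', -, rfl⟩ := hC
  obtain ⟨-, ⟨Y, rfl⟩, hY⟩ := hD
  obtain ⟨h1, h2⟩ := ncard_leg_inter_cut hY hz
  obtain ⟨h1', h2'⟩ := ncard_leg_inter_cut hY hz'
  rw [inter_comm, inter_symmDiff_distrib_left, inter_comm, inter_comm (cut Y)]
  refine ⟨h1.symmDiff h1', ?_⟩
  rw [ncard_symmDiff_cast h1 h1', h2, h2']
  split_ifs <;> rfl

/-! ### Cuts around components without terminals -/

/-- If no terminal belongs to the component `S` of `v` in `P`, then there is a bounded cut avoiding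
`P` that consists of the rungs at `S` and of one of the two edges at each place where `S` can be
left. The vertices of `S` are coloured by the copy of `T₂` they belong to, and each component of the
complement of `S` has one colour. -/
theorem exists_boundedCut_of_forall_not_agreeOff {Ψ : Set (ℕ → Bool)} {P : Set Edge} {v : List Bool}
    (hv : ∀ z : Terminal, z.Valid Ψ → ¬ AgreeOff P z.leg (stem v)) :
    ∃ D ∈ boundedCuts Ψ, Disjoint D P ∧ Edge.rung v ∈ D ∧
      ∀ s b i, (AgreeOff P (stem (b :: s)) (stem v) ↔ ¬ AgreeOff P (stem s) (stem v)) →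
        Edge.side s b i ∉ P → (i = true → Edge.side s b false ∈ P) → Edge.side s b i ∈ D := by
  classical
  let S : List Bool → Prop := fun u => AgreeOff P (stem u) (stem v)
  have hstep : ∀ s b, (∀ i, Edge.side s b i ∈ P) → (S (b :: s) ↔ S s) := fun s b h =>
    ⟨fun h' => (agreeOff_stem_cons.2 h).symm.trans h', fun h' => (agreeOff_stem_cons.2 h).trans h'⟩
  have hleave : ∀ s b, S (b :: s) → ¬ S s → ∀ w, S w → b :: s <:+ w := by
    intro s b hs hns w hw
    by_contra hbw
    refine hns ((hstep s b fun i => ?_).1 hs)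
    by_contra hi
    exact hbw (((hs.trans hw.symm) _ hi).1 (side_mem_stem.2 List.suffix_rfl))
  obtain ⟨y₀, hy₀⟩ : ∃ y₀ : Bool, ∀ s b, S (b :: s) → ¬ S s →
      y₀ = decide (Edge.side s b false ∉ P) := by
    by_cases hex : ∃ s b, S (b :: s) ∧ ¬ S s
    · obtain ⟨s, b, h1, h2⟩ := hex
      refine ⟨decide (Edge.side s b false ∉ P), fun s' b' h1' h2' => ?_⟩
      have h3 := hleave s b h1 h2 _ h1'
      have h4 := hleave s' b' h1' h2' _ h1
      obtain ⟨rfl, rfl⟩ := List.cons.inj (h3.eq_of_length_le h4.length_le)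
      rfl
    · exact ⟨false, fun s b h1 h2 => absurd ⟨s, b, h1, h2⟩ hex⟩
  let out : List Bool → Bool := fun u => List.rec y₀
    (fun b s r => if S s then decide (Edge.side s b false ∉ P) else r) u
  have out_cons : ∀ b s, out (b :: s) =
    if S s then decide (Edge.side s b false ∉ P) else out s := fun _ _ => rfl
  let Y : List Bool → Bool → Bool := fun u i => if S u then i else out u
  have hout : ∀ s b, S (b :: s) → ¬ S s → out s = decide (Edge.side s b false ∉ P) := by
    intro s b h1 h2
    rw [← hy₀ s b h1 h2]
    have hlow : ∀ t, t <:+ s → out t = y₀ := by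
      intro t
      induction t with
      | nil => exact fun _ => rfl
      | cons c t ih =>
        intro ht
        have ht' : t <:+ s := (List.suffix_cons c t).trans ht
        rw [out_cons, if_neg, ih ht']
        intro hSt
        have := (hleave s b h1 h2 t hSt).length_le
        have := ht'.length_le
        simp at *
        omega
    exact hlow s List.suffix_rfl
  have hrung : ∀ u, Edge.rung u ∈ cut Y ↔ S u := by
    intro u
    by_cases h : S u <;> simp [Y, h]
  have hside : ∀ s b i, Edge.side s b i ∈ cut Y ↔
      (S (b :: s) ↔ ¬ S s) ∧ i ≠ decide (Edge.side s b false ∉ P) := by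
    intro s b i
    rw [side_mem_cut]
    by_cases h1 : S s <;> by_cases h2 : S (b :: s)
    · simp [Y, h1, h2]
    · simp [Y, h1, h2, out_cons]
    · simp only [Y, h1, h2, if_true, if_false, hout s b h2 h1, not_false_iff, true_and]
      exact ne_comm
    · simp [Y, h1, h2, out_cons]
  refine ⟨cut Y, ⟨⟨.rung v, (hrung v).2 (AgreeOff.refl _ _)⟩, ⟨Y, rfl⟩, fun x hx => ?_⟩,
    disjoint_left.2 ?_, (hrung v).2 (AgreeOff.refl _ _), fun s b i h hi hi' => ?_⟩
  · obtain ⟨n, hn, hSn⟩ : ∃ n, v.length < n ∧ ¬ S (initialSegment x n) := by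
      by_contra hcon
      push Not at hcon
      refine hv (seq x) hx ?_
      rintro (⟨s, b, i⟩ | w) he
      · have h := hcon (v.length + s.length + 1) (by omega) _ he
        rw [← h, side_mem_leg, side_mem_stem, mem_path_seq_iff_suffix]
        simp only [List.length_cons]
        omega
      · simp
    have hno : ∀ u, S u → ¬ initialSegment x n <:+ u := by
      intro u hu hxu
      refine hSn (hu.stem_between hxu ?_)
      rintro (⟨s, b, i⟩ | w) hev heu
      · refine List.suffix_of_suffix_length_le heu hxu ?_
        have := (show b :: s <:+ v from hev).length_le
        rw [length_initialSegment]
        omega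
      · exact hev
    refine ⟨n + 1, disjoint_left.2 ?_⟩
    rintro (⟨s, b, i⟩ | w) he hab
    · have hs : initialSegment x n <:+ s := by
        have hab' : x n :: initialSegment x n <:+ b :: s := hab
        rcases List.suffix_cons_iff.1 hab' with h | h
        · rw [(List.cons.inj h).2]
        · exact (List.suffix_cons _ _).trans h
      have h := ((hside s b i).1 he).1
      by_cases h1 : S s
      · exact hno s h1 hs
      · exact hno _ (h.2 h1) (hs.trans (List.suffix_cons _ _))
    · exact hno w ((hrung w).1 he) ((initialSegment_suffix x (Nat.le_succ n)).trans hab)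
  · rintro (⟨s, b, i⟩ | w) he heP
    · obtain ⟨h, hi⟩ := (hside s b i).1 he
      cases i with
      | false => simp [heP] at hi
      | true =>
        have hf : Edge.side s b false ∈ P := by simpa using hi
        have := hstep s b (fun j => by cases j <;> assumption)
        tauto
    · have hw := (hrung w).1 he
      refine hv (vertex w) trivial (AgreeOff.trans ?_ hw)
      rintro (⟨s, b, i⟩ | u) he'
      · simp
      · simp only [rung_mem_leg, vertex.injEq, rung_notMem_stem, iff_false]
        rintro rfl
        exact he' heP
  · refine (hside s b i).2 ⟨h, ?_⟩
    cases i with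
    | false => simp [hi]
    | true => simp [hi' rfl]

theorem circuits_or_boundedCuts (Ψ : Set (ℕ → Bool)) (P : Set Edge) (e : Edge) (he : e ∉ P) :
    (∃ C ∈ circuits Ψ, e ∈ C ∧ C ⊆ insert e P) ∨ ∃ D ∈ boundedCuts Ψ, e ∈ D ∧ Disjoint D P := by
  rcases e with ⟨s, b, i⟩ | v
  · by_cases hoth : Edge.side s b (!i) ∈ P
    · by_cases h1 : ∃ z : Terminal, z.Valid Ψ ∧ AgreeOff P z.leg (stem (b :: s))
      · by_cases h2 : ∃ z : Terminal, z.Valid Ψ ∧ AgreeOff P z.leg (stem s)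
        · obtain ⟨z, hz, hzs⟩ := h1
          obtain ⟨z', hz', hzs'⟩ := h2
          have hez : Edge.side s b i ∈ z.leg := (hzs _ he).2 (side_mem_stem.2 List.suffix_rfl)
          have hez' : Edge.side s b i ∉ z'.leg := fun h => by
            simpa using (side_mem_stem.1 ((hzs' _ he).1 h)).length_le
          refine Or.inl ⟨_, ⟨z, z', hz, hz', ?_, rfl⟩, Or.inl ⟨hez, hez'⟩, ?_⟩
          · rintro rfl
            exact hez' hez
          · rw [← AgreeOff.iff_symmDiff_subset]
            refine ((hzs.mono (subset_insert _ _)).trans ?_).trans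
              (hzs'.mono (subset_insert _ _)).symm
            rw [agreeOff_stem_cons]
            intro j
            by_cases hj : j = i
            · exact Or.inl (by rw [hj])
            · refine Or.inr ?_
              rwa [show j = !i by cases i <;> cases j <;> simp_all]
        · push Not at h2
          obtain ⟨D, hD, hDP, -, hside⟩ := exists_boundedCut_of_forall_not_agreeOff h2
          refine Or.inr ⟨D, hD, hside s b i ?_ he ?_, hDP⟩
          · refine iff_of_false (fun h => he (agreeOff_stem_cons.1 h i)) ?_
            exact not_not.2 (AgreeOff.refl _ _)
          · rintro rfl
            exact hoth
      · push Not at h1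
        obtain ⟨D, hD, hDP, -, hside⟩ := exists_boundedCut_of_forall_not_agreeOff h1
        refine Or.inr ⟨D, hD, hside s b i ?_ he ?_, hDP⟩
        · exact iff_of_true (AgreeOff.refl _ _) fun h => he (agreeOff_stem_cons.1 h.symm i)
        · rintro rfl
          exact hoth
    · -- The two edges below `b :: s` form a cut that avoids `P`.
      classical
      let Y : List Bool → Bool → Bool := fun u _ => decide (b :: s <:+ u)
      have hY : ∀ e ∈ cut Y, ∃ j, e = Edge.side s b j := by
        rintro (⟨t, c, j⟩ | w) h
        · refine ⟨j, ?_⟩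
          have h' : ¬ (b :: s <:+ t ↔ b :: s <:+ c :: t) := by simpa [Y] using h
          rw [List.suffix_cons_iff (l₂ := t)] at h'
          have h3 : b :: s = c :: t := by tauto
          obtain ⟨rfl, rfl⟩ := List.cons.inj h3
          rfl
        · exact absurd rfl h
      have hmem : ∀ j, Edge.side s b j ∈ cut Y := by
        intro j
        have hn : ¬ (b :: s <:+ s) := fun hs => by simpa using hs.length_le
        simp [Y, hn, List.suffix_rfl]
      refine Or.inr ⟨cut Y, ⟨⟨_, hmem i⟩, ⟨Y, rfl⟩, fun x _ => ⟨s.length + 2, ?_⟩⟩, hmem i, ?_⟩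
      · refine disjoint_left.2 fun e he' hab => ?_
        obtain ⟨j, rfl⟩ := hY e he'
        have := (side_mem_above.1 hab).length_le
        simp at this
      · refine disjoint_left.2 fun e he' heP => ?_
        obtain ⟨j, rfl⟩ := hY e he'
        by_cases hj : j = i
        · exact he (hj ▸ heP)
        · refine hoth ?_
          rwa [show (!i) = j by cases i <;> cases j <;> simp_all]
  · by_cases h : ∃ z : Terminal, z.Valid Ψ ∧ AgreeOff P z.leg (stem v)
    · obtain ⟨z, hz, hzv⟩ := h
      have hez : Edge.rung v ∉ z.leg := fun h => (hzv _ he).1 h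
      refine Or.inl ⟨_, ⟨z, vertex v, hz, trivial, ?_, rfl⟩, Or.inr ⟨rfl, hez⟩, ?_⟩
      · rintro rfl
        exact hez rfl
      · rw [← AgreeOff.iff_symmDiff_subset]
        refine (hzv.mono (subset_insert _ _)).trans ?_
        rintro (⟨t, c, j⟩ | w) hw
        · simp
        · simp only [rung_notMem_stem, rung_mem_leg, vertex.injEq, false_iff]
          rintro rfl
          exact hw (mem_insert _ _)
    · push Not at h
      obtain ⟨D, hD, hDP, hr, -⟩ := exists_boundedCut_of_forall_not_agreeOff h
      exact Or.inr ⟨D, hD, hr, hDP⟩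

/-! ### Maximal independent sets -/

theorem AgreeOff.exists_stem {J : Set Edge} {z z' : Terminal} (hne : z ≠ z')
    (h : AgreeOff J z.leg z'.leg) :
    ∃ u, AgreeOff J z.leg (stem u) ∧ AgreeOff J z'.leg (stem u) := by
  obtain ⟨u, hu⟩ := exists_meet hne
  have key : AgreeOff J z.leg (stem u) := by
    rintro (⟨s, b, i⟩ | t) he
    · rw [side_mem_leg, side_mem_stem, ← hu]
      exact ⟨fun hz => ⟨hz, (h _ he).1 hz⟩, fun hz => hz.1⟩
    · refine iff_of_false (fun hz => hne ?_) id
      exact Eq.trans hz ((h _ he).1 hz).symm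
  exact ⟨u, key, h.symm.trans key⟩

theorem stem_subset_leg {z : Terminal} {w : List Bool} (hw : w ∈ z.path) : stem w ⊆ z.leg := by
  rintro (⟨s, b, i⟩ | t) he
  · exact mem_path_of_suffix hw he
  · exact he.elim

/-- A terminal that is reached from `w` upwards within `X` is reached from all later vertices of the
path to it. -/
theorem AgreeOff.stem_of_mem_path {X : Set Edge} {z : Terminal} {w p : List Bool}
    (h : AgreeOff X z.leg (stem w)) (hwp : w <:+ p) (hp : p ∈ z.path) :
    AgreeOff X z.leg (stem p) :=
  fun e he => ⟨fun hz => stem_mono hwp ((h e he).1 hz), fun hz => stem_subset_leg hp hz⟩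

/-- Every independent subset `I` of `X` extends to a maximal one.

Each vertex `v` is assigned a terminal `α v` (if possible), from the root upwards: `v` inherits the
terminal of its parent when the edges to the parent are kept, and otherwise chooses a terminal above
it that can be reached within `X` along a path that does not pass through a component of `I`
containing another terminal. The edges to the parent are kept if they are in `I`, or if they
lead towards the terminal of the parent, or if there is no terminal above. So every component of the
resulting set has just the one terminal it has been assigned. -/
theorem exists_maximal_of_circuits (Ψ : Set (ℕ → Bool)) (I X : Set Edge) (hIX : I ⊆ X)
    (hI : ∀ C ∈ circuits Ψ, ¬ C ⊆ I) :
    ∃ J, I ⊆ J ∧ J ⊆ X ∧ (∀ C ∈ circuits Ψ, ¬ C ⊆ J) ∧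
      ∀ e ∈ X \ J, ∃ C ∈ circuits Ψ, C ⊆ insert e J := by
  classical
  have hIu : ∀ z z' : Terminal, z.Valid Ψ → z'.Valid Ψ → ∀ v, AgreeOff I z.leg (stem v) →
      AgreeOff I z'.leg (stem v) → z = z' := by
    intro z z' hz hz' v h h'
    by_contra hne
    exact hI _ ⟨z, z', hz, hz', hne, rfl⟩ (AgreeOff.iff_symmDiff_subset.1 (h.trans h'.symm))
  let Vis : List Bool → Terminal → Prop := fun v z => z.Valid Ψ ∧ v ∈ z.path ∧
    AgreeOff X z.leg (stem v) ∧ ∀ u ∈ z.path, v <:+ u → ∀ z' : Terminal, z'.Valid Ψ →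
      AgreeOff I z'.leg (stem u) → z' = z
  obtain ⟨Sel, sel_vis, vis_sel⟩ : ∃ Sel : List Bool → Option Terminal,
      (∀ v z, Sel v = some z → Vis v z) ∧ ∀ v, (∃ z, Vis v z) → ∃ z, Sel v = some z := by
    refine ⟨fun v => if h : ∃ z, Vis v z then some h.choose else none, fun v z h => ?_,
      fun v h => ⟨_, dif_pos h⟩⟩
    beta_reduce at h
    by_cases hex : ∃ z, Vis v z
    · rw [dif_pos hex] at h
      exact Option.some_inj.1 h ▸ hex.choose_spec
    · rw [dif_neg hex] at h
      simp at h
  -- A reachable terminal above `w` yields a visible one: go to the first component of `I` on the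
  -- way that has a terminal.
  have exists_vis : ∀ w, (∀ b s, w = b :: s → ∃ i, Edge.side s b i ∉ I) → ∀ z : Terminal,
      z.Valid Ψ → w ∈ z.path → AgreeOff X z.leg (stem w) → ∃ z', Vis w z' := by
    intro w hw z hz hwz hX
    by_cases hex : ∃ n, ∃ u ∈ z.path, w <:+ u ∧ u.length = n ∧
        ∃ z' : Terminal, z'.Valid Ψ ∧ AgreeOff I z'.leg (stem u)
    · obtain ⟨u, huz, hwu, hlen, z', hz', hz'u⟩ := Nat.find_spec hex
      have hmin := fun m hm => Nat.find_min hex (m := m) hm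
      rw [← hlen] at hmin
      have hwz' : w ∈ z'.path := by
        rcases w with _ | ⟨b, s⟩
        · exact nil_mem_path z'
        · obtain ⟨i, hi⟩ := hw b s rfl
          exact (hz'u _ hi).2 (side_mem_stem.2 hwu)
      refine ⟨z', hz', hwz', ?_, fun u' hu' hwu' z'' hz'' hz''u => ?_⟩
      · exact ((hz'u.mono hIX).trans (hX.stem_of_mem_path hwu huz).symm).trans hX
      · by_cases huu : u' <:+ u
        · rcases huu.length_le.lt_or_eq with hlt | heq
          · exact absurd ⟨u', mem_path_of_suffix huz huu, hwu', rfl, z'', hz'', hz''u⟩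
              (hmin _ hlt)
          · rw [huu.eq_of_length heq] at hz''u
            exact hIu _ _ hz'' hz' _ hz''u hz'u
        · refine hIu _ _ hz'' hz' u' hz''u fun e he => ⟨fun hez => ?_, fun hes =>
            stem_subset_leg hu' hes⟩
          have hes := (hz'u e he).1 hez
          rcases e with ⟨t, c, i⟩ | t
          · refine (suffix_or_suffix hez hu').resolve_right fun h => huu (h.trans hes)
          · exact hes
    · push Not at hex
      exact ⟨z, hz, hwz, hX, fun u hu hwu z' hz' h => absurd h (hex _ u hu hwu rfl z' hz')⟩
  let Keep : Bool → List Bool → Option Terminal → Prop := fun b s a =>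
    (∀ i, Edge.side s b i ∈ X) ∧ ((∀ i, Edge.side s b i ∈ I) ∨
      (∃ z, a = some z ∧ b :: s ∈ z.path) ∨ Sel (b :: s) = none)
  let α : List Bool → Option Terminal := fun v => List.rec (Sel [])
    (fun b s a => if Keep b s a then a else Sel (b :: s)) v
  have α_cons : ∀ b s, α (b :: s) = if Keep b s (α s) then α s else Sel (b :: s) :=
    fun _ _ => rfl
  -- Where the connection to the parent is cut, just one of the two edges remains.
  let J : Set Edge := {e | e ∈ X ∧
    match e with
    | .side s b i => ((∀ j, Edge.side s b j ∈ X) → Keep b s (α s)) ∨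
        (i = false ↔ Edge.side s b false ∈ I)
    | .rung v => .rung v ∈ I ∨ α v = some (vertex v)}
  have hJX : J ⊆ X := fun e he => he.1
  have hJside : ∀ s b i, Edge.side s b i ∈ J ↔ Edge.side s b i ∈ X ∧
    (((∀ j, Edge.side s b j ∈ X) → Keep b s (α s)) ∨
      (i = false ↔ Edge.side s b false ∈ I)) := fun _ _ _ => Iff.rfl
  have hJrung : ∀ v, Edge.rung v ∈ J ↔ Edge.rung v ∈ X ∧
    (Edge.rung v ∈ I ∨ α v = some (vertex v)) := fun _ => Iff.rfl
  have hIJ : I ⊆ J := by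
    rintro (⟨s, b, i⟩ | v) he
    · refine ⟨hIX he, ?_⟩
      by_cases hk : ∀ j, Edge.side s b j ∈ I
      · exact Or.inl fun h => ⟨h, Or.inl hk⟩
      · refine Or.inr ?_
        cases i with
        | false => simpa using he
        | true =>
          refine iff_of_false (by simp) fun hf => hk fun j => ?_
          cases j <;> assumption
    · exact ⟨hIX he, Or.inl he⟩
  have hJkeep : ∀ s b, (∀ i, Edge.side s b i ∈ J) ↔ Keep b s (α s) := by
    refine fun s b => ⟨fun h => ?_, fun h i => (hJside s b i).2 ⟨h.1 i, Or.inl fun _ => h⟩⟩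
    by_contra hk
    have hX : ∀ j, Edge.side s b j ∈ X := fun j => hJX (h j)
    have h0 := ((hJside s b false).1 (h false)).2.resolve_left fun h' => hk (h' hX)
    have h1 := ((hJside s b true).1 (h true)).2.resolve_left fun h' => hk (h' hX)
    simp only [true_iff, reduceCtorEq, false_iff] at h0 h1
    exact h1 h0
  have exists_top : ∀ v, ∃ w, w <:+ v ∧ AgreeOff J (stem w) (stem v) ∧ α w = Sel w ∧ α v = Sel w ∧
      ∀ b s, w = b :: s → ∃ i, Edge.side s b i ∉ J := by
    intro v
    induction v with
    | nil => exact ⟨[], List.suffix_rfl, AgreeOff.refl _ _, rfl, rfl, by simp⟩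
    | cons b s ih =>
      by_cases hk : Keep b s (α s)
      · obtain ⟨w, h1, h2, h3, h4, h5⟩ := ih
        refine ⟨w, h1.trans (List.suffix_cons _ _),
          h2.trans (agreeOff_stem_cons.2 ((hJkeep s b).2 hk)).symm, h3, ?_, h5⟩
        rw [α_cons, if_pos hk, h4]
      · have hα : α (b :: s) = Sel (b :: s) := by rw [α_cons, if_neg hk]
        refine ⟨b :: s, List.suffix_rfl, AgreeOff.refl _ _, hα, hα, fun b' s' h => ?_⟩
        obtain ⟨rfl, rfl⟩ := List.cons.inj h
        by_contra hcon
        push Not at hcon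
        exact hk ((hJkeep _ _).1 hcon)
  have α_congr : ∀ t v, AgreeOff J (stem t) (stem v) → α t = α v := by
    intro t v h
    obtain ⟨w, -, h2, -, h4, h5⟩ := exists_top t
    obtain ⟨w', -, h2', -, h4', h5'⟩ := exists_top v
    have hww : AgreeOff J (stem w) (stem w') := (h2.trans h).trans h2'.symm
    have hle : ∀ p q : List Bool, AgreeOff J (stem p) (stem q) →
        (∀ b s, p = b :: s → ∃ i, Edge.side s b i ∉ J) → p <:+ q := by
      rintro (_ | ⟨b, s⟩) q hpq hp
      · exact List.nil_suffix
      · obtain ⟨i, hi⟩ := hp b s rfl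
        exact (hpq _ hi).1 (side_mem_stem.2 List.suffix_rfl)
    rw [h4, h4', (hle w w' hww h5).eq_of_length_le (hle w' w hww.symm h5').length_le]
  have mem_path_top : ∀ w, (∀ b s, w = b :: s → ∃ i, Edge.side s b i ∉ J) → ∀ z : Terminal,
      AgreeOff J z.leg (stem w) → w ∈ z.path := by
    rintro (_ | ⟨b, s⟩) hw z hz
    · exact nil_mem_path z
    · obtain ⟨i, hi⟩ := hw b s rfl
      exact (hz _ hi).2 (side_mem_stem.2 List.suffix_rfl)
  have top_I : ∀ w, (∀ b s, w = b :: s → ∃ i, Edge.side s b i ∉ J) →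
      ∀ b s, w = b :: s → ∃ i, Edge.side s b i ∉ I := fun w hw b s h =>
    (hw b s h).imp fun i hi hiI => hi (hIJ hiI)
  -- The only terminal in a component of `J` is the assigned one,
  have α_of_agree : ∀ (z : Terminal) v, z.Valid Ψ → AgreeOff J z.leg (stem v) → α v = some z := by
    intro z v hz hzv
    obtain ⟨w, hwv, hw, hw1, hw2, hw3⟩ := exists_top v
    have hzw : AgreeOff J z.leg (stem w) := hzv.trans hw.symm
    have hwz := mem_path_top w hw3 z hzw
    obtain ⟨z₀, hz₀⟩ := vis_sel w (exists_vis w (top_I w hw3) z hz hwz (hzw.mono hJX))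
    have hvis := sel_vis w z₀ hz₀
    have hα : ∀ t, w <:+ t → t ∈ z.path → α t = some z₀ := fun t hwt ht => by
      rw [α_congr t w ((hzw.stem_of_mem_path hwt ht).symm.trans hzw), hw1, hz₀]
    rw [hw2, hz₀, Option.some_inj]
    by_contra hne
    obtain ⟨u, hu⟩ := exists_meet (Ne.symm hne)
    have hwu : w <:+ u := (hu w).1 ⟨hwz, hvis.2.1⟩
    have huz := (hu u).2 List.suffix_rfl
    refine hne (hvis.2.2.2 u huz.2 hwu z hz ?_).symm
    rintro (⟨s, b, i⟩ | t) he
    · rw [side_mem_leg, side_mem_stem, ← hu]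
      refine ⟨fun hsz => ⟨hsz, ?_⟩, fun h => h.1⟩
      by_contra hsz₀
      have hnw : ¬ b :: s <:+ w := fun h => hsz₀ (mem_path_of_suffix hvis.2.1 h)
      have hws : w <:+ s := by
        rcases List.suffix_cons_iff.1 ((suffix_or_suffix hwz hsz).resolve_right hnw) with h | h
        · exact absurd (h ▸ List.suffix_rfl) hnw
        · exact h
      have hk : Keep b s (α s) := by
        refine (hJkeep s b).1 fun j => ?_
        by_contra hj
        exact hnw ((hzw _ hj).1 hsz)
      rw [hα s hws (mem_path_of_suffix hsz (List.suffix_cons _ _))] at hk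
      rcases hk.2 with h | ⟨y, hy, hsy⟩ | h
      · exact he (h i)
      · exact hsz₀ (Option.some_inj.1 hy ▸ hsy)
      · obtain ⟨y, hy⟩ := vis_sel (b :: s) (exists_vis (b :: s) (fun b' s' h' => by
          obtain ⟨rfl, rfl⟩ := List.cons.inj h'
          exact ⟨i, he⟩) z hz hsz
          ((hzw.stem_of_mem_path (hws.trans (List.suffix_cons _ _)) hsz).mono hJX))
        rw [h] at hy
        simp at hy
    · refine iff_of_false (fun ht => ?_) id
      have htJ : Edge.rung t ∈ J := Classical.byContradiction fun htJ => (hzw _ htJ).1 ht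
      have htz : t ∈ z.path := by
        rw [show z = vertex t from ht]
        exact List.suffix_rfl
      have hwt : w <:+ t := by
        have := hwz
        rwa [show z = vertex t from ht] at this
      have h := ((hJrung t).1 htJ).2.resolve_left he
      rw [hα t hwt htz] at h
      exact hne ((Option.some_inj.1 h).trans (Eq.symm ht))
  -- and it is indeed there.
  have agree_of_α : ∀ (z : Terminal) v, α v = some z →
      z.Valid Ψ ∧ AgreeOff J z.leg (stem v) := by
    intro z v hzv
    obtain ⟨w, hwv, hw, hw1, hw2, hw3⟩ := exists_top v
    rw [hw2] at hzv
    have hvis := sel_vis w z hzv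
    have hup : ∀ p ∈ z.path, w <:+ p → α p = some z ∧ AgreeOff J (stem p) (stem w) := by
      intro p
      induction p with
      | nil =>
        intro _ hwp
        rw [List.suffix_nil.1 hwp] at hw1 hzv ⊢
        exact ⟨hw1.trans hzv, AgreeOff.refl _ _⟩
      | cons b s ih =>
        intro hp hwp
        by_cases hws : w = b :: s
        · rw [← hws]
          exact ⟨hw1.trans hzv, AgreeOff.refl _ _⟩
        · have hws' : w <:+ s := (List.suffix_cons_iff.1 hwp).resolve_left hws
          obtain ⟨h1, h2⟩ := ih (mem_path_of_suffix hp (List.suffix_cons _ _)) hws'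
          have hk : Keep b s (α s) := by
            refine ⟨fun i => ?_, Or.inr (Or.inl ⟨z, h1, hp⟩)⟩
            by_contra hi
            exact hws (hwp.eq_of_length_le ((hvis.2.2.1 _ hi).1 hp).length_le)
          exact ⟨by rw [α_cons, if_pos hk, h1],
            (agreeOff_stem_cons.2 ((hJkeep s b).2 hk)).trans h2⟩
    refine ⟨hvis.1, AgreeOff.trans (B := stem w) ?_ hw⟩
    rintro (⟨s, b, i⟩ | t) he
    · refine ⟨fun hs => ?_, fun hs => stem_subset_leg hvis.2.1 hs⟩
      rcases suffix_or_suffix hs hvis.2.1 with h | h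
      · exact h
      · exact ((hup _ hs h).2 _ he).1 (side_mem_stem.2 List.suffix_rfl)
    · refine iff_of_false (fun ht => he ?_) id
      have htz : t ∈ z.path := by
        rw [show z = vertex t from ht]
        exact List.suffix_rfl
      have hwt : w <:+ t := by
        have := hvis.2.1
        rwa [show z = vertex t from ht] at this
      refine (hJrung t).2 ⟨?_, Or.inr ?_⟩
      · by_contra htX
        exact (hvis.2.2.1 _ htX).1 ht
      · rw [(hup t htz hwt).1]
        exact congrArg some ht
  have α_of_reach : ∀ (z : Terminal) v, z.Valid Ψ → v ∈ z.path → AgreeOff X z.leg (stem v) →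
      ∃ z', α v = some z' := by
    intro z v hz hv hzv
    obtain ⟨w, hwv, hw, hw1, hw2, hw3⟩ := exists_top v
    rw [hw2]
    exact vis_sel w (exists_vis w (top_I w hw3) z hz (mem_path_of_suffix hv hwv)
      (hzv.trans (hw.mono hJX).symm))
  refine ⟨J, hIJ, hJX, ?_, ?_⟩
  · rintro C ⟨z, z', hz, hz', hne, rfl⟩ hCJ
    obtain ⟨u, hu, hu'⟩ := (AgreeOff.iff_symmDiff_subset.2 hCJ).exists_stem hne
    have h := α_of_agree z u hz hu
    rw [α_of_agree z' u hz' hu'] at h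
    exact hne (Option.some_inj.1 h).symm
  · rintro (⟨s, b, i⟩ | v) ⟨heX, heJ⟩
    · have hcut : ¬ (((∀ j, Edge.side s b j ∈ X) → Keep b s (α s)) ∨
          (i = false ↔ Edge.side s b false ∈ I)) := fun h => heJ ((hJside s b i).2 ⟨heX, h⟩)
      rw [not_or, Classical.not_imp] at hcut
      obtain ⟨⟨hX, hk⟩, hi⟩ := hcut
      have hk' : ¬ ∀ j, Edge.side s b j ∈ I := fun h => hk ⟨hX, Or.inl h⟩
      have hsel : Sel (b :: s) ≠ none := fun h => hk ⟨hX, Or.inr (Or.inr h)⟩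
      obtain ⟨z, hz⟩ := Option.ne_none_iff_exists'.1 hsel
      have hvis := sel_vis _ _ hz
      have hαz : α (b :: s) = some z := by rw [α_cons, if_neg hk, hz]
      obtain ⟨z', hz'⟩ := α_of_reach z s hvis.1
        (mem_path_of_suffix hvis.2.1 (List.suffix_cons _ _))
        (hvis.2.2.1.trans (agreeOff_stem_cons.2 hX))
      have hzz : z ≠ z' := fun h => hk ⟨hX, Or.inr (Or.inl ⟨z', hz', h ▸ hvis.2.1⟩)⟩
      obtain ⟨h1, h2⟩ := agree_of_α z (b :: s) hαz
      obtain ⟨h1', h2'⟩ := agree_of_α z' s hz'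
      refine ⟨_, ⟨z, z', h1, h1', hzz, rfl⟩, AgreeOff.iff_symmDiff_subset.1 ?_⟩
      refine ((h2.mono (subset_insert _ _)).trans ?_).trans (h2'.mono (subset_insert _ _)).symm
      refine agreeOff_stem_cons.2 fun j => ?_
      by_cases hj : j = i
      · exact Or.inl (by rw [hj])
      · refine Or.inr ((hJside s b j).2 ⟨hX j, Or.inr ?_⟩)
        have hij : j = false ↔ ¬ i = false := by cases i <;> cases j <;> simp at hj ⊢
        exact hij.trans (not_iff.1 hi)
    · have hv : v ∈ (vertex v).path := List.suffix_rfl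
      have hagree : ∀ K : Set Edge, Edge.rung v ∈ K → AgreeOff K (vertex v).leg (stem v) := by
        rintro K hK (⟨s, b, i⟩ | t) ht
        · simp
        · refine iff_of_false (fun h => ht ?_) id
          obtain rfl : v = t := by simpa using h
          exact hK
      obtain ⟨z, hz⟩ := α_of_reach (vertex v) v trivial hv (hagree X heX)
      have hne : z ≠ vertex v := fun h => heJ ((hJrung v).2 ⟨heX, Or.inr (by rw [hz, h])⟩)
      obtain ⟨h1, h2⟩ := agree_of_α z v hz
      exact ⟨_, ⟨z, vertex v, h1, trivial, hne, rfl⟩, AgreeOff.iff_symmDiff_subset.1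
        ((h2.mono (subset_insert _ _)).trans (hagree _ (mem_insert _ _)).symm)⟩

/-! ### The matroid on the edges of `T₂ × K₂` -/

theorem symmDiff_leg_nonempty {z z' : Terminal} (h : z ≠ z') :
    (symmDiff z.leg z'.leg).Nonempty := by
  by_contra hcon
  rw [not_nonempty_iff_eq_empty] at hcon
  obtain ⟨u, hu, -⟩ := (AgreeOff.iff_symmDiff_subset.2 hcon.subset).exists_stem h
  rcases z with v | x
  · exact (hu (.rung v) (notMem_empty _)).1 rfl
  · have hx := (hu (.side (initialSegment x u.length) (x u.length) true) (notMem_empty _)).1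
      (initialSegment_mem_path x (u.length + 1))
    simpa using (side_mem_stem.1 hx).length_le

theorem orthogonalPair (Ψ : Set (ℕ → Bool)) : OrthogonalPair (circuits Ψ) (boundedCuts Ψ) where
  nonempty_left := by
    rintro C ⟨z, z', -, -, h, rfl⟩
    exact symmDiff_leg_nonempty h
  nonempty_right := fun D hD => hD.1
  inter_ne := by
    intro C hC D hD e he
    have := (circuit_inter_boundedCut hC hD).2
    rw [he, ncard_singleton] at this
    simp at this
  exists_or := circuits_or_boundedCuts Ψ
  exists_maximal := exists_maximal_of_circuits Ψ

/-- The `Ψ`-matroid of `T₂ × K₂`, on the type `Edge`. -/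
def edgeMatroid (Ψ : Set (ℕ → Bool)) : Matroid Edge := (orthogonalPair Ψ).matroid

/-! ### The circle -/

theorem isPreconnected_compl_singleton_circle (z : Circle) : IsPreconnected ({z}ᶜ : Set Circle) := by
  have h : ({z}ᶜ : Set Circle) =
      (fun t : ℝ => z * Circle.exp Real.pi * Circle.exp t) '' Ioo (-Real.pi) Real.pi := by
    ext w
    constructor
    · intro hw
      refine ⟨Complex.arg ((z * Circle.exp Real.pi)⁻¹ * w : Circle), ⟨Complex.neg_pi_lt_arg _,
        (Complex.arg_le_pi _).lt_of_ne fun h => hw ?_⟩, ?_⟩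
      · have h' : (z * Circle.exp Real.pi)⁻¹ * w = Circle.exp Real.pi := by
          have h3 := Circle.exp_arg ((z * Circle.exp Real.pi)⁻¹ * w)
          rw [h] at h3
          exact h3.symm
        have h2 : w = z * (Circle.exp Real.pi * Circle.exp Real.pi) := by
          rw [← mul_assoc]
          exact inv_mul_eq_iff_eq_mul.1 h'
        rw [← Circle.exp_add, show Real.pi + Real.pi = 2 * Real.pi by ring, Circle.exp_two_pi,
          mul_one] at h2
        exact h2
      · simp only [Circle.exp_arg]
        exact mul_inv_cancel_left _ _
    · rintro ⟨t, ht, rfl⟩ h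
      have h' : z * Circle.exp (Real.pi + t) = z := by
        rw [Circle.exp_add, ← mul_assoc]
        exact h
      have h1 : Circle.exp (Real.pi + t) = 1 := mul_eq_left.1 h'
      obtain ⟨n, hn⟩ := Circle.exp_eq_one.1 h1
      have hpi := Real.pi_pos
      have h0 : (0 : ℝ) < n := by
        by_contra hle
        push Not at hle
        nlinarith [ht.1]
      have h2 : (n : ℝ) < 1 := by
        by_contra hle
        push Not at hle
        nlinarith [ht.2]
      have h0' : (0 : ℤ) < n := by exact_mod_cast h0
      have h2' : n < 1 := by exact_mod_cast h2
      omega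
  rw [h]
  exact isPreconnected_Ioo.image _ (by fun_prop)

theorem not_injective_of_continuous_circle_real {g : Circle → ℝ} (hg : Continuous g) :
    ¬ Function.Injective g := by
  intro hinj
  -- No value can lie strictly between two others.
  have key : ∀ a b c : Circle, ¬ (g a < g c ∧ g c < g b) := by
    rintro a b c ⟨h1, h2⟩
    have hconn := ((isPreconnected_compl_singleton_circle c).image g hg.continuousOn).ordConnected
    have ha : a ∈ ({c}ᶜ : Set Circle) := fun h => h1.ne (congrArg g h)
    have hb : b ∈ ({c}ᶜ : Set Circle) := fun h => h2.ne' (congrArg g h)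
    obtain ⟨d, hd, hdc⟩ := hconn.out ⟨a, ha, rfl⟩ ⟨b, hb, rfl⟩ ⟨h1.le, h2.le⟩
    exact hd (hinj hdc)
  have hpi := Real.pi_pos
  have hI : ∀ s t : ℝ, s ∈ Ioc (-Real.pi) Real.pi → t ∈ Ioc (-Real.pi) Real.pi →
      Circle.exp s = Circle.exp t → s = t := fun s t hs ht h => by
    rw [← Circle.arg_exp hs.1 hs.2, ← Circle.arg_exp ht.1 ht.2, h]
  have m0 : (0 : ℝ) ∈ Ioc (-Real.pi) Real.pi := ⟨by linarith, hpi.le⟩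
  have m1 : (1 : ℝ) ∈ Ioc (-Real.pi) Real.pi := ⟨by linarith, by linarith [Real.pi_gt_three]⟩
  have m2 : (2 : ℝ) ∈ Ioc (-Real.pi) Real.pi := ⟨by linarith, by linarith [Real.pi_gt_three]⟩
  have h01 : g (Circle.exp 0) ≠ g (Circle.exp 1) := fun h => by
    have := hI _ _ m0 m1 (hinj h)
    norm_num at this
  have h02 : g (Circle.exp 0) ≠ g (Circle.exp 2) := fun h => by
    have := hI _ _ m0 m2 (hinj h)
    norm_num at this
  have h12 : g (Circle.exp 1) ≠ g (Circle.exp 2) := fun h => by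
    have := hI _ _ m1 m2 (hinj h)
    norm_num at this
  rcases h01.lt_or_gt with h | h <;> rcases h02.lt_or_gt with h' | h' <;>
    rcases h12.lt_or_gt with h'' | h''
  · exact key _ _ _ ⟨h, h''⟩
  · exact key _ _ _ ⟨h', h''⟩
  · exact key _ _ _ ⟨h', h⟩
  · exact key _ _ _ ⟨h', h⟩
  · exact key _ _ _ ⟨h, h'⟩
  · exact key _ _ _ ⟨h, h'⟩
  · exact key _ _ _ ⟨h'', h'⟩
  · exact key _ _ _ ⟨h'', h⟩

theorem surjective_of_continuous_injective_circle {f : Circle → Circle} (hf : Continuous f)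
    (hinj : Function.Injective f) : Function.Surjective f := by
  intro z
  by_contra hz
  push Not at hz
  let φ : Circle → Circle := fun w => (z * Circle.exp Real.pi)⁻¹ * f w
  have hφ : Continuous φ := by fun_prop
  have hslit : ∀ w, ((φ w : Circle) : ℂ) ∈ Complex.slitPlane := by
    intro w
    rw [Complex.mem_slitPlane_iff_arg]
    refine ⟨fun h => hz w ?_, Circle.coe_ne_zero _⟩
    have h' : φ w = Circle.exp Real.pi := by rw [← h, Circle.exp_arg]
    have h2 : f w = z * (Circle.exp Real.pi * Circle.exp Real.pi) := by
      rw [← mul_assoc]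
      exact inv_mul_eq_iff_eq_mul.1 h'
    rw [← Circle.exp_add, show Real.pi + Real.pi = 2 * Real.pi by ring, Circle.exp_two_pi,
      mul_one] at h2
    exact h2
  refine not_injective_of_continuous_circle_real (g := fun w => Complex.arg (φ w)) ?_ ?_
  · rw [continuous_iff_continuousAt]
    exact fun w => ContinuousAt.comp (f := fun w => ((φ w : Circle) : ℂ))
      (Complex.continuousAt_arg (hslit w)) (continuous_subtype_val.comp hφ).continuousAt
  · intro w w' h
    exact hinj (mul_left_cancel (Circle.injective_arg h))

/-- A topological circle is not properly contained in another one. -/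
theorem eq_of_subset_of_homeomorph_circle {T : Type*} [TopologicalSpace T] {A B : Set T}
    (hAB : A ⊆ B) (hA : A ≃ₜ Circle) (hB : B ≃ₜ Circle) : A = B := by
  let f : Circle → Circle := fun z => hB (inclusion hAB (hA.symm z))
  have hf : Continuous f := hB.continuous.comp ((continuous_inclusion hAB).comp hA.symm.continuous)
  have hinj : Function.Injective f :=
    hB.injective.comp ((inclusion_injective hAB).comp hA.symm.injective)
  refine subset_antisymm hAB fun b hb => ?_
  obtain ⟨z, hz⟩ := surjective_of_continuous_injective_circle hf hinj (hB ⟨b, hb⟩)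
  have h := hB.injective hz
  have h' : ((hA.symm z : A) : T) = b := congrArg Subtype.val h
  exact h' ▸ (hA.symm z).2

/-! ### The topology of `|G|_Ψ` -/

section PsiSpace

variable {V : Type*} {G : SimpleGraph V} {Ψ : Set G.end}

/-- A point of the 1-complex as a point of `|G|_Ψ`. -/
def psiPt (Ψ : Set G.end) (x : ComplexPoint G) : psiSpace G Ψ := ⟨.pt x, fun _ h => by cases h⟩

/-- An end in `Ψ` as a point of `|G|_Ψ`. -/
def psiEnd (ω : G.end) (h : ω ∈ Ψ) : psiSpace G Ψ := ⟨.atEnd ω, fun η e => by cases e; exact h⟩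

theorem psiPt_injective : Function.Injective (psiPt Ψ) := by
  intro x y h
  have := congrArg Subtype.val h
  simpa [psiPt] using this

theorem psiSpace_cases (p : psiSpace G Ψ) :
    (∃ x, p = psiPt Ψ x) ∨ ∃ ω, ∃ h : ω ∈ Ψ, p = psiEnd ω h := by
  obtain ⟨x | ω, hp⟩ := p
  · exact Or.inl ⟨x, rfl⟩
  · exact Or.inr ⟨ω, hp ω rfl, rfl⟩

theorem isOpen_psiSpace_iff {A : Set (psiSpace G Ψ)} : IsOpen A ↔
    (∀ x, psiPt Ψ x ∈ A → ∃ ε : ℝ, 0 < ε ∧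
      ∀ y : ComplexPoint G, (∀ v, |y.coord v - x.coord v| < ε) → psiPt Ψ y ∈ A) ∧
    ∀ ω, ∀ h : ω ∈ Ψ, psiEnd ω h ∈ A →
      ∃ S : Finset V, ∀ q : psiSpace G Ψ, q.1 ∈ endNhd S ω → q ∈ A := by
  constructor
  · rintro ⟨U, ⟨hU, hU'⟩, rfl⟩
    refine ⟨fun x hx => ?_, fun ω h hω => ?_⟩
    · obtain ⟨ε, hε, h⟩ := hU x hx
      exact ⟨ε, hε, fun y hy => h y hy⟩
    · obtain ⟨S, h⟩ := hU' ω hω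
      exact ⟨S, fun q hq => h hq⟩
  · rintro ⟨h1, h2⟩
    choose! S hS using h2
    refine ⟨{p | (∃ x, p = .pt x ∧ psiPt Ψ x ∈ A) ∨
      ∃ ω, ∃ h : ω ∈ Ψ, psiEnd ω h ∈ A ∧ p ∈ endNhd (S ω) ω}, ⟨?_, ?_⟩, ?_⟩
    · rintro x (⟨x', hx', hx⟩ | ⟨ω, h, hω, hx⟩)
      · cases hx'
        obtain ⟨ε, hε, hy⟩ := h1 x hx
        exact ⟨ε, hε, fun y hxy => Or.inl ⟨y, rfl, hy y hxy⟩⟩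
      · rcases hx with ⟨x', hx', v, hv, hxv⟩ | ⟨η, hη, -⟩
        · cases hx'
          refine ⟨|x.coord v|, abs_pos.2 hxv, fun y hy => Or.inr ⟨ω, h, hω, Or.inl
            ⟨y, rfl, v, hv, fun h0 => ?_⟩⟩⟩
          have := hy v
          rw [h0, zero_sub, abs_neg] at this
          exact this.false
        · cases hη
    · rintro ω (⟨x', hx', hx⟩ | ⟨η, h, hη, hx⟩)
      · cases hx'
      · rcases hx with ⟨x', hx', -⟩ | ⟨ω', hω', he⟩
        · cases hx'
        · cases hω'
          refine ⟨S η, fun p hp => Or.inr ⟨η, h, hη, ?_⟩⟩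
          simp only [endNhd, mem_ofPred_eq, he] at hp ⊢
          exact hp
    · ext p
      constructor
      · rintro (⟨x, hx, hxA⟩ | ⟨ω, h, hω, hp⟩)
        · rwa [show p = psiPt Ψ x from Subtype.ext hx]
        · exact hS ω h hω p hp
      · intro hp
        rcases psiSpace_cases p with ⟨x, rfl⟩ | ⟨ω, h, rfl⟩
        · exact Or.inl ⟨x, rfl, hp⟩
        · exact Or.inr ⟨ω, h, hp, Or.inr ⟨ω, rfl, rfl⟩⟩

theorem tendsto_psiPt {T : Type*} {l : Filter T} {F : T → psiSpace G Ψ} {x : ComplexPoint G}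
    (h : ∀ ε : ℝ, 0 < ε → ∀ᶠ t in l, ∃ y, F t = psiPt Ψ y ∧ ∀ v, |y.coord v - x.coord v| < ε) :
    Filter.Tendsto F l (nhds (psiPt Ψ x)) := by
  intro U hU
  obtain ⟨A, hAU, hA, hx⟩ := mem_nhds_iff.1 hU
  obtain ⟨ε, hε, hball⟩ := (isOpen_psiSpace_iff.1 hA).1 x hx
  change ∀ᶠ t in l, F t ∈ U
  filter_upwards [h ε hε] with t ⟨y, hy, hyx⟩
  refine hAU ?_
  rw [hy]
  exact hball y hyx

theorem tendsto_psiEnd {T : Type*} {l : Filter T} {F : T → psiSpace G Ψ} {ω : G.end} (hω : ω ∈ Ψ)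
    (h : ∀ S : Finset V, ∀ᶠ t in l, (F t).1 ∈ endNhd S ω) :
    Filter.Tendsto F l (nhds (psiEnd ω hω)) := by
  intro U hU
  obtain ⟨A, hAU, hA, hx⟩ := mem_nhds_iff.1 hU
  obtain ⟨S, hS⟩ := (isOpen_psiSpace_iff.1 hA).2 ω hω hx
  change ∀ᶠ t in l, F t ∈ U
  filter_upwards [h S] with t ht
  exact hAU (hS _ ht)

/-! ### Points of the 1-complex and the side of a cut they are on -/

theorem ComplexPoint.ext_coord {x y : ComplexPoint G} (h : ∀ v, x.coord v = y.coord v) : x = y := by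
  obtain ⟨cx, hx⟩ := x
  obtain ⟨cy, hy⟩ := y
  obtain rfl : cx = cy := funext h
  rfl

/-- The point on the edge `vw` with coordinate `t` at `w`. -/
noncomputable def edgePoint {v w : V} (h : G.Adj v w) (t : ℝ) (ht : t ∈ Ioo (0 : ℝ) 1) :
    ComplexPoint G where
  coord := by
    classical
    exact fun u => if u = v then 1 - t else if u = w then t else 0
  mem_complex := by
    refine Or.inr ⟨v, w, h, ?_⟩
    have := ht.1
    have := ht.2
    simp only [if_true, if_neg h.ne']
    refine ⟨by linarith, by linarith, by ring, fun x hv hw => ?_⟩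
    rw [if_neg hv, if_neg hw]

theorem edgePoint_coord_left {v w : V} (h : G.Adj v w) (t : ℝ) (ht : t ∈ Ioo (0 : ℝ) 1) :
    (edgePoint h t ht).coord v = 1 - t := by
  simp [edgePoint]

theorem edgePoint_coord_right {v w : V} (h : G.Adj v w) (t : ℝ) (ht : t ∈ Ioo (0 : ℝ) 1) :
    (edgePoint h t ht).coord w = t := by
  simp [edgePoint, h.ne']

theorem edgePoint_coord_ne_zero_iff {v w : V} (h : G.Adj v w) (t : ℝ) (ht : t ∈ Ioo (0 : ℝ) 1)
    (u : V) : (edgePoint h t ht).coord u ≠ 0 ↔ u ∈ s(v, w) := by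
  have h1 := ht.1
  have h2 := ht.2
  rw [Sym2.mem_iff]
  by_cases hv : u = v
  · subst hv
    rw [edgePoint_coord_left]
    exact iff_of_true (by linarith) (Or.inl rfl)
  by_cases hw : u = w
  · subst hw
    rw [edgePoint_coord_right]
    exact iff_of_true h1.ne' (Or.inr rfl)
  · simp [edgePoint, hv, hw]

theorem psiPt_edgePoint_mem {v w : V} (h : G.Adj v w) (t : ℝ) (ht : t ∈ Ioo (0 : ℝ) 1)
    {C : Set (Sym2 V)} (hC : s(v, w) ∈ C) : psiPt Ψ (edgePoint h t ht) ∈ edgePoints G Ψ C :=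
  ⟨_, rfl, _, hC, edgePoint_coord_ne_zero_iff h t ht⟩

/-- All points of the 1-complex have at most two nonzero coordinates, with sum one. -/
theorem ComplexPoint.exists_pair (x : ComplexPoint G) : ∃ A : Finset V, A.card ≤ 2 ∧
    (∀ v, x.coord v ≠ 0 → v ∈ A) ∧ ∑ v ∈ A, x.coord v = 1 := by
  classical
  rcases x.mem_complex with ⟨v, hv, h⟩ | ⟨v, w, hvw, -, -, hsum, h⟩
  · refine ⟨{v}, by simp, fun u hu => ?_, by simpa using hv⟩
    by_contra hne
    exact hu (h u (by simpa using hne))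
  · refine ⟨{v, w}, Finset.card_le_two, fun u hu => ?_, by rw [Finset.sum_pair hvw.ne, hsum]⟩
    by_contra hne
    simp only [Finset.mem_insert, Finset.mem_singleton, not_or] at hne
    exact hu (h u hne.1 hne.2)

/-- The total weight that a point of the 1-complex has in the vertex set `Y`. -/
noncomputable def mass (Y : Set V) (x : ComplexPoint G) : ℝ := ∑ᶠ v, Y.indicator x.coord v

theorem mass_eq_sum (Y : Set V) (x : ComplexPoint G) {A : Finset V}
    (hA : ∀ v, x.coord v ≠ 0 → v ∈ A) : mass Y x = ∑ v ∈ A, Y.indicator x.coord v := by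
  refine finsum_eq_sum_of_support_subset _ fun v hv => hA v fun h0 => hv ?_
  by_cases hvY : v ∈ Y
  · rw [indicator_of_mem hvY, h0]
  · rw [indicator_of_notMem hvY]

theorem mass_eq_one {Y : Set V} {x : ComplexPoint G} (h : ∀ v, x.coord v ≠ 0 → v ∈ Y) :
    mass Y x = 1 := by
  obtain ⟨A, -, hA, hsum⟩ := x.exists_pair
  rw [mass_eq_sum Y x hA, ← hsum]
  refine Finset.sum_congr rfl fun v _ => ?_
  by_cases hv : x.coord v = 0
  · by_cases hvY : v ∈ Y
    · rw [indicator_of_mem hvY]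
    · rw [indicator_of_notMem hvY, hv]
  · rw [indicator_of_mem (h v hv)]

theorem mass_eq_zero {Y : Set V} {x : ComplexPoint G} (h : ∀ v, x.coord v ≠ 0 → v ∉ Y) :
    mass Y x = 0 := by
  obtain ⟨A, -, hA, hsum⟩ := x.exists_pair
  rw [mass_eq_sum Y x hA]
  refine Finset.sum_eq_zero fun v _ => ?_
  by_cases hv : x.coord v = 0
  · by_cases hvY : v ∈ Y
    · rw [indicator_of_mem hvY, hv]
    · rw [indicator_of_notMem hvY]
  · rw [indicator_of_notMem (h v hv)]

theorem mass_eq_coord {Y : Set V} {x : ComplexPoint G} {v : V} (hv : v ∈ Y)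
    (h : ∀ u, x.coord u ≠ 0 → u ∈ Y → u = v) : mass Y x = x.coord v := by
  rw [mass, finsum_eq_single _ v, indicator_of_mem hv]
  intro u hu
  by_cases huY : u ∈ Y
  · rw [indicator_of_mem huY]
    by_contra h0
    exact hu (h u h0 huY)
  · rw [indicator_of_notMem huY]

theorem abs_mass_sub_le (Y : Set V) {x y : ComplexPoint G} {ε : ℝ}
    (h : ∀ v, |y.coord v - x.coord v| < ε) : |mass Y y - mass Y x| ≤ 4 * ε := by
  classical
  obtain ⟨A, hAc, hA, -⟩ := x.exists_pair
  obtain ⟨B, hBc, hB, -⟩ := y.exists_pair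
  rw [mass_eq_sum Y x (A := A ∪ B) fun v hv => Finset.mem_union_left _ (hA v hv),
    mass_eq_sum Y y (A := A ∪ B) fun v hv => Finset.mem_union_right _ (hB v hv),
    ← Finset.sum_sub_distrib]
  have hε : ∀ v ∈ A ∪ B, |Y.indicator y.coord v - Y.indicator x.coord v| ≤ ε := by
    intro v _
    by_cases hv : v ∈ Y
    · rw [indicator_of_mem hv, indicator_of_mem hv]
      exact (h v).le
    · rw [indicator_of_notMem hv, indicator_of_notMem hv, sub_zero, abs_zero]
      exact (abs_nonneg _).trans (h v).le
  refine (Finset.abs_sum_le_sum_abs _ _).trans ((Finset.sum_le_card_nsmul _ _ _ hε).trans ?_)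
  have hc : ((A ∪ B).card : ℝ) ≤ 4 := by
    exact_mod_cast (Finset.card_union_le A B).trans (by omega)
  rcases (A ∪ B).eq_empty_or_nonempty with he | ⟨v, -⟩
  · obtain ⟨v, -⟩ : ∃ v, x.coord v ≠ 0 := by
      rcases x.mem_complex with ⟨v, hv, -⟩ | ⟨v, w, -, hv, -⟩
      · exact ⟨v, by rw [hv]; exact one_ne_zero⟩
      · exact ⟨v, hv.ne'⟩
    rw [he]
    have := (abs_nonneg _).trans (h v).le
    simpa using this
  · have := (abs_nonneg _).trans (h v).le
    rw [nsmul_eq_mul]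
    exact mul_le_mul_of_nonneg_right hc this

/-- Near the end `ω` there are no edges between `Y` and its complement. -/
def TameAt (Y : Set V) (ω : G.end) : Prop :=
  ∃ S : Finset V, (∀ v ∈ endComponent S ω, ∀ w, G.Adj v w → (v ∈ Y ↔ w ∈ Y)) ∧
    (endComponent S ω ⊆ Y ∨ Disjoint (endComponent S ω) Y)

open Classical in
/-- The function on `|G|_Ψ` that is `1` at the vertices of `Y`, `0` at the other vertices, and
linear on edges. At the ends near which `Y` is tame it takes the value `1` or `0`. -/
noncomputable def height (Y : Set V) (p : psiSpace G Ψ) : ℝ :=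
  match p.1 with
  | .pt x => mass Y x
  | .atEnd ω => if ∃ S : Finset V, endComponent S ω ⊆ Y then 1 else 0

@[simp] theorem height_psiPt (Y : Set V) (x : ComplexPoint G) :
    height Y (psiPt Ψ x) = mass Y x := rfl

theorem height_psiEnd_of_subset {Y : Set V} {ω : G.end} (h : ω ∈ Ψ) {S : Finset V}
    (hS : endComponent S ω ⊆ Y) : height Y (psiEnd ω h) = 1 :=
  if_pos ⟨S, hS⟩

theorem height_psiEnd_of_disjoint {Y : Set V} {ω : G.end} (h : ω ∈ Ψ) {S : Finset V}
    (hS : Disjoint (endComponent S ω) Y) : height Y (psiEnd ω h) = 0 := by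
  classical
  refine if_neg ?_
  rintro ⟨S', hS'⟩
  obtain ⟨v, hv⟩ := endComponent_nonempty (S ∪ S') ω
  exact disjoint_left.1 hS (endComponent_mono Finset.subset_union_left ω hv)
    (hS' (endComponent_mono Finset.subset_union_right ω hv))

theorem height_psiEnd_eq {Y : Set V} {ω : G.end} (h : ω ∈ Ψ) :
    height Y (psiEnd ω h) = 0 ∨ height Y (psiEnd ω h) = 1 := by
  unfold height psiEnd
  simp only
  split_ifs
  · exact Or.inr rfl
  · exact Or.inl rfl

theorem continuous_height {Y : Set V} (hY : ∀ ω ∈ Ψ, TameAt Y ω) :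
    Continuous (height Y : psiSpace G Ψ → ℝ) := by
  rw [continuous_def]
  intro U hU
  rw [isOpen_psiSpace_iff]
  constructor
  · intro x hx
    obtain ⟨ε, hε, hball⟩ := Metric.isOpen_iff.1 hU _ hx
    refine ⟨ε / 5, by positivity, fun y hy => hball ?_⟩
    rw [height_psiPt, height_psiPt, Metric.mem_ball, Real.dist_eq]
    exact (abs_mass_sub_le Y hy).trans_lt (by linarith)
  · intro ω hω hx
    obtain ⟨S, hS, hS'⟩ := hY ω hω
    refine ⟨S, fun q hq => ?_⟩
    have hval : height Y q = height Y (psiEnd ω hω) := by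
      have hsupp : ∀ x : ComplexPoint G, ∀ v ∈ endComponent S ω, x.coord v ≠ 0 →
          ∀ u, x.coord u ≠ 0 → (u ∈ Y ↔ v ∈ Y) := by
        intro x v hv hxv u hu
        rcases x.mem_complex with ⟨w, -, h⟩ | ⟨w, w', hadj, -, -, -, h⟩
        · have h1 : ∀ u, x.coord u ≠ 0 → u = w := fun u hu => by
            by_contra hne
            exact hu (h u hne)
          rw [h1 u hu, h1 v hxv]
        · have h1 : ∀ u, x.coord u ≠ 0 → u = w ∨ u = w' := fun u hu => by
            by_contra hne
            push Not at hne
            exact hu (h u hne.1 hne.2)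
          rcases h1 u hu with rfl | rfl <;> rcases h1 v hxv with rfl | rfl
          · exact Iff.rfl
          · exact (hS _ hv _ hadj.symm).symm
          · exact (hS _ hv _ hadj).symm
          · exact Iff.rfl
      rcases hS' with hS' | hS'
      · rw [height_psiEnd_of_subset hω hS']
        rcases psiSpace_cases q with ⟨x, rfl⟩ | ⟨η, hη, rfl⟩
        · rcases hq with ⟨x', hx', v, hv, hxv⟩ | ⟨η, hη, -⟩
          · cases hx'
            exact mass_eq_one fun u hu => (hsupp x v hv hxv u hu).2 (hS' hv)
          · cases hη
        · rcases hq with ⟨x', hx', -⟩ | ⟨η', hη', he⟩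
          · cases hx'
          · cases hη'
            exact height_psiEnd_of_subset hη (he.subset.trans hS')
      · rw [height_psiEnd_of_disjoint hω hS']
        rcases psiSpace_cases q with ⟨x, rfl⟩ | ⟨η, hη, rfl⟩
        · rcases hq with ⟨x', hx', v, hv, hxv⟩ | ⟨η, hη, -⟩
          · cases hx'
            exact mass_eq_zero fun u hu h =>
              disjoint_left.1 hS' hv ((hsupp x v hv hxv u hu).1 h)
          · cases hη
        · rcases hq with ⟨x', hx', -⟩ | ⟨η', hη', he⟩
          · cases hx'
          · cases hη'
            exact height_psiEnd_of_disjoint hη (he ▸ hS')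
    rw [mem_preimage, hval]
    exact hx

/-! ### Closures of edge sets -/

/-- The closure of a set of edges contains no inner points of other edges. -/
theorem mem_of_mem_closure_edgePoints {C : Set (Sym2 V)} {x : ComplexPoint G}
    (hx : psiPt Ψ x ∈ closure (edgePoints G Ψ C)) {v w : V} (hvw : v ≠ w) (hv : 0 < x.coord v)
    (hw : 0 < x.coord w) : s(v, w) ∈ C := by
  have hopen : IsOpen {p : psiSpace G Ψ | ∃ y, p = psiPt Ψ y ∧ 0 < y.coord v ∧ 0 < y.coord w} := by
    rw [isOpen_psiSpace_iff]
    constructor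
    · rintro y ⟨y', hy', h1, h2⟩
      obtain rfl := psiPt_injective hy'
      refine ⟨min (y.coord v) (y.coord w), lt_min h1 h2, fun z hz => ⟨z, rfl, ?_, ?_⟩⟩
      · have := (hz v).trans_le (min_le_left _ _)
        linarith [(abs_lt.1 this).1]
      · have := (hz w).trans_le (min_le_right _ _)
        linarith [(abs_lt.1 this).1]
    · rintro ω h ⟨y, hy, -⟩
      exact absurd (congrArg Subtype.val hy) (by simp [psiEnd, psiPt])
  obtain ⟨p, ⟨y, rfl, hyv, hyw⟩, z, hz, e, he, hze⟩ :=
    mem_closure_iff.1 hx _ hopen ⟨x, rfl, hv, hw⟩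
  have hyz : y = z := by simpa [psiPt] using hz
  subst hyz
  rwa [(Sym2.mem_and_mem_iff hvw).1 ⟨(hze v).1 hyv.ne', (hze w).1 hyw.ne'⟩] at he

theorem subset_of_closure_edgePoints_subset {C D : Set (Sym2 V)} (hC : C ⊆ G.edgeSet)
    (h : closure (edgePoints G Ψ C) ⊆ closure (edgePoints G Ψ D)) : C ⊆ D := by
  intro e he
  induction e using Sym2.ind with
  | _ v w =>
    have hadj : G.Adj v w := hC he
    have ht : (1 / 2 : ℝ) ∈ Ioo (0 : ℝ) 1 := by norm_num
    refine mem_of_mem_closure_edgePoints (h (subset_closure (psiPt_edgePoint_mem hadj _ ht he)))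
      hadj.ne ?_ ?_
    · rw [edgePoint_coord_left]
      norm_num
    · rw [edgePoint_coord_right]
      norm_num

theorem edgePoints_mono {C D : Set (Sym2 V)} (h : C ⊆ D) :
    edgePoints G Ψ C ⊆ edgePoints G Ψ D := by
  rintro p ⟨x, hx, e, he, hxe⟩
  exact ⟨x, hx, e, h he, hxe⟩

theorem IsPsiCircuit.eq_of_subset {C D : Set (Sym2 V)} (hC : IsPsiCircuit G Ψ C)
    (hD : IsPsiCircuit G Ψ D) (h : C ⊆ D) : C = D := by
  obtain ⟨φ⟩ := hC.2
  obtain ⟨ψ⟩ := hD.2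
  have := eq_of_subset_of_homeomorph_circle (closure_mono (edgePoints_mono h)) φ ψ
  exact subset_antisymm h (subset_of_closure_edgePoints_subset hD.1 this.symm.subset)

theorem IsPsiCircuit.nonempty {C : Set (Sym2 V)} (hC : IsPsiCircuit G Ψ C) : C.Nonempty := by
  obtain ⟨φ⟩ := hC.2
  have hne : (closure (edgePoints G Ψ C)).Nonempty := ⟨_, (φ.symm 1).2⟩
  obtain ⟨p, x, -, e, he, -⟩ := closure_nonempty_iff.1 hne
  exact ⟨e, he⟩

/-- A topological circle does not meet a cut that has no end in its closure in just one edge: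
otherwise removing the midpoint of that edge would disconnect the circle. -/
theorem IsPsiCircuit.inter_cut_ne_singleton {C : Set (Sym2 V)} (hC : IsPsiCircuit G Ψ C) {Y : Set V}
    (hY : ∀ ω ∈ Ψ, TameAt Y ω) (e : Sym2 V) :
    C ∩ {e ∈ G.edgeSet | ∃ x ∈ Y, ∃ y ∉ Y, e = s(x, y)} ≠ {e} := by
  intro hCe
  obtain ⟨φ⟩ := hC.2
  obtain ⟨heC, -, v, hv, w, hw, rfl⟩ := hCe.ge rfl
  have hadj : G.Adj v w := hC.1 heC
  have hhalf : (1 / 2 : ℝ) ∈ Ioo (0 : ℝ) 1 := by norm_num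
  have hmem : ∀ t (ht : t ∈ Ioo (0 : ℝ) 1),
      psiPt Ψ (edgePoint hadj t ht) ∈ closure (edgePoints G Ψ C) := fun t ht =>
    subset_closure (psiPt_edgePoint_mem hadj t ht heC)
  have hheight : ∀ t (ht : t ∈ Ioo (0 : ℝ) 1),
      height Y (psiPt Ψ (edgePoint hadj t ht)) = 1 - t := by
    intro t ht
    rw [height_psiPt, mass_eq_coord hv, edgePoint_coord_left]
    intro u hu huY
    rw [edgePoint_coord_ne_zero_iff, Sym2.mem_iff] at hu
    exact hu.resolve_right fun h => hw (h ▸ huY)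
  let X := closure (edgePoints G Ψ C)
  let m : X := ⟨_, hmem _ hhalf⟩
  have hconn : IsPreconnected ({m}ᶜ : Set X) := by
    have h := (isPreconnected_compl_singleton_circle (φ m)).image φ.symm φ.symm.continuous.continuousOn
    rwa [Homeomorph.image_symm, preimage_compl, ← image_singleton, φ.preimage_image] at h
  have hcont : Continuous fun p : X => height Y p.1 :=
    (continuous_height hY).comp continuous_subtype_val
  have hq : (1 / 4 : ℝ) ∈ Ioo (0 : ℝ) 1 := by norm_num
  have hq' : (3 / 4 : ℝ) ∈ Ioo (0 : ℝ) 1 := by norm_num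
  have hne : ∀ t (ht : t ∈ Ioo (0 : ℝ) 1), t ≠ 1 / 2 →
      (⟨_, hmem t ht⟩ : X) ∈ ({m}ᶜ : Set X) := by
    intro t ht hthalf h
    have h1 : height Y (psiPt Ψ (edgePoint hadj t ht)) =
        height Y (psiPt Ψ (edgePoint hadj _ hhalf)) := congrArg (fun p : X => height Y p.1) h
    rw [hheight, hheight] at h1
    exact hthalf (by linarith)
  obtain ⟨p, hpm, hp⟩ := (hconn.image _ hcont.continuousOn).ordConnected.out
    ⟨_, hne _ hq' (by norm_num), rfl⟩ ⟨_, hne _ hq (by norm_num), rfl⟩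
    (show (1 / 2 : ℝ) ∈ Icc (height Y (psiPt Ψ (edgePoint hadj (3 / 4) hq')))
        (height Y (psiPt Ψ (edgePoint hadj (1 / 4) hq))) by
      rw [hheight, hheight]
      norm_num)
  refine hpm (Subtype.ext ?_)
  change height Y p.1 = 1 / 2 at hp
  rcases psiSpace_cases p.1 with ⟨x, hx⟩ | ⟨ω, hω, hx⟩
  · rw [hx, height_psiPt] at hp
    have hxX : psiPt Ψ x ∈ X := hx ▸ p.2
    have key : ∀ a b : V, G.Adj a b → 0 < x.coord a → 0 < x.coord b →
        x.coord a + x.coord b = 1 → (∀ c, c ≠ a → c ≠ b → x.coord c = 0) → a ∈ Y → b ∉ Y →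
        x = edgePoint hadj (1 / 2) hhalf := by
      intro a b hab ha hb hsum h0 haY hbY
      rw [mass_eq_coord haY fun u hu huY => by
        by_contra hne
        exact hu (h0 u hne fun h => hbY (h ▸ huY))] at hp
      have hbh : x.coord b = 1 / 2 := by linarith
      have heq : s(a, b) = s(v, w) :=
        hCe.le ⟨mem_of_mem_closure_edgePoints hxX hab.ne ha hb, hab, a, haY, b, hbY, rfl⟩
      have hab' : a = v ∧ b = w := by
        rcases Sym2.eq_iff.1 heq with h | h
        · exact h
        · exact absurd (h.1 ▸ haY) hw
      obtain ⟨rfl, rfl⟩ := hab'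
      refine ComplexPoint.ext_coord fun u => ?_
      by_cases hua : u = a
      · rw [hua, edgePoint_coord_left, hp]
        norm_num
      by_cases hub : u = b
      · rw [hub, edgePoint_coord_right, hbh]
      · rw [h0 u hua hub]
        by_contra hne
        have := (edgePoint_coord_ne_zero_iff hadj _ hhalf u).1 (Ne.symm hne)
        rw [Sym2.mem_iff] at this
        tauto
    rw [hx]
    refine congrArg _ ?_
    rcases x.mem_complex with ⟨a, ha, h0⟩ | ⟨a, b, hab, ha, hb, hsum, h0⟩
    · exfalso
      have h1 : ∀ u, x.coord u ≠ 0 → u = a := fun u hu => by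
        by_contra hne
        exact hu (h0 u hne)
      by_cases haY : a ∈ Y
      · rw [mass_eq_one fun u hu => (h1 u hu) ▸ haY] at hp
        norm_num at hp
      · rw [mass_eq_zero fun u hu => (h1 u hu) ▸ haY] at hp
        norm_num at hp
    · have h1 : ∀ u, x.coord u ≠ 0 → u = a ∨ u = b := fun u hu => by
        by_contra hne
        push Not at hne
        exact hu (h0 u hne.1 hne.2)
      by_cases haY : a ∈ Y <;> by_cases hbY : b ∈ Y
      · rw [mass_eq_one fun u hu => (h1 u hu).elim (fun h => h ▸ haY) fun h => h ▸ hbY] at hp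
        norm_num at hp
      · exact key a b hab ha hb hsum h0 haY hbY
      · exact key b a hab.symm hb ha (by linarith) (fun c h h' => h0 c h' h) hbY haY
      · rw [mass_eq_zero fun u hu => (h1 u hu).elim (fun h => h ▸ haY) fun h => h ▸ hbY] at hp
        norm_num at hp
  · exfalso
    rw [hx] at hp
    rcases height_psiEnd_eq (Y := Y) hω with h | h <;> rw [h] at hp <;> norm_num at hp

end PsiSpace

/-! ### The graph `T₂ × K₂` -/

theorem doubleTree_adj {p q : List Bool} {i j : Bool} :
    doubleTree.Adj (p, i) (q, j) ↔
      (i = j ∧ ∃ b, q = b :: p ∨ p = b :: q) ∨ (p = q ∧ i ≠ j) := by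
  have hne : ∀ (b : Bool) (s : List Bool), s ≠ b :: s := fun b s h => by
    simpa using congrArg List.length h
  simp only [doubleTree, SimpleGraph.boxProd_adj, binaryTree, SimpleGraph.fromRel_adj,
    SimpleGraph.top_adj]
  constructor
  · rintro (⟨⟨-, ⟨b, h⟩ | ⟨b, h⟩⟩, h'⟩ | ⟨h, h'⟩)
    · exact Or.inl ⟨h', b, Or.inl h⟩
    · exact Or.inl ⟨h', b, Or.inr h⟩
    · exact Or.inr ⟨h', h⟩
  · rintro (⟨h', b, h | h⟩ | ⟨h, h'⟩)
    · exact Or.inl ⟨⟨by rw [h]; exact hne b p, Or.inl ⟨b, h⟩⟩, h'⟩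
    · exact Or.inl ⟨⟨by rw [h]; exact (hne b q).symm, Or.inr ⟨b, h⟩⟩, h'⟩
    · exact Or.inr ⟨h', h⟩

/-- The edges of `T₂ × K₂` as pairs of vertices. -/
def edgeEmb : Edge ↪ Sym2 (List Bool × Bool) where
  toFun
    | .side p b i => s((p, i), (b :: p, i))
    | .rung v => s((v, false), (v, true))
  inj' := by
    rintro (⟨p, b, i⟩ | v) (⟨q, c, j⟩ | w) h
    · simp only [Sym2.eq_iff, Prod.mk.injEq] at h
      rcases h with ⟨⟨rfl, rfl⟩, h, -⟩ | ⟨⟨h1, -⟩, h2, -⟩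
      · obtain ⟨rfl, -⟩ := List.cons.inj h
        rfl
      · have h1' := congrArg List.length h1
        have h2' := congrArg List.length h2
        simp only [List.length_cons] at h1' h2'
        omega
    · simp only [Sym2.eq_iff, Prod.mk.injEq] at h
      rcases h with ⟨⟨-, rfl⟩, -, h⟩ | ⟨⟨-, rfl⟩, -, h⟩ <;> simp at h
    · simp only [Sym2.eq_iff, Prod.mk.injEq] at h
      rcases h with ⟨⟨-, rfl⟩, -, h⟩ | ⟨⟨-, rfl⟩, -, h⟩ <;> simp at h
    · simp only [Sym2.eq_iff, Prod.mk.injEq] at h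
      rcases h with ⟨⟨rfl, -⟩, -⟩ | ⟨⟨rfl, -⟩, -⟩ <;> rfl

@[simp] theorem edgeEmb_side (p : List Bool) (b i : Bool) :
    edgeEmb (.side p b i) = s((p, i), (b :: p, i)) := rfl

@[simp] theorem edgeEmb_rung (v : List Bool) : edgeEmb (.rung v) = s((v, false), (v, true)) := rfl

theorem range_edgeEmb : range edgeEmb = doubleTree.edgeSet := by
  ext e
  constructor
  · rintro ⟨⟨p, b, i⟩ | v, rfl⟩
    · exact doubleTree_adj.2 (Or.inl ⟨rfl, b, Or.inl rfl⟩)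
    · exact doubleTree_adj.2 (Or.inr ⟨rfl, by simp⟩)
  · induction e using Sym2.ind with
    | _ v w =>
      obtain ⟨p, i⟩ := v
      obtain ⟨q, j⟩ := w
      intro h
      rcases doubleTree_adj.1 h with ⟨rfl, b, rfl | rfl⟩ | ⟨rfl, hij⟩
      · exact ⟨.side p b i, rfl⟩
      · exact ⟨.side q b i, Sym2.eq_swap⟩
      · refine ⟨.rung p, ?_⟩
        cases i <;> cases j <;> simp [Sym2.eq_swap] at hij ⊢

instance : Countable Edge := edgeEmb.injective.countable

/-- The vertex set of the part of `T₂ × K₂` above `p`. -/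
def upper (p : List Bool) : Set (List Bool × Bool) := {v | p <:+ v.1}

@[simp] theorem mem_upper {p q : List Bool} {i : Bool} : (q, i) ∈ upper p ↔ p <:+ q := Iff.rfl

theorem exists_mem_upper_iff_mem_above {p : List Bool} {e : Edge} :
    (∃ v ∈ edgeEmb e, v ∈ upper p) ↔ e ∈ above p := by
  rcases e with ⟨q, b, i⟩ | v
  · simp only [edgeEmb_side, Sym2.mem_iff, side_mem_above]
    constructor
    · rintro ⟨v, rfl | rfl, h⟩
      · exact List.IsSuffix.trans h (List.suffix_cons _ _)
      · exact h
    · exact fun h => ⟨_, Or.inr rfl, h⟩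
  · simp only [edgeEmb_rung, Sym2.mem_iff, rung_mem_above]
    constructor
    · rintro ⟨v, rfl | rfl, h⟩ <;> exact h
    · exact fun h => ⟨_, Or.inl rfl, h⟩

/-- A property of vertices that is preserved by the edges meeting `upper p` is constant on
`upper p`. -/
theorem upper_induction {p : List Bool} {P : List Bool × Bool → Prop}
    (h : ∀ v ∈ upper p, ∀ w ∈ upper p, doubleTree.Adj v w → (P v ↔ P w)) :
    ∀ v ∈ upper p, (P v ↔ P (p, false)) := by
  rintro ⟨q, i⟩ hq
  rw [mem_upper] at hq
  induction q with
  | nil =>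
    obtain rfl := List.suffix_nil.1 hq
    cases i with
    | false => rfl
    | true => exact h _ hq _ hq (doubleTree_adj.2 (Or.inr ⟨rfl, by simp⟩))
  | cons b s ih =>
    rcases List.suffix_cons_iff.1 hq with rfl | hs
    · cases i with
      | false => rfl
      | true => exact h _ hq _ hq (doubleTree_adj.2 (Or.inr ⟨rfl, by simp⟩))
    · rw [← ih hs]
      exact h _ hq _ hs (doubleTree_adj.2 (Or.inl ⟨rfl, b, Or.inr rfl⟩))

/-! ### The ends of `T₂ × K₂` -/

theorem exists_disjoint_upper (x : ℕ → Bool) (S : Finset (List Bool × Bool)) :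
    ∃ N, ∀ n ≥ N, ∀ v ∈ upper (initialSegment x n), v ∉ S := by
  refine ⟨S.sup (fun v => v.1.length) + 1, fun n hn v hv hvS => ?_⟩
  have h1 := Finset.le_sup (f := fun v : List Bool × Bool => v.1.length) hvS
  have h2 := List.IsSuffix.length_le hv
  rw [length_initialSegment] at h2
  omega

theorem mk_eq_of_mem_upper {S : Finset (List Bool × Bool)} {p : List Bool}
    (hp : ∀ v ∈ upper p, v ∉ (S : Set (List Bool × Bool)))
    {v w : List Bool × Bool} (hv : v ∈ upper p) (hw : w ∈ upper p) :
    doubleTree.componentComplMk (hp v hv) = doubleTree.componentComplMk (hp w hw) := by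
  have key := upper_induction (p := p) (P := fun u => ∃ h : u ∉ (S : Set (List Bool × Bool)),
      doubleTree.componentComplMk h = doubleTree.componentComplMk (hp v hv)) (by
    intro u hu u' hu' hadj
    have := doubleTree.componentComplMk_eq_of_adj (hp u hu) (hp u' hu') hadj
    exact ⟨fun ⟨_, h⟩ => ⟨hp u' hu', this ▸ h⟩, fun ⟨_, h⟩ => ⟨hp u hu, this ▸ h⟩⟩)
  obtain ⟨_, h⟩ := (key w hw).2 ((key v hv).1 ⟨hp v hv, rfl⟩)
  exact h.symm

/-- Every 0-1-sequence belongs to an end. -/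
theorem exists_isEndOf (x : ℕ → Bool) : ∃ ω, IsEndOf x ω := by
  choose N hN using exists_disjoint_upper x
  have hself : ∀ n i, (initialSegment x n, i) ∈ upper (initialSegment x n) :=
    fun n i => List.suffix_rfl
  let c : ∀ S : (Finset (List Bool × Bool))ᵒᵖ, doubleTree.componentComplFunctor.obj S := fun S =>
    doubleTree.componentComplMk (v := (initialSegment x (N S.unop), false))
      (hN S.unop _ le_rfl _ (hself _ _))
  have hc : ∀ (S : (Finset (List Bool × Bool))ᵒᵖ) n (hn : N S.unop ≤ n) i,
      c S = doubleTree.componentComplMk (v := (initialSegment x n, i))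
        (hN S.unop _ le_rfl _ (initialSegment_suffix x hn)) := fun S n hn i =>
    mk_eq_of_mem_upper (S := S.unop) (hN S.unop _ le_rfl) (hself _ _) (initialSegment_suffix x hn)
  refine ⟨⟨c, fun {S S'} f => ?_⟩, fun S => ?_⟩
  · have hle : S'.unop ⊆ S.unop := CategoryTheory.le_of_op_hom f
    rw [hc S (max (N S.unop) (N S'.unop)) (le_max_left _ _) false,
      hc S' (max (N S.unop) (N S'.unop)) (le_max_right _ _) false]
    rfl
  · filter_upwards [Filter.eventually_ge_atTop (N S)] with n hn i
    exact ⟨_, (hc (Opposite.op S) n hn i).symm⟩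

theorem IsEndOf.exists_upper_subset {x : ℕ → Bool} {ω : doubleTree.end} (h : IsEndOf x ω)
    (S : Finset (List Bool × Bool)) :
    ∃ N, ∀ n ≥ N, upper (initialSegment x n) ⊆ endComponent S ω := by
  obtain ⟨N, hN⟩ := exists_disjoint_upper x S
  obtain ⟨N', hN'⟩ := Filter.eventually_atTop.1 (h S)
  refine ⟨max N N', fun n hn v hv => ?_⟩
  have hn' := hN n (le_of_max_le_left hn)
  obtain ⟨h1, h2⟩ := hN' n (le_of_max_le_right hn) false
  refine ⟨hn' v hv, ?_⟩
  rw [← h2]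
  exact mk_eq_of_mem_upper hn' hv List.suffix_rfl

theorem IsEndOf.exists_subset_upper {x : ℕ → Bool} {ω : doubleTree.end} (h : IsEndOf x ω) (n : ℕ) :
    ∃ S, endComponent S ω ⊆ upper (initialSegment x n) := by
  classical
  rcases n with _ | n
  · exact ⟨∅, fun v _ => List.nil_suffix⟩
  -- Remove the two vertices below `initialSegment x (n + 1)`.
  refine ⟨{(initialSegment x n, false), (initialSegment x n, true)}, fun w hw => ?_⟩
  set S : Finset (List Bool × Bool) := {(initialSegment x n, false), (initialSegment x n, true)}
    with hS
  set p := initialSegment x (n + 1) with hp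
  have hmem : ∀ i, (initialSegment x n, i) ∈ S := fun i => by cases i <;> simp [hS]
  have hstep : ∀ (b : Bool) (s : List Bool) (i : Bool), (s, i) ∉ S →
      (p <:+ b :: s ↔ p <:+ s) := by
    intro b s i hs
    rw [List.suffix_cons_iff, or_iff_right_iff_imp]
    intro h
    obtain ⟨-, h'⟩ := List.cons.inj (show x n :: initialSegment x n = b :: s from h)
    exact absurd (h' ▸ hmem i) hs
  have hinv : ∀ ⦃v w : List Bool × Bool⦄ (_ : v ∉ (S : Set (List Bool × Bool)))
      (_ : w ∉ (S : Set (List Bool × Bool))), doubleTree.Adj v w →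
      (v ∈ upper p) = (w ∈ upper p) := by
    rintro ⟨s, i⟩ ⟨t, j⟩ hv hw hadj
    rcases doubleTree_adj.1 hadj with ⟨-, b, rfl | rfl⟩ | ⟨rfl, -⟩
    · exact (propext (hstep b s i hv)).symm
    · exact propext (hstep b t j hw)
    · rfl
  have hval : ∀ v ∈ endComponent S ω, SimpleGraph.ComponentCompl.lift
      (fun v _ => v ∈ upper p) hinv (ω.1 (Opposite.op S)) = (v ∈ upper p) := by
    rintro v ⟨hv, h⟩
    rw [← h]
    rfl
  obtain ⟨N, hN⟩ := h.exists_upper_subset S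
  have hu : (initialSegment x (max N (n + 1)), false) ∈ endComponent S ω :=
    hN _ (le_max_left _ _) List.suffix_rfl
  have h1 : (initialSegment x (max N (n + 1)), false) ∈ upper p :=
    initialSegment_suffix x (le_max_right _ _)
  rw [← hval _ hu, hval w hw] at h1
  exact h1

theorem IsEndOf.end_unique {x : ℕ → Bool} {ω η : doubleTree.end} (h : IsEndOf x ω)
    (h' : IsEndOf x η) : ω = η := by
  refine Subtype.ext (funext fun S => ?_)
  obtain ⟨n, hn, hn'⟩ := ((h S.unop).and (h' S.unop)).exists
  obtain ⟨h1, h2⟩ := hn true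
  obtain ⟨h1', h2'⟩ := hn' true
  exact h2.symm.trans h2'

theorem exists_not_suffix_of_ne {x y : ℕ → Bool} (h : x ≠ y) :
    ∃ n, ∀ q, initialSegment x n <:+ q → ¬ initialSegment y n <:+ q := by
  by_contra hcon
  push Not at hcon
  refine h (funext fun n => ?_)
  obtain ⟨q, h1, h2⟩ := hcon (n + 1)
  have h3 : initialSegment x (n + 1) = initialSegment y (n + 1) :=
    (List.suffix_of_suffix_length_le h1 h2 (by simp)).eq_of_length (by simp)
  exact (List.cons.inj h3).1

theorem IsEndOf.seq_unique {x y : ℕ → Bool} {ω : doubleTree.end} (h : IsEndOf x ω)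
    (h' : IsEndOf y ω) : x = y := by
  by_contra hne
  obtain ⟨n, hn⟩ := exists_not_suffix_of_ne hne
  obtain ⟨S, hS⟩ := h.exists_subset_upper n
  obtain ⟨S', hS'⟩ := h'.exists_subset_upper n
  classical
  obtain ⟨v, hv⟩ := endComponent_nonempty (S ∪ S') ω
  exact hn _ (hS (endComponent_mono Finset.subset_union_left ω hv))
    (hS' (endComponent_mono Finset.subset_union_right ω hv))

/-! ### Bounded cuts of `T₂ × K₂` -/

theorem tameAt_of_bounded {Ψ : Set (ℕ → Bool)} {Y : List Bool → Bool → Bool}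
    (hY : Bounded Ψ (cut Y)) : ∀ ω ∈ endsOf Ψ, TameAt {v | Y v.1 v.2 = true} ω := by
  rintro ω ⟨x, hx, hω⟩
  obtain ⟨n, hn⟩ := hY x hx
  obtain ⟨S, hS⟩ := hω.exists_subset_upper n
  have hadj : ∀ v ∈ upper (initialSegment x n), ∀ w, doubleTree.Adj v w → Y v.1 v.2 = Y w.1 w.2 := by
    rintro ⟨s, i⟩ hv ⟨t, j⟩ h
    by_contra hne
    rcases doubleTree_adj.1 h with ⟨rfl, b, rfl | rfl⟩ | ⟨rfl, hij⟩
    · exact disjoint_left.1 hn (show Edge.side s b i ∈ cut Y from hne)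
        (List.IsSuffix.trans hv (List.suffix_cons _ _))
    · exact disjoint_left.1 hn (show Edge.side t b i ∈ cut Y from Ne.symm hne) hv
    · refine disjoint_left.1 hn (show Edge.rung s ∈ cut Y from ?_) hv
      cases i <;> cases j
      · exact absurd rfl hij
      · exact hne
      · exact Ne.symm hne
      · exact absurd rfl hij
  refine ⟨S, fun v hv w hvw => ?_, ?_⟩
  · rw [mem_ofPred_eq, mem_ofPred_eq, hadj v (hS hv) w hvw]
  · have hconst := upper_induction (p := initialSegment x n) (P := fun v => Y v.1 v.2 = true)
      (fun v hv w _ h => by rw [hadj v hv w h])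
    by_cases h0 : Y (initialSegment x n) false = true
    · exact Or.inl fun v hv => (hconst v (hS hv)).2 h0
    · exact Or.inr (disjoint_left.2 fun v hv hvY => h0 ((hconst v (hS hv)).1 hvY))

theorem tameAt_singleton (Ψ : Set (ℕ → Bool)) (v : List Bool × Bool) :
    ∀ ω ∈ endsOf Ψ, TameAt {v} ω := by
  classical
  have h := tameAt_of_bounded (Ψ := Ψ) (Y := fun q i => decide ((q, i) = v)) (fun x _ => by
    refine ⟨v.1.length + 2, disjoint_left.2 ?_⟩
    have key : ∀ (q : List Bool) (i : Bool), v.1.length < q.length → (q, i) ≠ v :=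
      fun q i hlt hv => by simp [← hv] at hlt
    rintro (⟨q, b, i⟩ | q) he hab
    · have hlen := List.IsSuffix.length_le hab
      simp only [length_initialSegment, List.length_cons] at hlen
      exact he ((decide_eq_false (key q i (by omega))).trans
        (decide_eq_false (key (b :: q) i (by simp only [List.length_cons]; omega))).symm)
    · have hlen := List.IsSuffix.length_le hab
      simp only [length_initialSegment] at hlen
      exact he ((decide_eq_false (key q _ (by omega))).trans
        (decide_eq_false (key q _ (by omega))).symm))
  convert h using 4 with ω hω
  ext w
  simp

theorem tameAt_upper (Ψ : Set (ℕ → Bool)) (p : List Bool) :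
    ∀ ω ∈ endsOf Ψ, TameAt (upper p) ω := by
  classical
  have h := tameAt_of_bounded (Ψ := Ψ) (Y := fun q _ => decide (p <:+ q)) (fun x _ => by
    refine ⟨p.length + 1, disjoint_left.2 ?_⟩
    rintro (⟨q, b, i⟩ | q) he hab
    · have hlen := List.IsSuffix.length_le hab
      simp only [length_initialSegment, List.length_cons] at hlen
      refine he (decide_eq_decide.2 ?_)
      rw [List.suffix_cons_iff (l₂ := q), eq_comm, iff_comm, or_iff_right_iff_imp]
      rintro rfl
      simp at hlen
    · exact he rfl)
  convert h using 4 with ω hω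
  ext w
  simp [upper]

instance (Ψ : Set (ℕ → Bool)) : T2Space (psiSpace doubleTree (endsOf Ψ)) := by
  have key : ∀ p q : psiSpace doubleTree (endsOf Ψ),
      (∃ Y, (∀ ω ∈ endsOf Ψ, TameAt Y ω) ∧ height Y p ≠ height Y q) →
      ∃ u v : Set (psiSpace doubleTree (endsOf Ψ)), IsOpen u ∧ IsOpen v ∧ p ∈ u ∧ q ∈ v ∧
        Disjoint u v := by
    rintro p q ⟨Y, hY, hne⟩
    exact separated_by_continuous (continuous_height hY) hne
  have hcoord : ∀ (x : ComplexPoint doubleTree) v, mass {v} x = x.coord v := fun x v =>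
    mass_eq_coord rfl fun _ _ h => h
  have hend : ∀ (x : ComplexPoint doubleTree) (ω : doubleTree.end) (hω : ω ∈ endsOf Ψ),
      ∃ Y, (∀ ω ∈ endsOf Ψ, TameAt Y ω) ∧ height Y (psiPt (endsOf Ψ) x) ≠ height Y (psiEnd ω hω) := by
    intro x ω hω
    obtain ⟨v, hv⟩ : ∃ v, x.coord v ≠ 0 := by
      rcases x.mem_complex with ⟨v, hv, -⟩ | ⟨v, w, -, hv, -⟩
      · exact ⟨v, by rw [hv]; exact one_ne_zero⟩
      · exact ⟨v, hv.ne'⟩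
    refine ⟨{v}, tameAt_singleton Ψ v, ?_⟩
    rw [height_psiPt, hcoord, height_psiEnd_of_disjoint hω (S := {v})]
    · exact hv
    · refine disjoint_left.2 fun w hw hwv => ?_
      obtain ⟨h, -⟩ := hw
      exact h (by simpa using hwv)
  refine ⟨fun p q hpq => key p q ?_⟩
  rcases psiSpace_cases p with ⟨x, rfl⟩ | ⟨ω, hω, rfl⟩ <;>
    rcases psiSpace_cases q with ⟨y, rfl⟩ | ⟨η, hη, rfl⟩
  · obtain ⟨v, hv⟩ : ∃ v, x.coord v ≠ y.coord v := by
      by_contra hcon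
      push Not at hcon
      exact hpq (congrArg _ (ComplexPoint.ext_coord hcon))
    exact ⟨{v}, tameAt_singleton Ψ v, by rwa [height_psiPt, height_psiPt, hcoord, hcoord]⟩
  · exact hend x η hη
  · obtain ⟨Y, h, h'⟩ := hend y ω hω
    exact ⟨Y, h, h'.symm⟩
  · obtain ⟨x, hx, hxω⟩ := id hω
    obtain ⟨y, hy, hyη⟩ := id hη
    have hne : x ≠ y := by
      rintro rfl
      obtain rfl := hxω.end_unique hyη
      exact hpq rfl
    obtain ⟨n, hn⟩ := exists_not_suffix_of_ne hne
    obtain ⟨S, hS⟩ := hxω.exists_subset_upper n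
    obtain ⟨S', hS'⟩ := hyη.exists_subset_upper n
    refine ⟨upper (initialSegment x n), tameAt_upper Ψ _, ?_⟩
    rw [height_psiEnd_of_subset _ hS, height_psiEnd_of_disjoint _ (S := S')]
    · exact one_ne_zero
    · exact disjoint_left.2 fun v hv hv' => hn _ hv' (hS' hv)

theorem isPsiBounded_iff {Ψ : Set (ℕ → Bool)} {D : Set Edge} :
    IsPsiBounded doubleTree (endsOf Ψ) (edgeEmb '' D) ↔ Bounded Ψ D := by
  constructor
  · intro h x hx
    obtain ⟨ω, hω⟩ := exists_isEndOf x
    have hωΨ : ω ∈ endsOf Ψ := ⟨x, hx, hω⟩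
    have hnot : psiEnd ω hωΨ ∈ (closure (edgePoints doubleTree (endsOf Ψ) (edgeEmb '' D)))ᶜ :=
      fun hcl => h _ hcl ω rfl
    obtain ⟨S, hS⟩ := (isOpen_psiSpace_iff.1 isClosed_closure.isOpen_compl).2 ω hωΨ hnot
    obtain ⟨N, hN⟩ := hω.exists_upper_subset S
    refine ⟨N, disjoint_left.2 fun e he hab => ?_⟩
    obtain ⟨u, hue, hu⟩ := exists_mem_upper_iff_mem_above.2 hab
    have hedge : edgeEmb e ∈ doubleTree.edgeSet := range_edgeEmb ▸ mem_range_self e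
    have hmem : edgeEmb e ∈ edgeEmb '' D := mem_image_of_mem _ he
    generalize edgeEmb e = e' at hue hedge hmem
    induction e' using Sym2.ind with
    | _ v w =>
      have hadj : doubleTree.Adj v w := hedge
      have ht : (1 / 2 : ℝ) ∈ Ioo (0 : ℝ) 1 := by norm_num
      refine hS (psiPt _ (edgePoint hadj _ ht)) (Or.inl ⟨_, rfl, u, hN N le_rfl hu, ?_⟩)
        (subset_closure (psiPt_edgePoint_mem hadj _ ht hmem))
      exact (edgePoint_coord_ne_zero_iff hadj _ ht u).2 hue
  · intro h p hp ω hpω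
    have hωΨ : ω ∈ endsOf Ψ := p.2 ω hpω
    obtain rfl : p = psiEnd ω hωΨ := Subtype.ext hpω
    have hωΨ' := hωΨ
    obtain ⟨x, hx, hω⟩ := hωΨ'
    obtain ⟨n, hn⟩ := h x hx
    obtain ⟨S, hS⟩ := hω.exists_subset_upper n
    have hopen := (isOpen_lt continuous_const
      (continuous_height (tameAt_upper Ψ (initialSegment x n))) :
      IsOpen {q | (0 : ℝ) < height (upper (initialSegment x n)) q})
    obtain ⟨q, hq, y, hqy, e', ⟨e, he, rfl⟩, hye⟩ := mem_closure_iff.1 hp _ hopen (by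
      rw [mem_ofPred_eq, height_psiEnd_of_subset hωΨ hS]
      exact one_pos)
    obtain rfl : q = psiPt _ y := Subtype.ext hqy
    rw [mem_ofPred_eq, height_psiPt] at hq
    obtain ⟨v, hv, hvu⟩ : ∃ v, y.coord v ≠ 0 ∧ v ∈ upper (initialSegment x n) := by
      by_contra hcon
      push Not at hcon
      exact hq.ne' (mass_eq_zero hcon)
    exact disjoint_left.1 hn he (exists_mem_upper_iff_mem_above.1 ⟨v, (hye v).1 hv, hvu⟩)

theorem image_cut (Y : List Bool → Bool → Bool) : edgeEmb '' cut Y =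
    {e ∈ doubleTree.edgeSet | ∃ x ∈ {v : List Bool × Bool | Y v.1 v.2 = true},
      ∃ y ∉ {v : List Bool × Bool | Y v.1 v.2 = true}, e = s(x, y)} := by
  ext e'
  constructor
  · rintro ⟨e, he, rfl⟩
    refine ⟨range_edgeEmb ▸ mem_range_self e, ?_⟩
    rcases e with ⟨p, b, i⟩ | v
    · rw [side_mem_cut] at he
      by_cases h : Y p i = true
      · exact ⟨_, h, (b :: p, i), fun h' => he (Eq.trans h (Eq.symm h')), rfl⟩
      · refine ⟨(b :: p, i), ?_, (p, i), h, Sym2.eq_swap⟩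
        simp only [mem_ofPred_eq]
        by_contra h'
        simp only [Bool.not_eq_true] at h h'
        exact he (h.trans h'.symm)
    · rw [rung_mem_cut] at he
      by_cases h : Y v false = true
      · exact ⟨_, h, (v, true), fun h' => he (Eq.trans h (Eq.symm h')), rfl⟩
      · refine ⟨(v, true), ?_, (v, false), h, Sym2.eq_swap⟩
        simp only [mem_ofPred_eq]
        by_contra h'
        simp only [Bool.not_eq_true] at h h'
        exact he (h.trans h'.symm)
  · rintro ⟨he, x, hx, y, hy, rfl⟩
    rw [← range_edgeEmb] at he
    obtain ⟨e, he⟩ := he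
    refine ⟨e, ?_, he⟩
    simp only [mem_ofPred_eq] at hx hy
    rcases e with ⟨p, b, i⟩ | v
    · rw [side_mem_cut]
      intro h
      rcases Sym2.eq_iff.1 he with ⟨rfl, rfl⟩ | ⟨rfl, rfl⟩
      · exact hy (h ▸ hx)
      · exact hy (h ▸ hx)
    · rw [rung_mem_cut]
      intro h
      rcases Sym2.eq_iff.1 he with ⟨rfl, rfl⟩ | ⟨rfl, rfl⟩
      · exact hy (h ▸ hx)
      · exact hy (h ▸ hx)

theorem boundedCuts_iff {Ψ : Set (ℕ → Bool)} {b : Set (Sym2 (List Bool × Bool))} :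
    b.Nonempty ∧ IsCut doubleTree b ∧ IsPsiBounded doubleTree (endsOf Ψ) b ↔
      ∃ D ∈ boundedCuts Ψ, edgeEmb '' D = b := by
  classical
  constructor
  · rintro ⟨hne, ⟨X, rfl⟩, hb⟩
    have h := image_cut fun v i => decide ((v, i) ∈ X)
    simp only [decide_eq_true_eq, mem_ofPred_eq, Prod.mk.eta] at h
    rw [← h] at hne hb ⊢
    exact ⟨_, ⟨image_nonempty.1 hne, ⟨_, rfl⟩, isPsiBounded_iff.1 hb⟩, rfl⟩
  · rintro ⟨D, ⟨hne, ⟨Y, rfl⟩, hD⟩, rfl⟩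
    exact ⟨hne.image _, ⟨_, image_cut Y⟩, isPsiBounded_iff.2 hD⟩

/-! ### Parametrising circles -/

theorem nonempty_onePoint_homeomorph_circle : Nonempty (OnePoint ℝ ≃ₜ Circle) := by
  have e₁ : OnePoint ℝ ≃ₜ Metric.sphere (0 : EuclideanSpace ℝ (Fin 2)) 1 :=
    onePointEquivSphereOfFinrankEq (by simp)
  have e₂ : {z : ℂ // z ∈ Submonoid.unitSphere ℂ} ≃ₜ
      {z : EuclideanSpace ℝ (Fin 2) // z ∈ Metric.sphere (0 : EuclideanSpace ℝ (Fin 2)) 1} :=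
    Complex.orthonormalBasisOneI.repr.toHomeomorph.subtype fun z => by
      have h : z ∈ Submonoid.unitSphere ℂ ↔ z ∈ Metric.sphere (0 : ℂ) 1 := Iff.rfl
      rw [h, mem_sphere_zero_iff_norm]
      simp
  exact ⟨e₁.trans e₂.symm⟩

section PathPoint

variable {V : Type*} {G : SimpleGraph V} {Ψ : Set G.end}

/-- A circle in `|G|_Ψ` through all inner points of edges of `C`, in the closure of these points,
shows that `C` is a `Ψ`-circuit. -/
theorem isPsiCircuit_of_parametrization [T2Space (psiSpace G Ψ)] {C : Set (Sym2 V)}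
    (hC : C ⊆ G.edgeSet) {K : Type*} [TopologicalSpace K] [CompactSpace K] (e : K ≃ₜ Circle)
    (Φ : K → psiSpace G Ψ) (hΦ : Continuous Φ) (hinj : Function.Injective Φ)
    (h₁ : edgePoints G Ψ C ⊆ range Φ) (h₂ : range Φ ⊆ closure (edgePoints G Ψ C)) :
    IsPsiCircuit G Ψ C := by
  have hemb := hΦ.isClosedEmbedding hinj
  have hcl : closure (edgePoints G Ψ C) = range Φ :=
    subset_antisymm (closure_minimal h₁ hemb.isClosed_range) h₂
  refine ⟨hC, ?_⟩
  rw [hcl]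
  exact ⟨hemb.isEmbedding.toHomeomorph.symm.trans e⟩

variable {v : ℤ → V}

open Classical in
/-- The point at distance `s` on the two-way infinite walk `v` in the 1-complex of `G`. -/
noncomputable def pathPoint (hv : ∀ n, G.Adj (v n) (v (n + 1))) (s : ℝ) : ComplexPoint G where
  coord u := (if u = v ⌊s⌋ then 1 - Int.fract s else 0) +
    if u = v (⌊s⌋ + 1) then Int.fract s else 0
  mem_complex := by
    have hne := (hv ⌊s⌋).ne
    have h0 := Int.fract_nonneg s
    have h1 := Int.fract_lt_one s
    rcases h0.eq_or_lt with h | h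
    · refine Or.inl ⟨v ⌊s⌋, ?_, fun w hw => ?_⟩
      · simp [← h]
      · simp [← h, hw]
    · refine Or.inr ⟨v ⌊s⌋, v (⌊s⌋ + 1), hv _, ?_, ?_, ?_, ?_⟩
      · simp [hne, h1]
      · simp [hne.symm, h]
      · simp [hne, hne.symm]
      · intro x hx hx'
        simp [hx, hx']

open Classical in
theorem pathPoint_coord (hv : ∀ n, G.Adj (v n) (v (n + 1))) {s : ℝ} {n : ℤ} (h₁ : n ≤ s) (h₂ : s ≤ n + 1) (u : V) :
    (pathPoint hv s).coord u =
      (if u = v n then 1 - (s - n) else 0) + if u = v (n + 1) then s - n else 0 := by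
  rcases h₂.lt_or_eq with h | h
  · have hn : ⌊s⌋ = n := Int.floor_eq_iff.2 ⟨h₁, h⟩
    simp [pathPoint, Int.fract, hn]
  · have hn : ⌊s⌋ = n + 1 := by
      rw [h]
      exact_mod_cast Int.floor_intCast (n + 1)
    simp [pathPoint, Int.fract, h]

theorem abs_pathPoint_sub_le_of_mem (hv : ∀ n, G.Adj (v n) (v (n + 1))) {s t : ℝ} {n : ℤ} (hs : s ∈ Icc (n : ℝ) (n + 1))
    (ht : t ∈ Icc (n : ℝ) (n + 1)) (u : V) :
    |(pathPoint hv s).coord u - (pathPoint hv t).coord u| ≤ |s - t| := by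
  rw [pathPoint_coord hv hs.1 hs.2, pathPoint_coord hv ht.1 ht.2]
  have hne := (hv n).ne
  by_cases h1 : u = v n
  · subst h1
    simp only [if_true, if_neg hne, add_zero]
    rw [show 1 - (s - n) - (1 - (t - n)) = -(s - t) by ring, abs_neg]
  · by_cases h2 : u = v (n + 1)
    · subst h2
      simp only [if_true, if_neg hne.symm, zero_add]
      rw [show s - n - (t - n) = s - t by ring]
    · simp [h1, h2]

theorem abs_pathPoint_sub_le (hv : ∀ n, G.Adj (v n) (v (n + 1))) {s t : ℝ} (h : |s - t| < 1) (u : V) :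
    |(pathPoint hv s).coord u - (pathPoint hv t).coord u| ≤ |s - t| := by
  wlog hst : s ≤ t generalizing s t
  · rw [abs_sub_comm, abs_sub_comm s t]
    exact this (by rwa [abs_sub_comm]) (le_of_not_ge hst)
  have hs := Int.floor_le s
  have hs' := Int.lt_floor_add_one s
  rw [abs_sub_comm, abs_of_nonneg (sub_nonneg.2 hst)] at h
  by_cases ht : t ≤ ⌊s⌋ + 1
  · exact abs_pathPoint_sub_le_of_mem hv ⟨hs, hs'.le⟩ ⟨hs.trans hst, ht⟩ u
  · push Not at ht
    have h1 := abs_pathPoint_sub_le_of_mem hv (s := s) (t := (⌊s⌋ : ℝ) + 1) (n := ⌊s⌋)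
      ⟨hs, hs'.le⟩ ⟨by linarith, le_rfl⟩ u
    have h2 := abs_pathPoint_sub_le_of_mem hv (s := (⌊s⌋ : ℝ) + 1) (t := t) (n := ⌊s⌋ + 1)
      ⟨by push_cast; exact le_rfl, by push_cast; linarith⟩
      ⟨by push_cast; exact ht.le, by push_cast; linarith⟩ u
    refine (abs_sub_le _ ((pathPoint hv ((⌊s⌋ : ℝ) + 1)).coord u) _).trans ?_
    refine (add_le_add h1 h2).trans ?_
    rw [abs_sub_comm, abs_of_nonneg (by linarith : (0 : ℝ) ≤ (⌊s⌋ : ℝ) + 1 - s), abs_sub_comm,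
      abs_of_nonneg (by linarith : (0 : ℝ) ≤ t - ((⌊s⌋ : ℝ) + 1)), abs_sub_comm,
      abs_of_nonneg (sub_nonneg.2 hst)]
    linarith

theorem continuous_pathPoint (hv : ∀ n, G.Adj (v n) (v (n + 1))) : Continuous fun s : ℝ => psiPt Ψ (pathPoint hv s) := by
  rw [continuous_iff_continuousAt]
  refine fun s => tendsto_psiPt fun ε hε => ?_
  filter_upwards [Metric.ball_mem_nhds s (lt_min one_pos hε)] with t ht
  rw [Metric.mem_ball, Real.dist_eq] at ht
  exact ⟨_, rfl, fun u => (abs_pathPoint_sub_le hv (ht.trans_le (min_le_left _ _)) u).trans_lt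
    (ht.trans_le (min_le_right _ _))⟩

theorem pathPoint_coord_floor (hv : ∀ n, G.Adj (v n) (v (n + 1))) (s : ℝ) :
    (pathPoint hv s).coord (v ⌊s⌋) = 1 - Int.fract s := by
  simp [pathPoint, (hv ⌊s⌋).ne]

theorem pathPoint_coord_floor_add_one (hv : ∀ n, G.Adj (v n) (v (n + 1))) (s : ℝ) :
    (pathPoint hv s).coord (v (⌊s⌋ + 1)) = Int.fract s := by
  simp [pathPoint, (hv ⌊s⌋).ne']

theorem pathPoint_coord_ne_zero (hv : ∀ n, G.Adj (v n) (v (n + 1))) {s : ℝ} {u : V} (h : (pathPoint hv s).coord u ≠ 0) :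
    u = v ⌊s⌋ ∨ u = v (⌊s⌋ + 1) ∧ Int.fract s ≠ 0 := by
  by_contra hcon
  rw [not_or] at hcon
  obtain ⟨h1, h2⟩ := hcon
  refine h ?_
  by_cases h3 : u = v (⌊s⌋ + 1)
  · have h4 : Int.fract s = 0 := by
      by_contra h4
      exact h2 ⟨h3, h4⟩
    simp [pathPoint, h1, h4]
  · simp [pathPoint, h1, h3]

theorem pathPoint_coord_floor_ne_zero (hv : ∀ n, G.Adj (v n) (v (n + 1))) (s : ℝ) : (pathPoint hv s).coord (v ⌊s⌋) ≠ 0 := by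
  rw [pathPoint_coord_floor]
  linarith [Int.fract_lt_one s]

/-- If the walk `v` repeats itself with period `m` (or never, if `m = 0`) and has no other
repetitions, then neither has the parametrisation. -/
theorem exists_of_pathPoint_eq (hv : ∀ n, G.Adj (v n) (v (n + 1))) {m : ℤ} (hm : ¬ m ∣ 2) (hinj : ∀ a b, v a = v b → m ∣ a - b)
    {s t : ℝ} (h : pathPoint hv s = pathPoint hv t) : ∃ k : ℤ, s - t = k * m := by
  have hs0 := Int.fract_nonneg s
  have hs1 := Int.fract_lt_one s
  have ht0 := Int.fract_nonneg t
  have ht1 := Int.fract_lt_one t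
  have hs := Int.floor_add_fract s
  have ht := Int.floor_add_fract t
  have hfin : ⌊s⌋ - ⌊t⌋ ∈ {d | m ∣ d} → Int.fract s = Int.fract t → ∃ k : ℤ, s - t = k * m := by
    rintro ⟨k, hk⟩ hf
    refine ⟨k, ?_⟩
    have : ((⌊s⌋ - ⌊t⌋ : ℤ) : ℝ) = ((m * k : ℤ) : ℝ) := by rw [hk]
    push_cast at this
    linarith
  have h1 : (pathPoint hv t).coord (v ⌊s⌋) ≠ 0 := h ▸ pathPoint_coord_floor_ne_zero hv s
  have h2 : (pathPoint hv s).coord (v ⌊t⌋) ≠ 0 := h ▸ pathPoint_coord_floor_ne_zero hv t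
  rcases pathPoint_coord_ne_zero hv h1 with h1' | ⟨h1', hf1⟩
  · refine hfin (hinj _ _ h1') ?_
    have := pathPoint_coord_floor hv s
    rw [h, h1', pathPoint_coord_floor] at this
    linarith
  · rcases pathPoint_coord_ne_zero hv h2 with h2' | ⟨h2', hf2⟩
    · refine hfin (hinj _ _ h2'.symm) ?_
      have := pathPoint_coord_floor hv t
      rw [← h, h2', pathPoint_coord_floor] at this
      linarith
    · exfalso
      have h3 := hinj _ _ h1'
      have h4 := hinj _ _ h2'
      have h5 := dvd_add h3 h4
      rw [show ⌊s⌋ - (⌊t⌋ + 1) + (⌊t⌋ - (⌊s⌋ + 1)) = -2 by ring, Int.dvd_neg] at h5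
      exact hm h5

theorem pathPoint_mem_edgePoints (hv : ∀ n, G.Adj (v n) (v (n + 1))) {C : Set (Sym2 V)} {s : ℝ} (hs : Int.fract s ≠ 0)
    (h : s(v ⌊s⌋, v (⌊s⌋ + 1)) ∈ C) : psiPt Ψ (pathPoint hv s) ∈ edgePoints G Ψ C := by
  refine ⟨_, rfl, _, h, fun u => ?_⟩
  rw [Sym2.mem_iff]
  constructor
  · exact fun hu => (pathPoint_coord_ne_zero hv hu).imp id And.left
  · rintro (rfl | rfl)
    · exact pathPoint_coord_floor_ne_zero hv s
    · rwa [pathPoint_coord_floor_add_one]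

theorem pathPoint_mem_closure (hv : ∀ n, G.Adj (v n) (v (n + 1))) {C : Set (Sym2 V)} (hC : ∀ n, s(v n, v (n + 1)) ∈ C) (s : ℝ) :
    psiPt Ψ (pathPoint hv s) ∈ closure (edgePoints G Ψ C) := by
  have hd : Dense (range ((↑) : ℤ → ℝ))ᶜ := (countable_range _).dense_compl ℝ
  have h := image_closure_subset_closure_image (continuous_pathPoint (Ψ := Ψ) hv)
    (mem_image_of_mem _ (hd s))
  refine closure_mono ?_ h
  rintro _ ⟨t, ht, rfl⟩
  refine pathPoint_mem_edgePoints hv (fun h0 => ht ?_) (hC _)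
  exact Int.fract_eq_zero_iff.1 h0

theorem exists_pathPoint_eq (hv : ∀ n, G.Adj (v n) (v (n + 1))) {x : ComplexPoint G} {n : ℤ}
    (hx : ∀ u, x.coord u ≠ 0 ↔ u ∈ s(v n, v (n + 1))) : ∃ s, x = pathPoint hv s := by
  classical
  obtain ⟨A, hA, hA', hsum⟩ := x.exists_pair
  have hne := (hv n).ne
  have h1 : x.coord (v n) ≠ 0 := (hx _).2 (Sym2.mem_mk_left _ _)
  have h2 : x.coord (v (n + 1)) ≠ 0 := (hx _).2 (Sym2.mem_mk_right _ _)
  have hAeq : {v n, v (n + 1)} = A := Finset.eq_of_subset_of_card_le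
    (by simp [Finset.insert_subset_iff, hA' _ h1, hA' _ h2]) (by rwa [Finset.card_pair hne])
  rw [← hAeq, Finset.sum_pair hne] at hsum
  have hpos : ∀ u, 0 ≤ x.coord u := by
    intro u
    rcases x.mem_complex with ⟨a, ha, h0⟩ | ⟨a, b, -, ha, hb, -, h0⟩
    · by_cases hu : u = a
      · rw [hu, ha]
        exact zero_le_one
      · rw [h0 u hu]
    · by_cases hu : u = a
      · rw [hu]
        exact ha.le
      · by_cases hu' : u = b
        · rw [hu']
          exact hb.le
        · rw [h0 u hu hu']
  have hp1 := hpos (v n)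
  have hp2 := hpos (v (n + 1))
  refine ⟨n + x.coord (v (n + 1)), ComplexPoint.ext_coord fun u => ?_⟩
  rw [pathPoint_coord hv (n := n) (by linarith) (by linarith)]
  by_cases hu : u = v n
  · subst hu
    simp only [if_true, if_neg hne]
    linarith
  · by_cases hu' : u = v (n + 1)
    · subst hu'
      simp [hne.symm]
    · simp only [if_neg hu, if_neg hu', add_zero]
      by_contra h0
      exact (Sym2.mem_iff.1 ((hx u).1 h0)).elim hu hu'

theorem edgePoints_subset_range (hv : ∀ n, G.Adj (v n) (v (n + 1))) {C : Set (Sym2 V)} (hC : ∀ e ∈ C, ∃ n, e = s(v n, v (n + 1))) :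
    edgePoints G Ψ C ⊆ range fun s => psiPt Ψ (pathPoint hv s) := by
  rintro p ⟨x, hx, e, he, hxe⟩
  obtain ⟨n, rfl⟩ := hC e he
  obtain ⟨s, rfl⟩ := exists_pathPoint_eq hv hxe
  exact ⟨s, Subtype.ext hx.symm⟩

/-- Finite cycles are circles. -/
theorem isPsiCircuit_of_periodic [T2Space (psiSpace G Ψ)]
    (hv : ∀ n, G.Adj (v n) (v (n + 1))) {m : ℕ} (hm : ¬ (m : ℤ) ∣ 2) (hm0 : m ≠ 0)
    (hper : ∀ n, v (n + m) = v n) (hinj : ∀ a b, v a = v b → (m : ℤ) ∣ a - b)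
    {C : Set (Sym2 V)} (hC : ∀ e, e ∈ C ↔ ∃ n, e = s(v n, v (n + 1))) : IsPsiCircuit G Ψ C := by
  have hm0' : (m : ℝ) ≠ 0 := Nat.cast_ne_zero.2 hm0
  have hP : Function.Periodic (fun s : ℝ => psiPt Ψ (pathPoint hv s)) m := by
    intro s
    refine congrArg _ (ComplexPoint.ext_coord fun u => ?_)
    have h1 : v ⌊s + m⌋ = v ⌊s⌋ := by rw [Int.floor_add_natCast, hper]
    have h1' : v (⌊s + m⌋ + 1) = v (⌊s⌋ + 1) := by
      rw [Int.floor_add_natCast, ← hper (⌊s⌋ + 1), add_right_comm]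
    have h2 : Int.fract (s + m) = Int.fract s := Int.fract_add_natCast s m
    simp only [pathPoint, h2]
    rw [h1, h1']
  have hrange : range hP.lift = range fun s => psiPt Ψ (pathPoint hv s) := by
    ext p
    constructor
    · rintro ⟨a, rfl⟩
      induction a using QuotientAddGroup.induction_on with
      | H s => exact ⟨s, (hP.lift_coe s).symm⟩
    · rintro ⟨s, rfl⟩
      exact ⟨(s : AddCircle (m : ℝ)), hP.lift_coe s⟩
  have : Fact (0 < (m : ℝ)) := ⟨by positivity⟩
  refine isPsiCircuit_of_parametrization (K := AddCircle (m : ℝ)) ?_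
    (AddCircle.homeomorphCircle hm0') hP.lift ?_ ?_ ?_ ?_
  · intro e he
    obtain ⟨n, rfl⟩ := (hC e).1 he
    exact hv n
  · exact (continuous_pathPoint hv).quotient_liftOn' _
  · intro a b hab
    induction a using QuotientAddGroup.induction_on with
    | H s =>
      induction b using QuotientAddGroup.induction_on with
      | H t =>
        have hab' : psiPt Ψ (pathPoint hv s) = psiPt Ψ (pathPoint hv t) := hab
        obtain ⟨k, hk⟩ := exists_of_pathPoint_eq hv hm hinj (psiPt_injective hab')
        change ((s : ℝ) : AddCircle (m : ℝ)) = (t : ℝ)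
        rw [← sub_eq_zero, ← AddCircle.coe_sub, AddCircle.coe_eq_zero_iff]
        exact ⟨k, by rw [hk, zsmul_eq_mul, Int.cast_natCast]⟩
  · rw [hrange]
    exact edgePoints_subset_range hv fun e he => (hC e).1 he
  · rw [hrange]
    rintro _ ⟨s, rfl⟩
    exact pathPoint_mem_closure hv (fun n => (hC _).2 ⟨n, rfl⟩) s

/-- A two-way infinite path whose tails converge to one end forms a circle together with that
end. -/
theorem isPsiCircuit_of_one_end [T2Space (psiSpace G Ψ)]
    (hv : ∀ n, G.Adj (v n) (v (n + 1))) (hinj : Function.Injective v) {ω : G.end}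
    (hω : ω ∈ Ψ)
    (htop : Filter.Tendsto (fun s => psiPt Ψ (pathPoint hv s)) Filter.atTop (nhds (psiEnd ω hω)))
    (hbot : Filter.Tendsto (fun s => psiPt Ψ (pathPoint hv s)) Filter.atBot (nhds (psiEnd ω hω)))
    {C : Set (Sym2 V)} (hC : ∀ e, e ∈ C ↔ ∃ n, e = s(v n, v (n + 1))) : IsPsiCircuit G Ψ C := by
  obtain ⟨e₀⟩ := nonempty_onePoint_homeomorph_circle
  let Φ : OnePoint ℝ → psiSpace G Ψ := fun a =>
    a.elim (psiEnd ω hω) fun s => psiPt Ψ (pathPoint hv s)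
  have hne : ∀ x, psiPt Ψ x ≠ psiEnd ω hω := fun x h => by
    have := congrArg Subtype.val h
    simp [psiPt, psiEnd] at this
  refine isPsiCircuit_of_parametrization (K := OnePoint ℝ) ?_ e₀ Φ ?_ ?_ ?_ ?_
  · intro e he
    obtain ⟨n, rfl⟩ := (hC e).1 he
    exact hv n
  · rw [OnePoint.continuous_iff]
    refine ⟨?_, continuous_pathPoint hv⟩
    rw [Filter.coclosedCompact_eq_cocompact, cocompact_eq_atBot_atTop]
    exact hbot.sup htop
  · intro a b hab
    induction a using OnePoint.rec with
    | infty =>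
      induction b using OnePoint.rec with
      | infty => rfl
      | coe t => exact absurd hab.symm (hne _)
    | coe s =>
      induction b using OnePoint.rec with
      | infty => exact absurd hab (hne _)
      | coe t =>
        obtain ⟨k, hk⟩ := exists_of_pathPoint_eq hv (m := 0) (by simp)
          (fun a b h => by simp [hinj h]) (psiPt_injective hab)
        rw [Int.cast_zero, mul_zero, sub_eq_zero] at hk
        rw [hk]
  · refine (edgePoints_subset_range hv fun e he => (hC e).1 he).trans ?_
    rintro _ ⟨s, rfl⟩
    exact ⟨(s : OnePoint ℝ), rfl⟩
  · rintro _ ⟨a, rfl⟩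
    have hcl := pathPoint_mem_closure (Ψ := Ψ) hv fun n => (hC _).2 ⟨n, rfl⟩
    induction a using OnePoint.rec with
    | infty => exact isClosed_closure.mem_of_tendsto htop (Filter.Eventually.of_forall hcl)
    | coe s => exact hcl s

/-- Two disjoint two-way infinite paths that lead from one end to another form a circle together
with these ends. It is parametrised by the projective line, with `∞` and `0` mapped to the ends,
and the logarithm of `|t|` giving the position on the first path for `t > 0` and on the second path
for `t < 0`. -/
theorem isPsiCircuit_of_two_ends [T2Space (psiSpace G Ψ)]
    (hv : ∀ n, G.Adj (v n) (v (n + 1))) {w : ℤ → V}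
    (hw : ∀ n, G.Adj (w n) (w (n + 1))) (hinj : Function.Injective v) (hinj' : Function.Injective w)
    (hvw : ∀ a b, v a ≠ w b) {ω η : G.end} (hω : ω ∈ Ψ) (hη : η ∈ Ψ) (hωη : ω ≠ η)
    (htop : Filter.Tendsto (fun s => psiPt Ψ (pathPoint hv s)) Filter.atTop (nhds (psiEnd ω hω)))
    (hbot : Filter.Tendsto (fun s => psiPt Ψ (pathPoint hv s)) Filter.atBot (nhds (psiEnd η hη)))
    (htop' : Filter.Tendsto (fun s => psiPt Ψ (pathPoint hw s)) Filter.atTop (nhds (psiEnd ω hω)))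
    (hbot' : Filter.Tendsto (fun s => psiPt Ψ (pathPoint hw s)) Filter.atBot (nhds (psiEnd η hη)))
    {C : Set (Sym2 V)}
    (hC : ∀ e, e ∈ C ↔ (∃ n, e = s(v n, v (n + 1))) ∨ ∃ n, e = s(w n, w (n + 1))) :
    IsPsiCircuit G Ψ C := by
  obtain ⟨e₀⟩ := nonempty_onePoint_homeomorph_circle
  let Fv : ℝ → psiSpace G Ψ := fun s => psiPt Ψ (pathPoint hv s)
  let Fw : ℝ → psiSpace G Ψ := fun s => psiPt Ψ (pathPoint hw s)
  let F : ℝ → psiSpace G Ψ := fun t =>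
    if 0 < t then Fv (Real.log t) else if t < 0 then Fw (Real.log t) else psiEnd η hη
  have hFpos : ∀ t, 0 < t → F t = Fv (Real.log t) := fun t ht => if_pos ht
  have hFneg : ∀ t, t < 0 → F t = Fw (Real.log t) := fun t ht => by
    simp only [F, if_neg ht.not_gt, if_pos ht]
  have hF0 : F 0 = psiEnd η hη := by simp [F]
  let Φ : OnePoint ℝ → psiSpace G Ψ := fun a => a.elim (psiEnd ω hω) F
  have hne : ∀ x ω (hω : ω ∈ Ψ), psiPt Ψ x ≠ psiEnd ω hω := fun x ω hω h => by
    have := congrArg Subtype.val h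
    simp [psiPt, psiEnd] at this
  have hωη' : psiEnd ω hω ≠ psiEnd η hη := fun h => by
    have := congrArg Subtype.val h
    simp only [psiEnd, Point.atEnd.injEq] at this
    exact hωη this
  have hFω : ∀ t, F t ≠ psiEnd ω hω := by
    intro t
    rcases lt_trichotomy t 0 with ht | rfl | ht
    · rw [hFneg t ht]
      exact hne _ _ _
    · rw [hF0]
      exact hωη'.symm
    · rw [hFpos t ht]
      exact hne _ _ _
  have hvw' : ∀ s t, Fv s ≠ Fw t := by
    intro s t h
    have h' := psiPt_injective h
    have h1 := pathPoint_coord_floor_ne_zero hv s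
    rw [h'] at h1
    exact (pathPoint_coord_ne_zero hw h1).elim (hvw _ _) fun h => hvw _ _ h.1
  have hcont : Continuous F := by
    rw [continuous_iff_continuousAt]
    intro t
    rcases lt_trichotomy t 0 with ht | rfl | ht
    · have h : ContinuousAt (fun t => Fw (Real.log t)) t :=
        ContinuousAt.comp (g := Fw) (continuous_pathPoint hw).continuousAt
          (Real.continuousAt_log ht.ne)
      refine h.congr ?_
      filter_upwards [Iio_mem_nhds ht] with s hs
      exact (hFneg s hs).symm
    · rw [continuousAt_iff_continuous_left'_right']
      constructor
      · rw [ContinuousWithinAt, hF0]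
        refine (hbot'.comp Real.tendsto_log_nhdsLT_zero).congr' ?_
        filter_upwards [self_mem_nhdsWithin] with s hs
        exact (hFneg s hs).symm
      · rw [ContinuousWithinAt, hF0]
        refine (hbot.comp Real.tendsto_log_nhdsGT_zero).congr' ?_
        filter_upwards [self_mem_nhdsWithin] with s hs
        exact (hFpos s hs).symm
    · have h : ContinuousAt (fun t => Fv (Real.log t)) t :=
        ContinuousAt.comp (g := Fv) (continuous_pathPoint hv).continuousAt
          (Real.continuousAt_log ht.ne')
      refine h.congr ?_
      filter_upwards [Ioi_mem_nhds ht] with s hs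
      exact (hFpos s hs).symm
  have hFinj : Function.Injective F := by
    have hz : ∀ a b : ℤ, a = b → (0 : ℤ) ∣ a - b := fun a b h => by simp [h]
    intro s t hst
    rcases lt_trichotomy s 0 with hs | rfl | hs <;> rcases lt_trichotomy t 0 with ht | rfl | ht
    · rw [hFneg s hs, hFneg t ht] at hst
      obtain ⟨k, hk⟩ := exists_of_pathPoint_eq hw (m := 0) (by simp)
        (fun a b h => hz _ _ (hinj' h)) (psiPt_injective hst)
      rw [Int.cast_zero, mul_zero, sub_eq_zero] at hk
      rw [← Real.log_neg_eq_log s, ← Real.log_neg_eq_log t] at hk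
      exact neg_injective (Real.log_injOn_pos (neg_pos.2 hs) (neg_pos.2 ht) hk)
    · rw [hFneg s hs, hF0] at hst
      exact absurd hst (hne _ _ _)
    · rw [hFneg s hs, hFpos t ht] at hst
      exact absurd hst.symm (hvw' _ _)
    · rw [hFneg t ht, hF0] at hst
      exact absurd hst.symm (hne _ _ _)
    · rfl
    · rw [hFpos t ht, hF0] at hst
      exact absurd hst.symm (hne _ _ _)
    · rw [hFneg t ht, hFpos s hs] at hst
      exact absurd hst (hvw' _ _)
    · rw [hFpos s hs, hF0] at hst
      exact absurd hst (hne _ _ _)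
    · rw [hFpos s hs, hFpos t ht] at hst
      obtain ⟨k, hk⟩ := exists_of_pathPoint_eq hv (m := 0) (by simp)
        (fun a b h => hz _ _ (hinj h)) (psiPt_injective hst)
      rw [Int.cast_zero, mul_zero, sub_eq_zero] at hk
      exact Real.log_injOn_pos hs ht hk
  refine isPsiCircuit_of_parametrization (K := OnePoint ℝ) ?_ e₀ Φ ?_ ?_ ?_ ?_
  · intro e he
    rcases (hC e).1 he with ⟨n, rfl⟩ | ⟨n, rfl⟩
    · exact hv n
    · exact hw n
  · rw [OnePoint.continuous_iff]
    refine ⟨?_, hcont⟩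
    rw [Filter.coclosedCompact_eq_cocompact, cocompact_eq_atBot_atTop]
    refine Filter.Tendsto.sup ?_ ?_
    · refine (htop'.comp (Real.tendsto_log_atTop.comp Filter.tendsto_neg_atBot_atTop)).congr' ?_
      filter_upwards [Filter.eventually_lt_atBot (0 : ℝ)] with s hs
      simp only [Function.comp_apply, Real.log_neg_eq_log]
      exact (hFneg s hs).symm
    · refine (htop.comp Real.tendsto_log_atTop).congr' ?_
      filter_upwards [Filter.eventually_gt_atTop (0 : ℝ)] with s hs
      exact (hFpos s hs).symm
  · intro a b hab
    induction a using OnePoint.rec with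
    | infty =>
      induction b using OnePoint.rec with
      | infty => rfl
      | coe t => exact absurd hab.symm (hFω t)
    | coe s =>
      induction b using OnePoint.rec with
      | infty => exact absurd hab (hFω s)
      | coe t => exact congrArg _ (hFinj hab)
  · rintro p ⟨x, hx, e, he, hxe⟩
    rcases (hC e).1 he with ⟨n, rfl⟩ | ⟨n, rfl⟩
    · obtain ⟨s, rfl⟩ := exists_pathPoint_eq hv hxe
      refine ⟨(Real.exp s : ℝ), Subtype.ext ?_⟩
      rw [hx]
      change (F (Real.exp s)).1 = _
      rw [hFpos _ (Real.exp_pos s), Real.log_exp]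
      rfl
    · obtain ⟨s, rfl⟩ := exists_pathPoint_eq hw hxe
      refine ⟨((-Real.exp s : ℝ) : OnePoint ℝ), Subtype.ext ?_⟩
      rw [hx]
      change (F (-Real.exp s)).1 = _
      rw [hFneg _ (neg_neg_of_pos (Real.exp_pos s)), Real.log_neg_eq_log, Real.log_exp]
      rfl
  · have hcl := pathPoint_mem_closure (Ψ := Ψ) hv fun n => (hC _).2 (Or.inl ⟨n, rfl⟩)
    have hcl' := pathPoint_mem_closure (Ψ := Ψ) hw fun n => (hC _).2 (Or.inr ⟨n, rfl⟩)
    rintro _ ⟨a, rfl⟩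
    induction a using OnePoint.rec with
    | infty => exact isClosed_closure.mem_of_tendsto htop (Filter.Eventually.of_forall hcl)
    | coe t =>
      change F t ∈ _
      rcases lt_trichotomy t 0 with ht | rfl | ht
      · rw [hFneg t ht]
        exact hcl' _
      · rw [hF0]
        exact isClosed_closure.mem_of_tendsto hbot (Filter.Eventually.of_forall hcl)
      · rw [hFpos t ht]
        exact hcl _

end PathPoint

/-! ### The double ray through two legs -/

namespace Terminal

/-- The path from the root to the terminal `z` is an initial part of the path along `x`. -/
def Along (x : ℕ → Bool) : Terminal → Prop
  | vertex v => v = initialSegment x v.length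
  | seq y => y = x

theorem Along.mem_path_iff {x : ℕ → Bool} {z : Terminal} (h : z.Along x) {p : List Bool} :
    p ∈ z.path ↔ p ∈ (seq x).path ∧ ∀ v, z = vertex v → p.length ≤ v.length := by
  cases z with
  | vertex v =>
    have hv : v = initialSegment x v.length := h
    rw [mem_path_vertex]
    constructor
    · intro hp
      refine ⟨mem_path_of_suffix (mem_path_seq.2 hv) hp, ?_⟩
      rintro _ ⟨⟩
      exact hp.length_le
    · rintro ⟨h1, h2⟩
      exact suffix_of_length_le h1 (mem_path_seq.2 hv) (h2 v rfl)
  | seq y =>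
    obtain rfl : y = x := h
    simp

/-- The path to a vertex extends to a ray that leaves the vertex in any given direction. -/
theorem exists_along_vertex (v : List Bool) (b : Bool) :
    ∃ x, (vertex v).Along x ∧ x v.length = b := by
  have h : ∃ x : ℕ → Bool, initialSegment x v.length = v := by
    induction v with
    | nil => exact ⟨fun _ => true, rfl⟩
    | cons c s ih =>
      obtain ⟨x, hx⟩ := ih
      refine ⟨fun n => if n < s.length then x n else c, ?_⟩
      have : ∀ m ≤ s.length, initialSegment (fun n => if n < s.length then x n else c) m =
          initialSegment x m := by
        intro m hm
        induction m with
        | zero => rfl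
        | succ m ih => simp [initialSegment, ih (by omega), show m < s.length by omega]
      simp [initialSegment, this _ le_rfl, hx]
  obtain ⟨x, hx⟩ := h
  refine ⟨fun n => if n < v.length then x n else b, ?_, by simp⟩
  have : ∀ m ≤ v.length, initialSegment (fun n => if n < v.length then x n else b) m =
      initialSegment x m := by
    intro m hm
    induction m with
    | zero => rfl
    | succ m ih => simp [initialSegment, ih (by omega), show m < v.length by omega]
  exact hx.symm.trans (this _ le_rfl).symm

theorem exists_along (z : Terminal) : ∃ x, z.Along x := by
  cases z with
  | vertex v =>
    obtain ⟨x, hx, -⟩ := exists_along_vertex v true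
    exact ⟨x, hx⟩
  | seq x => exact ⟨x, rfl⟩

/-- The paths to two different terminals extend to rays that separate where these paths do. -/
theorem exists_along_along {z z' : Terminal} (h : z ≠ z') : ∃ x y k, z.Along x ∧ z'.Along y ∧
    initialSegment x k = initialSegment y k ∧ x k ≠ y k ∧ initialSegment x k ∈ z.path ∧
    initialSegment x k ∈ z'.path := by
  obtain ⟨u, hu⟩ := exists_meet h
  obtain ⟨huz, huz'⟩ := (hu u).2 List.suffix_rfl
  have hinit : ∀ {z : Terminal} {x : ℕ → Bool}, z.Along x → u ∈ z.path →
      initialSegment x u.length = u := fun hx hu =>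
    (mem_path_seq.1 (hx.mem_path_iff.1 hu).1).symm
  suffices ∃ x y, z.Along x ∧ z'.Along y ∧ x u.length ≠ y u.length by
    obtain ⟨x, y, hx, hy, hne⟩ := this
    have h1 := hinit hx huz
    exact ⟨x, y, u.length, hx, hy, h1.trans (hinit hy huz').symm, hne, h1.symm ▸ huz,
      h1.symm ▸ huz'⟩
  by_cases hzu : z = vertex u
  · obtain ⟨y, hy⟩ := exists_along z'
    obtain ⟨x, hx, hxu⟩ := exists_along_vertex u (!y u.length)
    exact ⟨x, y, hzu ▸ hx, hy, by simp [hxu]⟩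
  by_cases hzu' : z' = vertex u
  · obtain ⟨x, hx⟩ := exists_along z
    obtain ⟨y, hy, hyu⟩ := exists_along_vertex u (!x u.length)
    exact ⟨x, y, hx, hzu' ▸ hy, by simp [hyu]⟩
  obtain ⟨x, hx⟩ := exists_along z
  obtain ⟨y, hy⟩ := exists_along z'
  refine ⟨x, y, hx, hy, fun hxy => ?_⟩
  have hnext : ∀ {z : Terminal} {x : ℕ → Bool}, z.Along x → u ∈ z.path → z ≠ vertex u →
      x u.length :: u ∈ z.path := by
    intro z x hx huz hzu
    refine hx.mem_path_iff.2 ⟨?_, ?_⟩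
    · have := initialSegment_mem_path x (u.length + 1)
      rwa [initialSegment, hinit hx huz] at this
    · rintro v rfl
      have huv : u <:+ v := huz
      have h1 := huv.length_le
      have h2 : u.length ≠ v.length := fun h => hzu (by rw [huv.eq_of_length h])
      simp only [List.length_cons]
      omega
  have := ((hu (x u.length :: u)).1 ⟨hnext hx huz hzu, hxy ▸ hnext hy huz' hzu'⟩).length_le
  simp at this

end Terminal

/-- The double ray of `T₂` that comes down along `y` to the vertex of height `k` and goes up
along `x`. -/
def doubleRay (x y : ℕ → Bool) (k : ℕ) : ℤ → List Bool
  | .ofNat n => initialSegment x (k + n)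
  | .negSucc n => initialSegment y (k + (n + 1))

section DoubleRay

variable {x y : ℕ → Bool} {k : ℕ}

theorem doubleRay_natCast (n : ℕ) : doubleRay x y k n = initialSegment x (k + n) := rfl

theorem doubleRay_neg_natCast (h : initialSegment x k = initialSegment y k) (n : ℕ) :
    doubleRay x y k (-n) = initialSegment y (k + n) := by
  cases n with
  | zero => exact h
  | succ n => rfl

theorem length_doubleRay (n : ℤ) : (doubleRay x y k n).length = k + n.natAbs := by
  cases n with
  | ofNat n => simp [doubleRay]
  | negSucc n => simp [doubleRay]

theorem doubleRay_injective (hne : x k ≠ y k) : Function.Injective (doubleRay x y k) := by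
  have key : ∀ m n : ℕ, initialSegment x (k + (m + 1)) ≠ initialSegment y (k + (n + 1)) := by
    intro m n h
    have h1 : initialSegment x (k + 1) <:+ initialSegment y (k + (n + 1)) :=
      h ▸ initialSegment_suffix x (by omega)
    have h2 := eq_initialSegment_of_suffix h1
    rw [length_initialSegment] at h2
    exact hne (List.cons.inj h2).1
  intro a b hab
  have hlen := congrArg List.length hab
  rw [length_doubleRay, length_doubleRay] at hlen
  rcases Int.natAbs_eq_natAbs_iff.1 (show a.natAbs = b.natAbs by omega) with h | h
  · exact h
  · rcases a with m | m
    · rcases b with n | n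
      · simp only [Int.ofNat_eq_natCast] at h ⊢
        omega
      · rcases m with _ | m
        · simp at hlen
        · exact absurd hab (key m n)
    · rcases b with n | n
      · rcases n with _ | n
        · simp at hlen
        · exact absurd hab.symm (key n m)
      · omega

theorem doubleRay_add_one (h : initialSegment x k = initialSegment y k) (n : ℤ) :
    (0 ≤ n ∧ ∃ b, doubleRay x y k (n + 1) = b :: doubleRay x y k n) ∨
      n < 0 ∧ ∃ b, doubleRay x y k n = b :: doubleRay x y k (n + 1) := by
  rcases n with n | n
  · exact Or.inl ⟨Int.natCast_nonneg n, _, rfl⟩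
  · refine Or.inr ⟨Int.negSucc_lt_zero n, y (k + n), ?_⟩
    rw [show Int.negSucc n + 1 = -(n : ℤ) by omega, doubleRay_neg_natCast h]
    rfl

theorem doubleTree_adj_doubleRay (h : initialSegment x k = initialSegment y k) (n : ℤ) (i : Bool) :
    doubleTree.Adj (doubleRay x y k n, i) (doubleRay x y k (n + 1), i) := by
  rw [doubleTree_adj]
  rcases doubleRay_add_one h n with ⟨-, b, hb⟩ | ⟨-, b, hb⟩
  · exact Or.inl ⟨rfl, b, Or.inl hb⟩
  · exact Or.inl ⟨rfl, b, Or.inr hb⟩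

/-- The circuit given by two legs: the edges of both copies of the part of the double ray between the
two terminals, and the rungs at the terminals that are vertices. -/
theorem mem_image_symmDiff_leg {z z' : Terminal} (hx : z.Along x) (hy : z'.Along y)
    (h : initialSegment x k = initialSegment y k) (hne : x k ≠ y k) (hkz : initialSegment x k ∈ z.path)
    (hkz' : initialSegment x k ∈ z'.path) (hzz' : z ≠ z') {e : Sym2 (List Bool × Bool)} :
    e ∈ edgeEmb '' symmDiff z.leg z'.leg ↔
      (∃ (n : ℤ) (i : Bool), (∀ v, z = vertex v → 0 ≤ n → k + n < v.length) ∧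
        (∀ v, z' = vertex v → n < 0 → k - n ≤ v.length) ∧
        e = s((doubleRay x y k n, i), (doubleRay x y k (n + 1), i))) ∨
      ∃ v, (z = vertex v ∨ z' = vertex v) ∧ e = s((v, false), (v, true)) := by
  have hk : ∀ v, z = vertex v → k ≤ v.length := fun v hv => by
    simpa using (hx.mem_path_iff.1 hkz).2 v hv
  have hk' : ∀ v, z' = vertex v → k ≤ v.length := fun v hv => by
    simpa using (hy.mem_path_iff.1 hkz').2 v hv
  have hlow : ∀ p : List Bool, p.length ≤ k → (p ∈ z.path ↔ p ∈ z'.path) := by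
    intro p hp
    rw [hx.mem_path_iff, hy.mem_path_iff, mem_path_seq_iff_suffix hp, mem_path_seq_iff_suffix hp, h]
    exact and_congr_right fun _ => ⟨fun _ v hv => hp.trans (hk' v hv), fun _ v hv => hp.trans (hk v hv)⟩
  have hhigh : ∀ p : List Bool, p ∈ z.path → p ∈ z'.path → p.length ≤ k := by
    intro p hp hp'
    by_contra hlt
    have h1 := (hx.mem_path_iff.1 hp).1
    have h2 := (hy.mem_path_iff.1 hp').1
    rw [mem_path_seq] at h1 h2
    have h3 : initialSegment x (k + 1) <:+ initialSegment y p.length := by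
      rw [← h2, h1]
      exact initialSegment_suffix x (by omega)
    have h4 := eq_initialSegment_of_suffix h3
    rw [length_initialSegment] at h4
    exact hne (List.cons.inj h4).1
  constructor
  · rintro ⟨⟨p, b, i⟩ | v, he, rfl⟩
    · left
      rcases he with ⟨h1, h2⟩ | ⟨h1, h2⟩
      · rw [side_mem_leg] at h1 h2
        have hlt : k < (b :: p).length := by
          by_contra hle
          exact h2 ((hlow _ (not_lt.1 hle)).1 h1)
        obtain ⟨h3, h4⟩ := hx.mem_path_iff.1 h1
        rw [List.length_cons] at hlt
        obtain ⟨m, hm⟩ : ∃ m, p.length = k + m := ⟨p.length - k, by omega⟩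
        refine ⟨m, i, fun v hv _ => ?_, fun v hv hm => by omega, ?_⟩
        · have := h4 v hv
          rw [List.length_cons] at this
          omega
        · rw [show (m : ℤ) + 1 = (m + 1 : ℕ) by push_cast; rfl, doubleRay_natCast, doubleRay_natCast,
            edgeEmb_side]
          rw [mem_path_seq, List.length_cons, hm] at h3
          rw [show k + (m + 1) = k + m + 1 by omega, ← h3, (List.cons.inj h3).2]
      · rw [side_mem_leg] at h1 h2
        have hlt : k < (b :: p).length := by
          by_contra hle
          exact h2 ((hlow _ (not_lt.1 hle)).2 h1)
        obtain ⟨h3, h4⟩ := hy.mem_path_iff.1 h1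
        rw [List.length_cons] at hlt
        obtain ⟨m, hm⟩ : ∃ m, p.length = k + m := ⟨p.length - k, by omega⟩
        refine ⟨-(m + 1 : ℕ), i, fun v hv hm => by omega, fun v hv _ => ?_, ?_⟩
        · have := h4 v hv
          rw [List.length_cons] at this
          omega
        · rw [show -((m + 1 : ℕ) : ℤ) + 1 = -(m : ℕ) by push_cast; ring, doubleRay_neg_natCast h,
            doubleRay_neg_natCast h, edgeEmb_side]
          rw [mem_path_seq, List.length_cons, hm] at h3
          rw [show k + (m + 1) = k + m + 1 by omega, ← h3, ← (List.cons.inj h3).2]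
          exact Sym2.eq_swap
    · right
      rcases he with ⟨h1, -⟩ | ⟨h1, -⟩
      · exact ⟨v, Or.inl h1, rfl⟩
      · exact ⟨v, Or.inr h1, rfl⟩
  · rintro (⟨n, i, h1, h2, rfl⟩ | ⟨v, hv, rfl⟩)
    · rcases lt_or_ge n 0 with hn | hn
      · obtain ⟨m, rfl⟩ : ∃ m : ℕ, n = -(m + 1 : ℕ) := ⟨(-n - 1).toNat, by omega⟩
        refine ⟨.side (initialSegment y (k + m)) (y (k + m)) i, Or.inr ⟨?_, fun h3 => ?_⟩, ?_⟩
        · refine hy.mem_path_iff.2 ⟨initialSegment_mem_path y (k + m + 1), fun v hv => ?_⟩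
          have := h2 v hv hn
          rw [List.length_cons, length_initialSegment]
          omega
        · have := hhigh _ h3 (hy.mem_path_iff.2 ⟨initialSegment_mem_path y (k + m + 1),
            fun v hv => by
              have := h2 v hv hn
              rw [List.length_cons, length_initialSegment]
              omega⟩)
          simp at this
        · rw [show -((m + 1 : ℕ) : ℤ) + 1 = -(m : ℕ) by push_cast; ring, doubleRay_neg_natCast h,
            doubleRay_neg_natCast h, edgeEmb_side]
          exact Sym2.eq_swap
      · obtain ⟨m, rfl⟩ : ∃ m : ℕ, n = m := ⟨n.toNat, by omega⟩
        refine ⟨.side (initialSegment x (k + m)) (x (k + m)) i, Or.inl ⟨?_, fun h3 => ?_⟩, ?_⟩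
        · refine hx.mem_path_iff.2 ⟨initialSegment_mem_path x (k + m + 1), fun v hv => ?_⟩
          have := h1 v hv hn
          rw [List.length_cons, length_initialSegment]
          omega
        · have := hhigh _ (hx.mem_path_iff.2 ⟨initialSegment_mem_path x (k + m + 1),
            fun v hv => by
              have := h1 v hv hn
              rw [length_initialSegment]
              omega⟩) h3
          simp at this
        · rfl
    · refine ⟨.rung v, ?_, rfl⟩
      rw [mem_symmDiff, rung_mem_leg, rung_mem_leg]
      rcases hv with hv | hv
      · exact Or.inl ⟨hv, fun hv' => hzz' (hv.trans hv'.symm)⟩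
      · exact Or.inr ⟨hv, fun hv' => hzz' (hv'.trans hv.symm)⟩

end DoubleRay

/-! ### The circuits are circles -/

/-- A walk that eventually stays above all initial segments of a 0-1-sequence converges to the
corresponding end. -/
theorem tendsto_pathPoint {Ψ : Set (ℕ → Bool)} {x : ℕ → Bool} {ω : doubleTree.end}
    (hω : IsEndOf x ω) (hΨ : ω ∈ endsOf Ψ) {v : ℤ → List Bool × Bool}
    (hv : ∀ n, doubleTree.Adj (v n) (v (n + 1))) {l : Filter ℝ} {l' : Filter ℤ}
    (hl : Filter.Tendsto Int.floor l l')
    (h : ∀ N, ∀ᶠ n in l', v n ∈ upper (initialSegment x N)) :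
    Filter.Tendsto (fun s => psiPt (endsOf Ψ) (pathPoint hv s)) l (nhds (psiEnd ω hΨ)) := by
  refine tendsto_psiEnd hΨ fun S => ?_
  obtain ⟨N, hN⟩ := hω.exists_upper_subset S
  filter_upwards [hl.eventually (h N)] with s hs
  exact Or.inl ⟨_, rfl, v ⌊s⌋, hN N le_rfl hs, pathPoint_coord_floor_ne_zero hv s⟩

section

variable {x y : ℕ → Bool} {k : ℕ} {Ψ : Set (ℕ → Bool)}

theorem isPsiCircuit_of_seq_seq (hxy : initialSegment x k = initialSegment y k) (hne : x k ≠ y k)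
    (hxΨ : x ∈ Ψ) (hyΨ : y ∈ Ψ) {C : Set (Sym2 (List Bool × Bool))}
    (hC : ∀ e, e ∈ C ↔ ∃ (n : ℤ) (i : Bool),
      e = s((doubleRay x y k n, i), (doubleRay x y k (n + 1), i))) :
    IsPsiCircuit doubleTree (endsOf Ψ) C := by
  obtain ⟨ω, hω⟩ := exists_isEndOf x
  obtain ⟨η, hη⟩ := exists_isEndOf y
  have hωΨ : ω ∈ endsOf Ψ := ⟨x, hxΨ, hω⟩
  have hηΨ : η ∈ endsOf Ψ := ⟨y, hyΨ, hη⟩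
  have hadj := fun i n => doubleTree_adj_doubleRay hxy n i
  have hinj : ∀ i : Bool, Function.Injective fun n => (doubleRay x y k n, i) := fun i m n h =>
    doubleRay_injective hne (Prod.mk.inj h).1
  have htop : ∀ i, Filter.Tendsto (fun s => psiPt (endsOf Ψ) (pathPoint (hadj i) s)) Filter.atTop
      (nhds (psiEnd ω hωΨ)) := fun i =>
    tendsto_pathPoint hω hωΨ (hadj i) tendsto_floor_atTop fun N => by
      filter_upwards [Filter.eventually_ge_atTop (N : ℤ)] with n hn
      obtain ⟨m, rfl⟩ := Int.eq_ofNat_of_zero_le (by omega : 0 ≤ n)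
      exact initialSegment_suffix x (by omega)
  have hbot : ∀ i, Filter.Tendsto (fun s => psiPt (endsOf Ψ) (pathPoint (hadj i) s)) Filter.atBot
      (nhds (psiEnd η hηΨ)) := fun i =>
    tendsto_pathPoint hη hηΨ (hadj i) tendsto_floor_atBot fun N => by
      filter_upwards [Filter.eventually_le_atBot (-N : ℤ)] with n hn
      obtain ⟨m, hm⟩ := Int.eq_ofNat_of_zero_le (by omega : 0 ≤ -n)
      obtain rfl : n = -(m : ℤ) := by omega
      rw [doubleRay_neg_natCast hxy]
      exact initialSegment_suffix y (by omega)
  refine isPsiCircuit_of_two_ends (hadj false) (hadj true) (hinj _) (hinj _)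
    (fun a b h => by simpa using (Prod.mk.inj h).2) hωΨ hηΨ ?_ (htop _) (hbot _) (htop _) (hbot _) ?_
  · rintro rfl
    exact hne (congrFun (hω.seq_unique hη) k)
  · intro e
    rw [hC e]
    constructor
    · rintro ⟨n, i, rfl⟩
      cases i
      · exact Or.inl ⟨n, rfl⟩
      · exact Or.inr ⟨n, rfl⟩
    · rintro (⟨n, rfl⟩ | ⟨n, rfl⟩)
      · exact ⟨n, false, rfl⟩
      · exact ⟨n, true, rfl⟩

/-- A ray in `T₂`, run through down one copy and up the other. -/
theorem isPsiCircuit_of_ray {r : ℕ → List Bool} (hinj : Function.Injective r)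
    (hadj : ∀ n i, doubleTree.Adj (r n, i) (r (n + 1), i)) (hxΨ : x ∈ Ψ)
    (hr : ∀ N, ∀ᶠ n in Filter.atTop, initialSegment x N <:+ r n)
    {C : Set (Sym2 (List Bool × Bool))}
    (hC : ∀ e, e ∈ C ↔ (∃ (n : ℕ) (i : Bool), e = s((r n, i), (r (n + 1), i))) ∨
      e = s((r 0, false), (r 0, true))) :
    IsPsiCircuit doubleTree (endsOf Ψ) C := by
  obtain ⟨ω, hω⟩ := exists_isEndOf x
  have hωΨ : ω ∈ endsOf Ψ := ⟨x, hxΨ, hω⟩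
  let v : ℤ → List Bool × Bool := fun
    | .ofNat n => (r n, false)
    | .negSucc n => (r n, true)
  have hv : ∀ n, doubleTree.Adj (v n) (v (n + 1)) := by
    rintro (n | _ | n)
    · exact hadj n false
    · exact doubleTree_adj.2 (Or.inr ⟨rfl, by simp⟩)
    · exact (hadj n true).symm
  have hr' : ∀ N, ∃ M, ∀ n ≥ M, initialSegment x N <:+ r n := fun N =>
    Filter.eventually_atTop.1 (hr N)
  refine isPsiCircuit_of_one_end hv ?_ hωΨ
    (tendsto_pathPoint hω hωΨ hv tendsto_floor_atTop fun N => ?_)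
    (tendsto_pathPoint hω hωΨ hv tendsto_floor_atBot fun N => ?_) ?_
  · rintro (m | m) (n | n) h
    · rw [hinj (Prod.mk.inj h).1]
    · exact absurd (Prod.mk.inj h).2 (by simp)
    · exact absurd (Prod.mk.inj h).2 (by simp)
    · rw [hinj (Prod.mk.inj h).1]
  · obtain ⟨M, hM⟩ := hr' N
    filter_upwards [Filter.eventually_ge_atTop (M : ℤ)] with n hn
    obtain ⟨m, rfl⟩ := Int.eq_ofNat_of_zero_le (by omega : 0 ≤ n)
    exact hM m (by omega)
  · obtain ⟨M, hM⟩ := hr' N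
    filter_upwards [Filter.eventually_le_atBot (-M - 1 : ℤ)] with n hn
    obtain ⟨m, rfl⟩ := Int.eq_negSucc_of_lt_zero (by omega : n < 0)
    exact hM m (by omega)
  · intro e
    rw [hC e]
    constructor
    · rintro (⟨n, i, rfl⟩ | rfl)
      · cases i
        · exact ⟨n, rfl⟩
        · exact ⟨.negSucc (n + 1), Sym2.eq_swap⟩
      · exact ⟨.negSucc 0, Sym2.eq_swap⟩
    · rintro ⟨n | _ | n, rfl⟩
      · exact Or.inl ⟨n, false, rfl⟩
      · exact Or.inr Sym2.eq_swap
      · exact Or.inl ⟨n, true, Sym2.eq_swap⟩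

/-- A finite path in `T₂`, run through down one copy and up the other. -/
theorem isPsiCircuit_of_path {r : ℕ → List Bool} (hinj : Function.Injective r)
    (hadj : ∀ n i, doubleTree.Adj (r n, i) (r (n + 1), i)) {L : ℕ} (hL : L ≠ 0)
    {C : Set (Sym2 (List Bool × Bool))}
    (hC : ∀ e, e ∈ C ↔ (∃ (n : ℕ) (i : Bool), n < L ∧ e = s((r n, i), (r (n + 1), i))) ∨
      e = s((r 0, false), (r 0, true)) ∨ e = s((r L, false), (r L, true))) :
    IsPsiCircuit doubleTree (endsOf Ψ) C := by
  let c : ℕ → List Bool × Bool := fun j => if j ≤ L then (r j, false) else (r (2 * L + 1 - j), true)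
  let m : ℕ := 2 * L + 2
  let v : ℤ → List Bool × Bool := fun n => c (n % m).toNat
  have hm : (0 : ℤ) < m := by simp only [m]; omega
  have hmod : ∀ n : ℤ, ∃ j : ℕ, j < m ∧ n % m = j := fun n => by
    have h1 := Int.emod_nonneg n hm.ne'
    have h2 := Int.emod_lt_of_pos n hm
    exact ⟨(n % m).toNat, by omega, by omega⟩
  have hvj : ∀ j : ℕ, j < m → v j = c j := fun j hj => by
    simp only [v]
    rw [Int.emod_eq_of_lt (by omega) (by omega), Int.toNat_natCast]
  have hstep : ∀ (n : ℤ) (j : ℕ), j < m → n % m = j →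
      v n = c j ∧ v (n + 1) = if j + 1 = m then c 0 else c (j + 1) := by
    intro n j hj hn
    refine ⟨by simp only [v, hn, Int.toNat_natCast], ?_⟩
    have h1 : (n + 1) % m = ((j : ℤ) + 1) % m := by rw [Int.add_emod, hn]; simp
    simp only [v, h1]
    split_ifs with h
    · rw [show (j : ℤ) + 1 = m by omega, Int.emod_self]
      rfl
    · rw [Int.emod_eq_of_lt (by omega) (by omega)]
      rfl
  -- The edges of the cycle, going once around.
  have hedge : ∀ (n : ℤ) (j : ℕ), j < m → n % m = j → s(v n, v (n + 1)) =
      if j < L then s((r j, false), (r (j + 1), false))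
      else if j = L then s((r L, false), (r L, true))
      else if j < 2 * L + 1 then s((r (2 * L - j), true), (r (2 * L - j + 1), true))
      else s((r 0, false), (r 0, true)) := by
    intro n j hj hn
    obtain ⟨h1, h2⟩ := hstep n j hj hn
    rw [h1, h2]
    rcases lt_trichotomy j L with h | h | h
    · rw [if_neg (by omega), if_pos h]
      simp only [c]
      rw [if_pos (by omega), if_pos (by omega)]
    · subst h
      rw [if_neg (by omega), if_neg (lt_irrefl _), if_pos rfl]
      simp only [c]
      rw [if_pos le_rfl, if_neg (by omega), show 2 * j + 1 - (j + 1) = j by omega]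
    · rw [if_neg (show ¬ j < L by omega), if_neg h.ne']
      by_cases h' : j + 1 = m
      · rw [if_pos h', if_neg (by omega)]
        simp only [c]
        rw [if_neg (by omega), if_pos (by omega), show 2 * L + 1 - j = 0 by omega]
        exact Sym2.eq_swap
      · rw [if_neg h', if_pos (by omega)]
        simp only [c]
        rw [if_neg (by omega), if_neg (by omega), show 2 * L + 1 - (j + 1) = 2 * L - j by omega,
          show 2 * L + 1 - j = 2 * L - j + 1 by omega]
        exact Sym2.eq_swap
  have hcC : ∀ e, e ∈ C ↔ ∃ n, e = s(v n, v (n + 1)) := by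
    intro e
    rw [hC e]
    constructor
    · have hself : ∀ j : ℕ, j < m → (j : ℤ) % m = j := fun j hj =>
        Int.emod_eq_of_lt (by omega) (by omega)
      rintro (⟨n, i, hn, rfl⟩ | rfl | rfl)
      · cases i
        · refine ⟨n, ?_⟩
          rw [hedge n n (by omega) (hself n (by omega)), if_pos hn]
        · refine ⟨(2 * L - n : ℕ), ?_⟩
          rw [hedge _ (2 * L - n) (by omega) (hself _ (by omega)), if_neg (by omega),
            if_neg (by omega), if_pos (by omega), show 2 * L - (2 * L - n) = n by omega]
      · refine ⟨(2 * L + 1 : ℕ), ?_⟩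
        rw [hedge _ (2 * L + 1) (by omega) (hself _ (by omega)), if_neg (by omega),
          if_neg (by omega), if_neg (by omega)]
      · refine ⟨L, ?_⟩
        rw [hedge _ L (by omega) (hself _ (by omega)), if_neg (by omega), if_pos rfl]
    · rintro ⟨n, rfl⟩
      obtain ⟨j, hj, hn⟩ := hmod n
      rw [hedge n j hj hn]
      split_ifs with h1 h2 h3
      · exact Or.inl ⟨j, false, h1, rfl⟩
      · exact Or.inr (Or.inr rfl)
      · exact Or.inl ⟨2 * L - j, true, by omega, rfl⟩
      · exact Or.inr (Or.inl rfl)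
  have hv : ∀ n, doubleTree.Adj (v n) (v (n + 1)) := by
    intro n
    have h : s(v n, v (n + 1)) ∈ C := (hcC _).2 ⟨n, rfl⟩
    rw [← SimpleGraph.mem_edgeSet]
    rcases (hC _).1 h with ⟨j, i, -, h⟩ | h | h
    · rw [h]
      exact hadj j i
    · rw [h]
      exact doubleTree_adj.2 (Or.inr ⟨rfl, by simp⟩)
    · rw [h]
      exact doubleTree_adj.2 (Or.inr ⟨rfl, by simp⟩)
  refine isPsiCircuit_of_periodic hv (m := m) ?_ (by simp only [m]; omega) ?_ ?_ hcC
  · intro h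
    have := Int.le_of_dvd two_pos h
    omega
  · intro n
    simp only [v]
    rw [Int.add_emod_right]
  · intro a b hab
    obtain ⟨i, hi, hai⟩ := hmod a
    obtain ⟨j, hj, hbj⟩ := hmod b
    simp only [v, hai, hbj, Int.toNat_natCast, c] at hab
    refine Int.ModEq.dvd (a := b) (b := a) ?_
    rw [Int.ModEq, hai, hbj]
    split_ifs at hab with h1 h2 h2
    · rw [hinj (Prod.mk.inj hab).1]
    · exact absurd (Prod.mk.inj hab).2 (by simp)
    · exact absurd (Prod.mk.inj hab).2 (by simp)
    · have := hinj (Prod.mk.inj hab).1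
      omega

end

theorem isPsiCircuit_of_mem_circuits {Ψ : Set (ℕ → Bool)} {C : Set Edge} (hC : C ∈ circuits Ψ) :
    IsPsiCircuit doubleTree (endsOf Ψ) (edgeEmb '' C) := by
  -- A leg with a vertex as its terminal is a path, possibly prolonged by a ray.
  have hvertex : ∀ (v : List Bool) (z' : Terminal), z'.Valid Ψ → vertex v ≠ z' →
      IsPsiCircuit doubleTree (endsOf Ψ) (edgeEmb '' symmDiff (vertex v).leg z'.leg) := by
    intro v z' hz' hne
    obtain ⟨x, y, k, hx, hy, hxy, hk, hkz, hkz'⟩ := exists_along_along hne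
    have hkv : k ≤ v.length := by simpa using List.IsSuffix.length_le hkz
    obtain ⟨A, hA⟩ := Nat.exists_eq_add_of_le hkv
    have hvA : v = doubleRay x y k A := by
      rw [doubleRay_natCast, ← hA]
      exact hx
    let r : ℕ → List Bool := fun n => doubleRay x y k (A - n)
    have hr0 : r 0 = v := by simp [r, ← hvA]
    have hrinj : Function.Injective r := fun m n h => by
      have := doubleRay_injective hk h
      omega
    have hsub : ∀ n : ℕ, (A : ℤ) - (n + 1 : ℕ) + 1 = A - n := fun n => by push_cast; ring
    have hradj : ∀ n i, doubleTree.Adj (r n, i) (r (n + 1), i) := fun n i => by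
      have := doubleTree_adj_doubleRay hxy (A - (n + 1 : ℕ)) i
      rw [hsub] at this
      exact this.symm
    have hmem := fun e => mem_image_symmDiff_leg hx hy hxy hk hkz hkz' hne (e := e)
    cases z' with
    | seq y' =>
      obtain rfl : y' = y := hy
      refine isPsiCircuit_of_ray hrinj hradj hz' (fun N => ?_) fun e => (hmem e).trans ?_
      · filter_upwards [Filter.eventually_ge_atTop (A + N)] with n hn
        obtain ⟨m, rfl⟩ := Nat.exists_eq_add_of_le (show A ≤ n by omega)
        simp only [r]
        rw [show (A : ℤ) - (A + m : ℕ) = -m by push_cast; ring, doubleRay_neg_natCast hxy]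
        exact initialSegment_suffix _ (by omega)
      · refine or_congr ⟨?_, ?_⟩ ?_
        · rintro ⟨n, i, h1, -, rfl⟩
          have h1' := h1 v rfl
          refine ⟨(A - 1 - n).toNat, i, ?_⟩
          have e1 : (A : ℤ) - (A - 1 - n).toNat = n + 1 := by omega
          have e2 : (A : ℤ) - ((A - 1 - n).toNat + 1 : ℕ) = n := by omega
          simp only [r]
          rw [e1, e2]
          exact Sym2.eq_swap
        · rintro ⟨n, i, rfl⟩
          refine ⟨A - (n + 1 : ℕ), i, fun w hw h0 => ?_, fun w hw => by simp at hw, ?_⟩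
          · obtain rfl := vertex.inj hw
            omega
          · rw [hsub]
            exact Sym2.eq_swap
        · rw [hr0]
          simp
    | vertex w =>
      have hkw : k ≤ w.length := by simpa using List.IsSuffix.length_le hkz'
      obtain ⟨B, hB⟩ := Nat.exists_eq_add_of_le hkw
      have hwB : w = r (A + B) := by
        simp only [r]
        rw [show (A : ℤ) - (A + B : ℕ) = -B by push_cast; ring, doubleRay_neg_natCast hxy, ← hB]
        exact hy
      refine isPsiCircuit_of_path hrinj hradj (L := A + B) ?_ fun e => (hmem e).trans ?_
      · intro h0
        rw [h0, hr0] at hwB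
        exact hne (by rw [hwB])
      · refine or_congr ⟨?_, ?_⟩ ?_
        · rintro ⟨n, i, h1, h2, rfl⟩
          have h1' := h1 v rfl
          have h2' := h2 w rfl
          have hlt : n < A := by
            rcases lt_or_ge n 0 with h | h
            · omega
            · have := h1' h
              omega
          have hge : -(B : ℤ) ≤ n := by
            rcases lt_or_ge n 0 with h | h
            · have := h2' h
              omega
            · omega
          refine ⟨(A - 1 - n).toNat, i, by omega, ?_⟩
          have e1 : (A : ℤ) - (A - 1 - n).toNat = n + 1 := by omega
          have e2 : (A : ℤ) - ((A - 1 - n).toNat + 1 : ℕ) = n := by omega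
          simp only [r]
          rw [e1, e2]
          exact Sym2.eq_swap
        · rintro ⟨n, i, hn, rfl⟩
          refine ⟨A - (n + 1 : ℕ), i, fun u hu h0 => ?_, fun u hu h0 => ?_, ?_⟩
          · obtain rfl := vertex.inj hu
            omega
          · obtain rfl := vertex.inj hu
            omega
          · rw [hsub]
            exact Sym2.eq_swap
        · rw [hr0, ← hwB]
          simp only [vertex.injEq]
          constructor
          · rintro ⟨u, rfl | rfl, rfl⟩
            · exact Or.inl rfl
            · exact Or.inr rfl
          · rintro (rfl | rfl)
            · exact ⟨_, Or.inl rfl, rfl⟩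
            · exact ⟨_, Or.inr rfl, rfl⟩
  obtain ⟨z, z', hz, hz', hne, rfl⟩ := hC
  cases z with
  | vertex v => exact hvertex v z' hz' hne
  | seq x =>
    cases z' with
    | vertex v =>
      rw [symmDiff_comm]
      exact hvertex v (seq x) hz hne.symm
    | seq y =>
      obtain ⟨x', y', k, hx, hy, hxy, hk, hkz, hkz'⟩ := exists_along_along hne
      have hx' : x = x' := hx
      have hy' : y = y' := hy
      subst hx' hy'
      refine isPsiCircuit_of_seq_seq hxy hk hz hz' fun e =>
        (mem_image_symmDiff_leg hx hy hxy hk hkz hkz' hne).trans ?_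
      simp

/-! ### The `Ψ`-matroid of `T₂ × K₂` -/

section MapEmbedding

variable {α β : Type*} {M : Matroid α} {f : α ↪ β}

theorem mapEmbedding_indep_image_iff {I : Set α} :
    (M.mapEmbedding f).Indep (f '' I) ↔ M.Indep I := by
  simp [preimage_image_eq _ f.injective]

theorem mapEmbedding_isCircuit_image_iff {C : Set α} :
    (M.mapEmbedding f).IsCircuit (f '' C) ↔ M.IsCircuit C := by
  rw [Matroid.isCircuit_iff_dep_forall_sdiff_singleton_indep,
    Matroid.isCircuit_iff_dep_forall_sdiff_singleton_indep, Matroid.Dep, Matroid.Dep,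
    mapEmbedding_indep_image_iff, Matroid.mapEmbedding_ground_eq,
    image_subset_image_iff f.injective, forall_mem_image]
  refine and_congr_right fun _ => forall₂_congr fun e _ => ?_
  rw [← image_singleton, ← image_sdiff f.injective, mapEmbedding_indep_image_iff]

theorem mapEmbedding_isCircuit_iff {C : Set β} :
    (M.mapEmbedding f).IsCircuit C ↔ ∃ C₀, M.IsCircuit C₀ ∧ f '' C₀ = C := by
  constructor
  · intro h
    obtain ⟨C₀, -, rfl⟩ := subset_image_iff.1 (h.subset_ground : C ⊆ f '' M.E)
    exact ⟨C₀, mapEmbedding_isCircuit_image_iff.1 h, rfl⟩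
  · rintro ⟨C₀, h, rfl⟩
    exact mapEmbedding_isCircuit_image_iff.2 h

theorem mapEmbedding_isCocircuit_iff {D : Set β} :
    (M.mapEmbedding f).IsCocircuit D ↔ ∃ D₀, M.IsCocircuit D₀ ∧ f '' D₀ = D := by
  have h : (M.mapEmbedding f)✶ = M✶.mapEmbedding f := Matroid.map_dual
  rw [Matroid.isCocircuit_def, h, mapEmbedding_isCircuit_iff]

end MapEmbedding

/-- The `Ψ`-matroid of `T₂ × K₂`. -/
noncomputable def psiMatroid (Ψ : Set (ℕ → Bool)) : Matroid (Sym2 (List Bool × Bool)) :=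
  (edgeMatroid Ψ).mapEmbedding edgeEmb

theorem psiMatroid_ground (Ψ : Set (ℕ → Bool)) : (psiMatroid Ψ).E = doubleTree.edgeSet := by
  rw [← range_edgeEmb, ← image_univ]
  rfl

/-- A `Ψ`-circuit is dependent: otherwise some bounded cut would meet it in a single edge. As it
cannot properly contain another circle it is a circuit. -/
theorem isCircuit_psiMatroid_iff {Ψ : Set (ℕ → Bool)} {C : Set (Sym2 (List Bool × Bool))} :
    (psiMatroid Ψ).IsCircuit C ↔ IsPsiCircuit doubleTree (endsOf Ψ) C := by
  constructor
  · intro h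
    obtain ⟨C₀, h₀, rfl⟩ := mapEmbedding_isCircuit_iff.1 h
    exact isPsiCircuit_of_mem_circuits ((orthogonalPair Ψ).mem_of_isCircuit h₀)
  · intro h
    obtain ⟨C₀, rfl⟩ : ∃ C₀, C = edgeEmb '' C₀ := by
      have hC := h.1
      rw [← range_edgeEmb] at hC
      obtain ⟨C₀, h⟩ := subset_range_iff_exists_image_eq.1 hC
      exact ⟨C₀, h.symm⟩
    have hdep : (edgeMatroid Ψ).Dep C₀ := by
      rw [edgeMatroid, OrthogonalPair.matroid_dep_iff]
      by_contra hcon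
      push Not at hcon
      obtain ⟨_, e, he, rfl⟩ := h.nonempty
      obtain ⟨D, ⟨-, ⟨Y, rfl⟩, hbd⟩, hD⟩ := (orthogonalPair Ψ).exists_inter_eq hcon he
      refine h.inter_cut_ne_singleton (tameAt_of_bounded hbd) (edgeEmb e) ?_
      rw [← image_cut, ← image_inter edgeEmb.injective, inter_comm, hD, image_singleton]
    obtain ⟨K, hKC, hK⟩ := hdep.exists_isCircuit_subset
    have hK' := isPsiCircuit_of_mem_circuits ((orthogonalPair Ψ).mem_of_isCircuit hK)
    rw [← hK'.eq_of_subset h (image_mono hKC)]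
    exact mapEmbedding_isCircuit_image_iff.2 hK

theorem isPsiMatroid_psiMatroid (Ψ : Set (ℕ → Bool)) :
    IsPsiMatroid doubleTree (endsOf Ψ) (psiMatroid Ψ) where
  ground_eq := psiMatroid_ground Ψ
  isCircuit_iff _ := isCircuit_psiMatroid_iff
  isCocircuit_iff D := by
    have h : (fun b => b.Nonempty ∧ IsCut doubleTree b ∧ IsPsiBounded doubleTree (endsOf Ψ) b) =
        fun b => ∃ D ∈ boundedCuts Ψ, edgeEmb '' D = b := by
      ext b
      exact boundedCuts_iff
    rw [psiMatroid, mapEmbedding_isCocircuit_iff, IsPsiBond, h]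
    simp only [edgeMatroid, OrthogonalPair.isCocircuit_iff]
    constructor
    · rintro ⟨D₀, hD₀, rfl⟩
      refine ⟨⟨D₀, hD₀.1, rfl⟩, ?_⟩
      rintro _ ⟨D₁, hD₁, rfl⟩ hle
      exact image_mono (hD₀.2 hD₁ ((image_subset_image_iff edgeEmb.injective).1 hle))
    · rintro ⟨⟨D₀, hD₀, rfl⟩, hmin⟩
      refine ⟨D₀, ⟨hD₀, fun D₁ hD₁ hle => ?_⟩, rfl⟩
      exact (image_subset_image_iff edgeEmb.injective).1 (hmin ⟨D₁, hD₁, rfl⟩ (image_mono hle))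

theorem isCircuit_edgeMatroid_iff {Ψ : Set (ℕ → Bool)} {C : Set Edge} :
    (edgeMatroid Ψ).IsCircuit C ↔ C ∈ circuits Ψ :=
  ⟨(orthogonalPair Ψ).mem_of_isCircuit, fun h => mapEmbedding_isCircuit_image_iff.1
    (isCircuit_psiMatroid_iff.2 (isPsiCircuit_of_mem_circuits h))⟩

/-! ### Binary matroids -/

/-- A matroid is binary if its circuits meet its cocircuits in finite sets of even size: it is
represented by the incidences of its elements with its cocircuits. -/
theorem isBinary_of_even_inter {α : Type} {M : Matroid α}
    (h : ∀ C D, M.IsCircuit C → M.IsCocircuit D →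
      (C ∩ D).Finite ∧ ((C ∩ D).ncard : ZMod 2) = 0) : IsBinary M := by
  classical
  refine ⟨Set α, fun e D => if M.IsCocircuit D ∧ e ∈ D then 1 else 0, fun I hI => ⟨?_, ?_⟩⟩
  · intro hIndep c hc hdep
    by_contra hne
    obtain ⟨e, he⟩ := Function.ne_iff.1 hne
    obtain ⟨D, hD, hDI⟩ := hIndep.exists_isCocircuit_inter_eq_mem (hc he)
    have heD : e ∈ D := (hDI.ge rfl).1
    have hsum := (hdep D).2
    rw [finsum_eq_single _ e] at hsum
    · beta_reduce at hsum
      rw [if_pos ⟨hD, heD⟩, mul_one] at hsum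
      exact he hsum
    · intro f hf
      by_cases hfD : f ∈ D
      · have : c f = 0 := by
          by_contra hcf
          exact hf (hDI.le ⟨hfD, hc hcf⟩)
        rw [this, zero_mul]
      · beta_reduce
        rw [if_neg fun h => hfD h.2, mul_zero]
  · intro hI'
    by_contra hdep
    obtain ⟨C, hCI, hC⟩ := ((Matroid.not_indep_iff hI).1 hdep).exists_isCircuit_subset
    have h0 := hI' (C.indicator 1) ((support_indicator_subset).trans hCI) fun D => by
      have hval : ∀ e, C.indicator (1 : α → ZMod 2) e * (if M.IsCocircuit D ∧ e ∈ D then 1 else 0) =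
          (if M.IsCocircuit D then C ∩ D else ∅).indicator 1 e := by
        intro e
        by_cases hD : M.IsCocircuit D <;> by_cases h1 : e ∈ C <;> by_cases h2 : e ∈ D <;>
          simp [hD, h1, h2]
      simp only [hval]
      by_cases hD : M.IsCocircuit D
      · obtain ⟨hfin, hcard⟩ := h C D hC hD
        simp only [if_pos hD]
        refine ⟨hfin.subset fun e he => by_contra fun hn => he (indicator_of_notMem hn _), ?_⟩
        rw [← hcard, ← finsum_mem_def, finsum_mem_eq_finite_toFinset_sum _ hfin,
          ncard_eq_toFinset_card _ hfin]
        simp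
      · simp [hD]
    obtain ⟨e, he⟩ := hC.nonempty
    have := congrFun h0 e
    rw [indicator_of_mem he] at this
    exact one_ne_zero this

theorem isBinary_psiMatroid (Ψ : Set (ℕ → Bool)) : IsBinary (psiMatroid Ψ) := by
  refine isBinary_of_even_inter fun C D hC hD => ?_
  obtain ⟨C, hC', rfl⟩ := mapEmbedding_isCircuit_iff.1 hC
  obtain ⟨D, hD', rfl⟩ := mapEmbedding_isCocircuit_iff.1 hD
  obtain ⟨h1, h2⟩ := circuit_inter_boundedCut ((orthogonalPair Ψ).mem_of_isCircuit hC')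
    ((orthogonalPair Ψ).isCocircuit_iff.1 hD').1
  rw [← image_inter edgeEmb.injective, ncard_image_of_injective _ edgeEmb.injective]
  exact ⟨h1.image _, h2⟩

/-! ### Trees given by a parent function -/

/-- The graph in which every element is adjacent to its parent. The root is its own parent. -/
def parentTree {N : Type*} (par : N → N) : SimpleGraph N := SimpleGraph.fromRel fun s t => par s = t

section ParentTree

variable {N : Type*} {par : N → N} {r : N} {rank : N → ℕ}

theorem iff_of_reachable {G : SimpleGraph N} {P : N → Prop} (h : ∀ s t, G.Adj s t → (P s ↔ P t))
    {s t : N} (hst : G.Reachable s t) : P s ↔ P t := by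
  obtain ⟨w⟩ := hst
  induction w with
  | nil => rfl
  | cons hadj _ ih => exact (h _ _ hadj).trans ih

theorem parentTree_adj {s t : N} :
    (parentTree par).Adj s t ↔ s ≠ t ∧ (par s = t ∨ par t = s) :=
  SimpleGraph.fromRel_adj _ _ _

theorem parentTree_adj_par (hrank : ∀ n ≠ r, rank (par n) < rank n) {n : N} (hn : n ≠ r) :
    (parentTree par).Adj n (par n) :=
  parentTree_adj.2 ⟨fun h => (hrank n hn).ne (congrArg rank h.symm), Or.inl rfl⟩

/-- A property that every node but `s` shares with its parent is constant on the components that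
remain when the edge from `s` to its parent is removed. -/
theorem iff_of_reachable_deleteEdges (hroot : par r = r) {s : N} {Q : N → Prop}
    (hQ : ∀ m ≠ s, m ≠ r → (Q m ↔ Q (par m))) {m m' : N}
    (h : ((parentTree par).deleteEdges {s(s, par s)}).Reachable m m') : Q m ↔ Q m' := by
  refine iff_of_reachable (fun m m' h => ?_) h
  rw [SimpleGraph.deleteEdges_adj, parentTree_adj] at h
  obtain ⟨⟨hne, h⟩, hmem⟩ := h
  rcases h with rfl | rfl
  · exact hQ m (fun h => hmem (by simp [h])) fun h => hne (by rw [h, hroot])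
  · exact (hQ m' (fun h => hmem (by rw [h]; exact Sym2.eq_swap))
      fun h => hne (by rw [h, hroot])).symm

theorem deleteEdges_adj_par (hrank : ∀ n ≠ r, rank (par n) < rank n) {s m : N} (hsr : s ≠ r)
    (hmr : m ≠ r) (hms : m ≠ s) :
    ((parentTree par).deleteEdges {s(s, par s)}).Adj m (par m) := by
  rw [SimpleGraph.deleteEdges_adj]
  refine ⟨parentTree_adj_par hrank hmr, fun h => ?_⟩
  rcases Sym2.eq_iff.1 (mem_singleton_iff.1 h) with ⟨h1, -⟩ | ⟨h1, h2⟩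
  · exact hms h1
  · have h3 := hrank s hsr
    have h4 := hrank m hmr
    rw [h2] at h4
    rw [← h1] at h3
    exact lt_asymm h3 h4

theorem reachable_deleteEdges_iff (hroot : par r = r) (hrank : ∀ n ≠ r, rank (par n) < rank n)
    {s : N} (hsr : s ≠ r) {Q : N → Prop} (hs : Q s) (hr : ¬ Q r)
    (hQ : ∀ m ≠ s, m ≠ r → (Q m ↔ Q (par m))) (m : N) :
    ((parentTree par).deleteEdges {s(s, par s)}).Reachable s m ↔ Q m := by
  refine ⟨fun h => (iff_of_reachable_deleteEdges hroot hQ h).1 hs, fun hm => ?_⟩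
  induction hk : rank m using Nat.strong_induction_on generalizing m with
  | _ k ih =>
    by_cases hms : m = s
    · rw [hms]
    · have hmr : m ≠ r := fun h => hr (h ▸ hm)
      exact (ih _ (hk ▸ hrank m hmr) (par m) ((hQ m hms hmr).1 hm) rfl).trans
        (deleteEdges_adj_par hrank hsr hmr hms).symm.reachable

theorem reachable_par_deleteEdges_iff (hroot : par r = r) (hrank : ∀ n ≠ r, rank (par n) < rank n)
    {s : N} (hsr : s ≠ r) {Q : N → Prop} (hs : Q s) (hps : ¬ Q (par s))
    (hQ : ∀ m ≠ s, m ≠ r → (Q m ↔ Q (par m))) (m : N) :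
    ((parentTree par).deleteEdges {s(s, par s)}).Reachable (par s) m ↔ ¬ Q m := by
  have key : ∀ m, ¬ Q m → ((parentTree par).deleteEdges {s(s, par s)}).Reachable m r := by
    intro m hm
    induction hk : rank m using Nat.strong_induction_on generalizing m with
    | _ k ih =>
      by_cases hmr : m = r
      · rw [hmr]
      · have hms : m ≠ s := fun h => hm (h ▸ hs)
        exact (deleteEdges_adj_par hrank hsr hmr hms).reachable.trans
          (ih _ (hk ▸ hrank m hmr) (par m) (fun h => hm ((hQ m hms hmr).2 h)) rfl)
  refine ⟨fun h hm => hps ((iff_of_reachable_deleteEdges hroot hQ h).2 hm), fun hm => ?_⟩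
  exact (key _ hps).trans (key _ hm).symm

theorem isTree_parentTree (hroot : par r = r) (hrank : ∀ n ≠ r, rank (par n) < rank n) :
    (parentTree par).IsTree := by
  have hconn : ∀ m, (parentTree par).Reachable r m := by
    intro m
    induction hk : rank m using Nat.strong_induction_on generalizing m with
    | _ k ih =>
      by_cases hmr : m = r
      · rw [hmr]
      · exact (ih _ (hk ▸ hrank m hmr) (par m) rfl).trans
          (parentTree_adj_par hrank hmr).symm.reachable
  have hbridge : ∀ s ≠ r, (parentTree par).IsBridge s(s, par s) := by
    intro s hs
    rw [SimpleGraph.isBridge_iff]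
    -- The descendants of `s` are separated from the other nodes.
    have hle : ∀ k n, rank (par^[k] n) ≤ rank n := by
      intro k
      induction k with
      | zero => exact fun n => le_rfl
      | succ k ih =>
        intro n
        refine (ih (par n)).trans ?_
        by_cases hn : n = r
        · rw [hn, hroot]
        · exact (hrank n hn).le
    intro h
    obtain ⟨k, hk⟩ : ∃ k, par^[k] (par s) = s := by
      refine (iff_of_reachable_deleteEdges (Q := fun m => ∃ k, par^[k] m = s) hroot ?_ h).1 ⟨0, rfl⟩
      intro m hm _
      constructor
      · rintro ⟨_ | k, hk⟩
        · exact absurd hk hm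
        · exact ⟨k, hk⟩
      · rintro ⟨k, hk⟩
        exact ⟨k + 1, hk⟩
    have := hle k (par s)
    rw [hk] at this
    exact this.not_gt (hrank s hs)
  refine ⟨SimpleGraph.connected_iff_exists_forall_reachable _ |>.2 ⟨r, hconn⟩,
    SimpleGraph.isAcyclic_iff_forall_isBridge.2 fun e => ?_⟩
  induction e using Sym2.ind with
  | _ s t =>
    intro he
    obtain ⟨hne, h⟩ := parentTree_adj.1 ((SimpleGraph.mem_edgeSet _).1 he)
    rcases h with rfl | rfl
    · exact hbridge s fun h => hne (by rw [h, hroot])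
    · rw [Sym2.eq_swap]
      exact hbridge t fun h => hne (by rw [h, hroot])

theorem neighborSet_parentTree_subset (s : N) :
    (parentTree par).neighborSet s ⊆ insert (par s) {t | t ≠ s ∧ par t = s} := by
  intro t ht
  obtain ⟨hne, h | h⟩ := parentTree_adj.1 ht
  · exact Or.inl h.symm
  · exact Or.inr ⟨hne.symm, h⟩

end ParentTree

/-! ### Separations of small connectivity -/

theorem connectivity_le_encard {α : Type*} {M : Matroid α} {X I J F : Set α}
    (hI : M.IsBasis I (M.E ∩ X)) (hJ : M.IsBasis J (M.E \ X)) (h : M.Indep ((I ∪ J) \ F)) :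
    connectivity M X ≤ F.encard := by
  unfold connectivity
  refine iInf_le_of_le I ?_
  refine iInf_le_of_le J ?_
  refine iInf_le_of_le F ?_
  exact iInf_le_of_le hI (iInf_le_of_le hJ (iInf_le_of_le h le_rfl))

theorem connectivity_le_one {α : Type*} {M : Matroid α} {X I J F : Set α} (hX : X ⊆ M.E)
    (hI : M.IsBasis I X) (hJ : M.IsBasis J (M.E \ X)) (hF : F.encard ≤ 1)
    (h : M.Indep ((I ∪ J) \ F)) : connectivity M X ≤ 1 ∧ connectivity M (M.E \ X) ≤ 1 := by
  constructor
  · exact connectivity_le_encard (by rwa [inter_eq_right.2 hX]) hJ h |>.trans hF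
  · refine (connectivity_le_encard (F := F) (by rwa [inter_eq_right.2 sdiff_subset]) ?_
      (union_comm I J ▸ h)).trans hF
    rwa [sdiff_sdiff_cancel_left hX]

theorem connectivity_singleton_le_one {α : Type*} {M : Matroid α} {e : α} (he : e ∈ M.E) :
    connectivity M {e} ≤ 1 ∧ connectivity M (M.E \ {e}) ≤ 1 := by
  obtain ⟨I, hI⟩ := M.exists_isBasis {e} (by simpa)
  obtain ⟨J, hJ⟩ := M.exists_isBasis (M.E \ {e}) sdiff_subset
  refine connectivity_le_one (by simpa) hI hJ (F := I)
    ((encard_le_encard hI.subset).trans (encard_singleton e).le) ?_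
  rw [union_sdiff_left]
  exact hJ.indep.subset sdiff_subset

/-- If modulo a fixed set `W` every leg lies on one side of a partition, then a circuit that meets
both sides consists of the part on one side of a leg and the part on the other side of another leg.
Given bases of the two sides, there is at most one leg for either side. -/
theorem exists_encard_le_one_indep {Ψ : Set (ℕ → Bool)} {X W : Set Edge}
    (hW : ∀ z : Terminal, z.Valid Ψ → AgreeOff X z.leg W ∨ AgreeOff Xᶜ z.leg W) {I J : Set Edge}
    (hI : (edgeMatroid Ψ).Indep I) (hIX : I ⊆ X) (hJ : (edgeMatroid Ψ).Indep J) (hJX : J ⊆ Xᶜ) :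
    ∃ F : Set Edge, F.encard ≤ 1 ∧ (edgeMatroid Ψ).Indep ((I ∪ J) \ F) := by
  have hdep : ∀ {S}, ¬ (edgeMatroid Ψ).Indep S → ∃ C ∈ circuits Ψ, C ⊆ S := fun h =>
    (orthogonalPair Ψ).matroid_dep_iff.1 ((Matroid.not_indep_iff (subset_univ _)).1 h)
  have huniq : ∀ {S}, (edgeMatroid Ψ).Indep S → ∀ {z z' : Terminal}, z.Valid Ψ → z'.Valid Ψ →
      AgreeOff S z.leg z'.leg → z = z' := by
    intro S hS z z' hz hz' h
    by_contra hne
    exact hS _ ⟨z, z', hz, hz', hne, rfl⟩ (AgreeOff.iff_symmDiff_subset.1 h)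
  -- A circuit in the union of the bases consists of two legs on different sides.
  have hcross : ∀ z z' : Terminal, z.Valid Ψ → z'.Valid Ψ → z ≠ z' →
      symmDiff z.leg z'.leg ⊆ I ∪ J → ∃ y y' : Terminal, y.Valid Ψ ∧ y'.Valid Ψ ∧
        symmDiff z.leg z'.leg = symmDiff y.leg y'.leg ∧ AgreeOff I y.leg W ∧ AgreeOff J y'.leg W := by
    intro z z' hz hz' hne hC
    have hsplit : ∀ y y' : Terminal, symmDiff y.leg y'.leg ⊆ I ∪ J → AgreeOff X y.leg W →
        AgreeOff Xᶜ y'.leg W → AgreeOff I y.leg W ∧ AgreeOff J y'.leg W := by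
      intro y y' hC hy hy'
      constructor
      · intro e he
        by_cases heX : e ∈ X
        · rw [← hy' e (by simpa)]
          by_contra hn
          rcases hC (show e ∈ symmDiff y.leg y'.leg by rw [mem_symmDiff]; tauto) with h | h
          · exact he h
          · exact hJX h heX
        · exact hy e heX
      · intro e he
        by_cases heX : e ∈ X
        · exact hy' e (by simpa)
        · rw [← hy e heX]
          by_contra hn
          rcases hC (show e ∈ symmDiff y.leg y'.leg by rw [mem_symmDiff]; tauto) with h | h
          · exact heX (hIX h)
          · exact he h
    rcases hW z hz with h | h <;> rcases hW z' hz' with h' | h'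
    · refine absurd (huniq hI hz hz' fun e he => ?_) hne
      by_cases heX : e ∈ X
      · by_contra hn
        rcases hC (show e ∈ symmDiff z.leg z'.leg by rw [mem_symmDiff]; tauto) with h | h
        · exact he h
        · exact hJX h heX
      · rw [h e heX, h' e heX]
    · obtain ⟨h1, h2⟩ := hsplit z z' hC h h'
      exact ⟨z, z', hz, hz', rfl, h1, h2⟩
    · obtain ⟨h1, h2⟩ := hsplit z' z (by rwa [symmDiff_comm]) h' h
      exact ⟨z', z, hz', hz, symmDiff_comm _ _, h1, h2⟩
    · refine absurd (huniq hJ hz hz' fun e he => ?_) hne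
      by_cases heX : e ∈ X
      · rw [h e (by simpa), h' e (by simpa)]
      · by_contra hn
        rcases hC (show e ∈ symmDiff z.leg z'.leg by rw [mem_symmDiff]; tauto) with h | h
        · exact heX (hIX h)
        · exact he h
  by_cases hIJ : (edgeMatroid Ψ).Indep (I ∪ J)
  · exact ⟨∅, by simp, by simpa⟩
  obtain ⟨C, ⟨z, z', hz, hz', hne, rfl⟩, hC⟩ := hdep hIJ
  obtain ⟨e, he⟩ := symmDiff_leg_nonempty hne
  refine ⟨{e}, by simp, ?_⟩
  by_contra hIJ'
  obtain ⟨C', ⟨y, y', hy, hy', hne', rfl⟩, hC'⟩ := hdep hIJ'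
  obtain ⟨z₁, z₂, hz₁, hz₂, hzeq, h1, h2⟩ := hcross z z' hz hz' hne hC
  obtain ⟨y₁, y₂, hy₁, hy₂, hyeq, h3, h4⟩ := hcross y y' hy hy' hne' (hC'.trans sdiff_subset)
  obtain rfl := huniq hI hz₁ hy₁ (h1.trans h3.symm)
  obtain rfl := huniq hJ hz₂ hy₂ (h2.trans h4.symm)
  rw [hzeq, ← hyeq] at he
  exact (hC' he).2 rfl

theorem connectivity_image_le_one {Ψ : Set (ℕ → Bool)} {X W : Set Edge}
    (hW : ∀ z : Terminal, z.Valid Ψ → AgreeOff X z.leg W ∨ AgreeOff Xᶜ z.leg W) :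
    connectivity (psiMatroid Ψ) (edgeEmb '' X) ≤ 1 ∧
      connectivity (psiMatroid Ψ) ((psiMatroid Ψ).E \ edgeEmb '' X) ≤ 1 := by
  obtain ⟨I, hI⟩ := (edgeMatroid Ψ).exists_isBasis X (subset_univ _)
  obtain ⟨J, hJ⟩ := (edgeMatroid Ψ).exists_isBasis Xᶜ (subset_univ _)
  obtain ⟨F, hF, h⟩ := exists_encard_le_one_indep hW hI.indep hI.subset hJ.indep hJ.subset
  have hE : (psiMatroid Ψ).E = edgeEmb '' univ := rfl
  refine connectivity_le_one (by rw [hE]; exact image_mono (subset_univ _)) (hI.mapEmbedding edgeEmb)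
    (J := edgeEmb '' J) ?_ (F := edgeEmb '' F) ?_ ?_
  · rw [hE, ← image_sdiff edgeEmb.injective, ← compl_eq_univ_sdiff]
    exact hJ.mapEmbedding edgeEmb
  · rwa [edgeEmb.injective.encard_image]
  · rw [← image_union, ← image_sdiff edgeEmb.injective]
    exact h.mapEmbedding edgeEmb

/-- The criterion of `exists_encard_le_one_indep` holds for the edge sets `X` displayed by the
branch-decomposition: the part of `T₂ × K₂` strictly above `v`, with some of the edges that lead down
from `v` and the rung at `v`. The legs that pass through `v` agree with `stem v` outside `X`, and the
others do not meet `X`. -/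
theorem agreeOff_or_agreeOff_compl {X : Set Edge} {v : List Bool} (h₁ : X ⊆ above v)
    (h₂ : above v ⊆ X ∪ stem v ∪ {Edge.rung v}) (h₃ : Edge.rung v ∈ X ∨ Disjoint X (stem v))
    (z : Terminal) : AgreeOff X z.leg (stem v \ X) ∨ AgreeOff Xᶜ z.leg (stem v \ X) := by
  by_cases hv : v ∈ z.path
  · have hsub : ∀ e ∈ z.leg, e ∈ stem v ∨ e ∈ above v := by
      rintro (⟨p, b, i⟩ | w) he
      · exact suffix_or_suffix (z := z) he hv
      · rw [rung_mem_leg] at he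
        subst he
        exact Or.inr hv
    have hstem : stem v ⊆ z.leg := by
      rintro (⟨p, b, i⟩ | w) he
      · exact mem_path_of_suffix hv he
      · exact absurd he rung_notMem_stem
    by_cases hz : z = vertex v ∧ Edge.rung v ∉ X
    · obtain ⟨rfl, hX⟩ := hz
      have hdis := h₃.resolve_left hX
      right
      intro e he
      rw [notMem_compl_iff] at he
      refine ⟨fun h => ?_, fun h => hstem h.1⟩
      exfalso
      rcases e with ⟨p, b, i⟩ | w
      · exact disjoint_left.1 hdis he h
      · rw [rung_mem_leg, vertex.injEq] at h
        exact hX (h ▸ he)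
    · left
      intro e he
      refine ⟨fun h => ⟨?_, he⟩, fun h => hstem h.1⟩
      rcases hsub e h with h' | h'
      · exact h'
      · rcases h₂ h' with (h'' | h'') | h''
        · exact absurd h'' he
        · exact h''
        · obtain rfl := mem_singleton_iff.1 h''
          exact absurd ⟨rung_mem_leg.1 h, he⟩ hz
  · right
    intro e he
    rw [notMem_compl_iff] at he
    refine ⟨fun h => ?_, fun h => absurd he h.2⟩
    refine absurd ?_ hv
    have := h₁ he
    rcases e with ⟨p, b, i⟩ | w
    · exact mem_path_of_suffix (z := z) h this
    · rw [rung_mem_leg] at h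
      rw [h]
      exact this

/-! ### The branch-decomposition -/

instance : Nonempty Edge := ⟨.rung []⟩

/-- The nodes of the branch-decomposition of `T₂ × K₂`: a path of four nodes for every vertex `v`
of `T₂`, from which the two edges that lead down from `v` and the rung at `v` branch off before it
forks towards the paths of the two upper neighbours of `v`; and a leaf for every edge. -/
inductive DecompNode : Type
  | inner (v : List Bool) (j : Fin 4) : DecompNode
  | leaf (e : Edge) : DecompNode

namespace DecompNode

/-- The vertex of `T₂` to whose path the leaf `e` is attached. -/
def edgeVertex : Edge → List Bool
  | .side p b _ => b :: p
  | .rung v => v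

/-- The position on that path. -/
def edgeLevel : Edge → Fin 4
  | .side _ _ false => 0
  | .side _ _ true => 1
  | .rung _ => 2

/-- The root of the tree. -/
def root : DecompNode := inner [] 0

/-- The neighbour of a node on the way to the root. -/
def parent : DecompNode → DecompNode
  | inner [] 0 => root
  | inner (_ :: s) 0 => inner s 3
  | inner v 1 => inner v 0
  | inner v 2 => inner v 1
  | inner v 3 => inner v 2
  | leaf e => inner (edgeVertex e) (edgeLevel e)

/-- A measure for the distance of a node from the root. -/
def rank : DecompNode → ℕ
  | inner v j => 4 * v.length + j
  | leaf e => 4 * (edgeVertex e).length + 4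

theorem parent_one (v : List Bool) : (inner v 1).parent = inner v 0 := by cases v <;> rfl

theorem parent_two (v : List Bool) : (inner v 2).parent = inner v 1 := by cases v <;> rfl

theorem parent_three (v : List Bool) : (inner v 3).parent = inner v 2 := by cases v <;> rfl

theorem parent_root : root.parent = root := rfl

theorem rank_parent_lt : ∀ n ≠ root, rank n.parent < rank n := by
  rintro (⟨v, j⟩ | e) h
  · fin_cases j
    · cases v with
      | nil => exact absurd rfl h
      | cons b s => simp [parent, rank]; omega
    all_goals simp [parent, rank]
  · have := (edgeLevel e).2
    simp only [parent, rank]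
    omega

/-- The set of nodes on or above the `j`-th node of the path of `v`. -/
def Descends (v : List Bool) (j : Fin 4) : DecompNode → Prop
  | inner w i => v <:+ w ∧ (w = v → j ≤ i)
  | leaf e => v <:+ edgeVertex e ∧ (edgeVertex e = v → j ≤ edgeLevel e)

/-- Every edge of the tree other than the one below the `j`-th node of the path of `v` joins two
descendants of that node or two other nodes. -/
theorem descends_iff_parent {v : List Bool} {j : Fin 4} {m : DecompNode} (hm : m ≠ inner v j)
    (hr : m ≠ root) : m.Descends v j ↔ m.parent.Descends v j := by
  have key : ∀ (w : List Bool) (i i' : Fin 4), inner w i ≠ inner v j → (i : ℕ) = i' + 1 →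
      ((v <:+ w ∧ (w = v → j ≤ i)) ↔ (v <:+ w ∧ (w = v → j ≤ i'))) := by
    intro w i i' hne hi
    refine and_congr_right fun _ => imp_congr_right fun hw => ?_
    have : j ≠ i := fun h => hne (by rw [hw, h])
    rw [Fin.le_def, Fin.le_def]
    have : (j : ℕ) ≠ i := fun h => this (Fin.ext h)
    omega
  rcases m with ⟨w, i⟩ | e
  · fin_cases i
    · cases w with
      | nil => exact absurd rfl hr
      | cons b s =>
        simp only [Descends, parent]
        constructor
        · rintro ⟨h1, h2⟩
          rcases List.suffix_cons_iff.1 h1 with rfl | h1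
          · refine absurd ?_ hm
            have := h2 rfl
            congr 1
            exact (Fin.le_zero_iff.1 this).symm
          · exact ⟨h1, fun _ => Fin.le_last j⟩
        · rintro ⟨h1, -⟩
          refine ⟨h1.trans (List.suffix_cons _ _), ?_⟩
          rintro rfl
          simpa using h1.length_le
    · change Descends v j (inner w 1) ↔ Descends v j (inner w 1).parent
      rw [parent_one]
      exact key w 1 0 hm rfl
    · change Descends v j (inner w 2) ↔ Descends v j (inner w 2).parent
      rw [parent_two]
      exact key w 2 1 hm rfl
    · change Descends v j (inner w 3) ↔ Descends v j (inner w 3).parent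
      rw [parent_three]
      exact key w 3 2 hm rfl
  · rfl

theorem exists_children (t : DecompNode) : ∃ a b, ∀ m, m ≠ t → m.parent = t → m = a ∨ m = b := by
  rcases t with ⟨v, j⟩ | e
  · fin_cases j
    · cases v with
      | nil =>
        refine ⟨inner [] 1, inner [] 1, ?_⟩
        rintro (⟨w, i⟩ | ⟨⟨p, b, i⟩ | w⟩) hm h
        · fin_cases i
          · cases w with
            | nil => exact absurd rfl hm
            | cons => simp [parent] at h
          all_goals simp_all [parent]
        all_goals simp_all [parent, edgeVertex, edgeLevel]
      | cons c s =>
        refine ⟨inner (c :: s) 1, leaf (.side s c false), ?_⟩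
        rintro (⟨w, i⟩ | ⟨⟨p, b, i⟩ | w⟩) hm h
        · fin_cases i
          · cases w with
            | nil => simp [parent, root] at h
            | cons => simp [parent] at h
          all_goals simp_all [parent]
        · cases i <;> simp_all [parent, edgeVertex, edgeLevel]
        · simp_all [parent, edgeVertex, edgeLevel]
    · cases v with
      | nil =>
        refine ⟨inner [] 2, inner [] 2, ?_⟩
        rintro (⟨w, i⟩ | ⟨⟨p, b, i⟩ | w⟩) hm h
        · fin_cases i
          · cases w with
            | nil => simp [parent, root] at h
            | cons => simp [parent] at h
          all_goals simp_all [parent]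
        all_goals simp_all [parent, edgeVertex, edgeLevel]
      | cons c s =>
        refine ⟨inner (c :: s) 2, leaf (.side s c true), ?_⟩
        rintro (⟨w, i⟩ | ⟨⟨p, b, i⟩ | w⟩) hm h
        · fin_cases i
          · cases w with
            | nil => simp [parent, root] at h
            | cons => simp [parent] at h
          all_goals simp_all [parent]
        · cases i <;> simp_all [parent, edgeVertex, edgeLevel]
        · simp_all [parent, edgeVertex, edgeLevel]
    · refine ⟨inner v 3, leaf (.rung v), ?_⟩
      rintro (⟨w, i⟩ | ⟨⟨p, b, i⟩ | w⟩) hm h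
      · fin_cases i
        · cases w with
          | nil => simp [parent, root] at h
          | cons => simp [parent] at h
        all_goals simp_all [parent]
      · cases i <;> simp [parent, edgeVertex, edgeLevel] at h
      · simp_all [parent, edgeVertex, edgeLevel]
    · refine ⟨inner (true :: v) 0, inner (false :: v) 0, ?_⟩
      rintro (⟨w, i⟩ | ⟨⟨p, b, i⟩ | w⟩) hm h
      · fin_cases i
        · cases w with
          | nil => simp [parent, root] at h
          | cons b s => cases b <;> simp_all [parent]
        all_goals simp [parent] at h
      · cases i <;> simp [parent, edgeVertex, edgeLevel] at h
      · simp [parent, edgeVertex, edgeLevel] at h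
  · refine ⟨root, root, ?_⟩
    rintro (⟨w, i⟩ | e) hm h
    · fin_cases i
      · cases w <;> simp [parent, root] at h
      all_goals simp [parent] at h
    · simp [parent] at h

theorem parent_ne_leaf (m : DecompNode) (e : Edge) : m.parent ≠ leaf e := by
  rcases m with ⟨w, i⟩ | e
  · fin_cases i
    · cases w <;> simp [parent, root]
    all_goals simp [parent]
  · simp [parent]

end DecompNode

open DecompNode

theorem connectivity_descends_le_one (Ψ : Set (ℕ → Bool)) (v : List Bool) (j : Fin 4) :
    connectivity (psiMatroid Ψ) (edgeEmb '' {e | (leaf e).Descends v j}) ≤ 1 ∧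
      connectivity (psiMatroid Ψ) ((psiMatroid Ψ).E \ edgeEmb '' {e | (leaf e).Descends v j}) ≤ 1 := by
  refine connectivity_image_le_one fun z _ => agreeOff_or_agreeOff_compl (v := v) ?_ ?_ ?_ z
  · rintro (⟨p, b, i⟩ | w) ⟨h, -⟩ <;> exact h
  · rintro (⟨p, b, i⟩ | w) h
    · by_cases hv : b :: p = v
      · exact Or.inl (Or.inr (by rw [side_mem_stem, hv]))
      · exact Or.inl (Or.inl ⟨h, fun h' => absurd h' hv⟩)
    · by_cases hv : w = v
      · exact Or.inr (by rw [hv]; rfl)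
      · exact Or.inl (Or.inl ⟨h, fun h' => absurd h' hv⟩)
  · by_cases hj : j ≤ 2
    · exact Or.inl ⟨List.suffix_rfl, fun _ => hj⟩
    · right
      rw [disjoint_left]
      rintro (⟨p, b, i⟩ | w) ⟨h1, h2⟩ h3
      · have h4 : b :: p = v := List.IsSuffix.eq_of_length_le h3 (List.IsSuffix.length_le h1)
        refine hj ((h2 h4).trans ?_)
        cases i <;> simp [edgeLevel]
      · exact absurd h3 rung_notMem_stem

/-- The branch-decomposition of the `Ψ`-matroid of `T₂ × K₂`. -/
noncomputable def branchDecomposition (Ψ : Set (ℕ → Bool)) :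
    BranchDecomposition (psiMatroid Ψ) where
  Node := DecompNode
  tree := parentTree parent
  isTree := isTree_parentTree parent_root rank_parent_lt
  degree_le t := by
    obtain ⟨a, b, h⟩ := exists_children t
    refine (encard_le_encard (t := {parent t, a, b}) fun m hm => ?_).trans ?_
    · rcases neighborSet_parentTree_subset t hm with rfl | ⟨h1, h2⟩
      · exact Or.inl rfl
      · exact Or.inr (h m h1 h2)
    · refine (encard_insert_le _ _).trans ?_
      refine (add_le_add_left (encard_insert_le _ _) 1).trans ?_
      rw [encard_singleton]
      norm_num
  leaf e := leaf (Function.invFun edgeEmb e)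
  leaf_injective := by
    rintro ⟨_, e, _, rfl⟩ ⟨_, f, _, rfl⟩ h
    have h' := leaf.inj h
    rw [Function.leftInverse_invFun edgeEmb.injective e,
      Function.leftInverse_invFun edgeEmb.injective f] at h'
    exact Subtype.ext (congrArg edgeEmb h')
  degree_leaf_le e := by
    refine (encard_le_encard (t := {parent (leaf (Function.invFun edgeEmb e))}) fun m hm => ?_).trans
      (encard_singleton _).le
    rcases neighborSet_parentTree_subset _ hm with rfl | ⟨-, h2⟩
    · rfl
    · exact absurd h2 (parent_ne_leaf _ _)

theorem side_branchDecomposition {Ψ : Set (ℕ → Bool)} {s t : DecompNode} {Q : DecompNode → Prop}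
    (h : ∀ m, ((parentTree parent).deleteEdges {s(s, t)}).Reachable s m ↔ Q m) :
    (branchDecomposition Ψ).side s t = edgeEmb '' {e | Q (leaf e)} := by
  have hleaf : ∀ (e : Edge) (he : edgeEmb e ∈ (psiMatroid Ψ).E),
      (branchDecomposition Ψ).leaf ⟨edgeEmb e, he⟩ = leaf e := fun e _ =>
    congrArg leaf (Function.leftInverse_invFun edgeEmb.injective e)
  ext e
  constructor
  · rintro ⟨hE, he⟩
    obtain ⟨e, _, rfl⟩ : e ∈ edgeEmb '' univ := hE
    refine ⟨e, (h (leaf e)).1 ?_, rfl⟩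
    rw [← hleaf e ⟨e, mem_univ e, rfl⟩]
    exact he
  · rintro ⟨e, he, rfl⟩
    have hE : edgeEmb e ∈ (psiMatroid Ψ).E := ⟨e, mem_univ e, rfl⟩
    have he' : Q ((branchDecomposition Ψ).leaf ⟨edgeEmb e, hE⟩) := by
      rw [hleaf]
      exact he
    exact ⟨hE, (h _).2 he'⟩

theorem branchWidth_psiMatroid_le (Ψ : Set (ℕ → Bool)) : branchWidth (psiMatroid Ψ) ≤ 2 := by
  have hE : (psiMatroid Ψ).E = edgeEmb '' univ := rfl
  have key : ∀ n ≠ root,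
      connectivity (psiMatroid Ψ) ((branchDecomposition Ψ).side n n.parent) ≤ 1 ∧
      connectivity (psiMatroid Ψ) ((branchDecomposition Ψ).side n.parent n) ≤ 1 := by
    intro n hn
    obtain ⟨Q, h1, h2, h3, h4, h5⟩ : ∃ Q : DecompNode → Prop, Q n ∧ ¬ Q n.parent ∧ ¬ Q root ∧
        (∀ m ≠ n, m ≠ root → (Q m ↔ Q m.parent)) ∧
        (connectivity (psiMatroid Ψ) (edgeEmb '' {e | Q (leaf e)}) ≤ 1 ∧
        connectivity (psiMatroid Ψ) ((psiMatroid Ψ).E \ edgeEmb '' {e | Q (leaf e)}) ≤ 1) := by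
      rcases n with ⟨v, j⟩ | e
      · refine ⟨Descends v j, ⟨List.suffix_rfl, fun _ => le_rfl⟩, ?_, ?_,
          fun m hm hr => descends_iff_parent hm hr, connectivity_descends_le_one Ψ v j⟩
        · fin_cases j
          · cases v with
            | nil => exact absurd rfl hn
            | cons b s =>
              rintro ⟨h, -⟩
              simpa using h.length_le
          · change ¬ Descends v 1 (inner v 1).parent
            rw [parent_one]
            exact fun h => absurd (h.2 rfl) (by decide)
          · change ¬ Descends v 2 (inner v 2).parent
            rw [parent_two]
            exact fun h => absurd (h.2 rfl) (by decide)
          · change ¬ Descends v 3 (inner v 3).parent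
            rw [parent_three]
            exact fun h => absurd (h.2 rfl) (by decide)
        · rintro ⟨h, h'⟩
          obtain rfl := List.suffix_nil.1 h
          exact hn (by rw [Fin.le_zero_iff.1 (h' rfl)]; rfl)
      · refine ⟨fun m => m = leaf e, rfl, parent_ne_leaf _ _, by simp [root], fun m hm _ => ?_, ?_⟩
        · simp [hm, parent_ne_leaf]
        · have : edgeEmb '' {e' | leaf e' = leaf e} = {edgeEmb e} := by simp
          rw [this]
          exact connectivity_singleton_le_one ⟨e, trivial, rfl⟩
    have hs := side_branchDecomposition (Ψ := Ψ)
      (reachable_deleteEdges_iff parent_root rank_parent_lt hn h1 h3 h4)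
    have hs' := side_branchDecomposition (Ψ := Ψ) (s := n.parent) (t := n) (Q := fun m => ¬ Q m) (by
      rw [Sym2.eq_swap]
      exact reachable_par_deleteEdges_iff parent_root rank_parent_lt hn h1 h2 h4)
    have hcompl : edgeEmb '' {e | ¬ Q (leaf e)} =
        (psiMatroid Ψ).E \ edgeEmb '' {e | Q (leaf e)} := by
      rw [hE, ← image_sdiff edgeEmb.injective, ← compl_eq_univ_sdiff]
      rfl
    rw [hs, hs', hcompl]
    exact h5
  refine (iInf_le _ (branchDecomposition Ψ)).trans ?_
  refine iSup_le fun s => iSup_le fun t => iSup_le fun hst => ?_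
  have h : connectivity (psiMatroid Ψ) ((branchDecomposition Ψ).side s t) ≤ 1 := by
    obtain ⟨hne, h⟩ := parentTree_adj.1 hst
    rcases h with rfl | rfl
    · exact (key s fun h => hne (by rw [h, parent_root])).1
    · exact (key t fun h => hne (by rw [h, parent_root])).2
  exact (add_le_add_left h 1).trans (by norm_num)

/-! ### Accumulation of circuits at ends -/

theorem eq_or_exists_cons_suffix {p w : List Bool} (h : p <:+ w) : w = p ∨ ∃ b, b :: p <:+ w := by
  obtain ⟨t, rfl⟩ := h
  rcases List.eq_nil_or_concat t with rfl | ⟨t, b, rfl⟩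
  · exact Or.inl rfl
  · exact Or.inr ⟨b, t, by simp⟩

theorem above_diff_finite (p : List Bool) :
    (above p \ (above (true :: p) ∪ above (false :: p))).Finite := by
  have key : ∀ w, p <:+ w → ¬ (true :: p <:+ w ∨ false :: p <:+ w) → w = p := by
    intro w h1 h2
    rcases eq_or_exists_cons_suffix h1 with h | ⟨b, h⟩
    · exact h
    · cases b
      · exact absurd (Or.inr h) h2
      · exact absurd (Or.inl h) h2
  refine ((finite_singleton (Edge.rung p)).union
    ((finite_range fun i => Edge.side p.tail (p.headD true) i))).subset ?_
  rintro (⟨q, b, i⟩ | v) ⟨h1, h2⟩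
  · right
    rw [← key (b :: q) h1 h2]
    exact ⟨i, rfl⟩
  · left
    rw [key v h1 h2]
    rfl

/-- Every infinite set of edges accumulates at some end. -/
theorem exists_accumulation {S : Set Edge} (hS : S.Infinite) :
    ∃ y, ∀ n, (S ∩ above (initialSegment y n)).Infinite := by
  have hstep : ∀ p, (S ∩ above p).Infinite → ∃ b, (S ∩ above (b :: p)).Infinite := by
    intro p hp
    by_contra hcon
    push Not at hcon
    refine hp ((((hcon true).union (hcon false)).union (above_diff_finite p)).subset ?_)
    rintro e ⟨heS, he⟩
    by_cases h : e ∈ above (true :: p) ∪ above (false :: p)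
    · exact Or.inl (h.imp (fun h => ⟨heS, h⟩) fun h => ⟨heS, h⟩)
    · exact Or.inr ⟨he, h⟩
  choose! b hb using hstep
  let g : ℕ → List Bool := Nat.rec [] fun _ p => b p :: p
  have hg : ∀ n, initialSegment (fun n => b (g n)) n = g n := by
    intro n
    induction n with
    | zero => rfl
    | succ n ih => rw [initialSegment, ih]
  refine ⟨fun n => b (g n), fun n => ?_⟩
  rw [hg]
  induction n with
  | zero =>
    have : S ∩ above [] = S := inter_eq_left.2 fun e _ => by
      rcases e with ⟨q, c, i⟩ | v <;> exact List.nil_suffix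
    exact this.symm ▸ hS
  | succ n ih => exact hb _ ih

theorem exists_disjoint_leg_above {z : Terminal} {y : ℕ → Bool} (h : z ≠ seq y) :
    ∃ N, ∀ n ≥ N, Disjoint z.leg (above (initialSegment y n)) := by
  suffices ∃ N, initialSegment y N ∉ z.path by
    obtain ⟨N, hN⟩ := this
    refine ⟨N, fun n hn => disjoint_left.2 fun e he he' => hN ?_⟩
    refine mem_path_of_suffix ?_ (initialSegment_suffix y hn)
    rcases e with ⟨q, b, i⟩ | v
    · exact mem_path_of_suffix (z := z) he he'
    · rw [rung_mem_leg] at he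
      rw [he]
      exact he'
  cases z with
  | vertex v => exact ⟨v.length + 1, fun h => by simpa using List.IsSuffix.length_le h⟩
  | seq x =>
    obtain ⟨n, hn⟩ := exists_not_suffix_of_ne fun hxy : y = x => h (by rw [hxy])
    refine ⟨n, fun h => hn _ List.suffix_rfl ?_⟩
    rw [mem_path_seq, length_initialSegment] at h
    rw [h]

/-- A circuit that accumulates at the end of `y` agrees with the leg of `y` near that end. -/
theorem exists_inter_above_eq {Ψ : Set (ℕ → Bool)} {K : Set Edge} (hK : K ∈ circuits Ψ)
    {y : ℕ → Bool} (hy : ∀ n, (K ∩ above (initialSegment y n)).Nonempty) :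
    y ∈ Ψ ∧ ∃ N, ∀ n ≥ N, K ∩ above (initialSegment y n) =
      (seq y).leg ∩ above (initialSegment y n) := by
  have key : ∀ {z : Terminal}, z ≠ seq y → ∃ N, ∀ n ≥ N, symmDiff (seq y).leg z.leg ∩
      above (initialSegment y n) = (seq y).leg ∩ above (initialSegment y n) := by
    intro z hz
    obtain ⟨N, hN⟩ := exists_disjoint_leg_above hz
    refine ⟨N, fun n hn => ?_⟩
    ext e
    simp only [mem_inter_iff, mem_symmDiff]
    have : e ∈ above (initialSegment y n) → e ∉ z.leg := fun h => disjoint_right.1 (hN n hn) h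
    tauto
  obtain ⟨z, z', hz, hz', hne, rfl⟩ := hK
  by_cases h : z = seq y
  · subst h
    exact ⟨hz, key hne.symm⟩
  by_cases h' : z' = seq y
  · subst h'
    rw [symmDiff_comm]
    exact ⟨hz', key h⟩
  obtain ⟨N, hN⟩ := exists_disjoint_leg_above h
  obtain ⟨N', hN'⟩ := exists_disjoint_leg_above h'
  obtain ⟨e, he, he'⟩ := hy (max N N')
  rcases he with he | he
  · exact absurd he' (disjoint_left.1 (hN _ (le_max_left _ _)) he.1)
  · exact absurd he' (disjoint_left.1 (hN' _ (le_max_right _ _)) he.1)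

/-! ### Minors -/

/-- The rung at the root with both copies of the ray towards `x`. If `x ∈ Ψ` then this is a circuit of
the `Ψ`-matroid. -/
def rootCircuit (x : ℕ → Bool) : Set Edge := symmDiff (seq x).leg (vertex []).leg

theorem rootCircuit_mem_circuits {Ψ : Set (ℕ → Bool)} {x : ℕ → Bool} (hx : x ∈ Ψ) :
    rootCircuit x ∈ circuits Ψ := ⟨seq x, vertex [], hx, trivial, by simp, rfl⟩

theorem side_mem_rootCircuit {x : ℕ → Bool} {p : List Bool} {b i : Bool} :
    Edge.side p b i ∈ rootCircuit x ↔ b :: p ∈ (seq x).path := by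
  simp [rootCircuit, mem_symmDiff]

theorem rung_mem_rootCircuit {x : ℕ → Bool} {v : List Bool} :
    Edge.rung v ∈ rootCircuit x ↔ v = [] := by
  simp [rootCircuit, mem_symmDiff, eq_comm]

theorem infinite_rootCircuit (x : ℕ → Bool) : (rootCircuit x).Infinite := by
  refine infinite_of_injective_forall_mem (f := fun n => Edge.side (initialSegment x n) (x n) true)
    (fun m n h => ?_) fun n => ?_
  · have := congrArg List.length (Edge.side.inj h).1
    simpa using this
  · exact side_mem_rootCircuit.2 (initialSegment_mem_path x (n + 1))

theorem finite_rootCircuit_inter {x x' : ℕ → Bool} (h : x ≠ x') :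
    (rootCircuit x ∩ rootCircuit x').Finite := by
  obtain ⟨u, hu⟩ := exists_meet fun h' : seq x = seq x' => h (seq.inj h')
  refine ((finite_singleton (Edge.rung [])).union (finite_range
    fun k : Fin u.length × Bool => Edge.side (initialSegment x k.1) (x k.1) k.2)).subset ?_
  rintro (⟨p, b, i⟩ | v) ⟨h1, h2⟩
  · right
    rw [side_mem_rootCircuit] at h1 h2
    have hle := ((hu _).1 ⟨h1, h2⟩).length_le
    rw [List.length_cons] at hle
    rw [mem_path_seq, List.length_cons] at h1
    obtain ⟨h3, h4⟩ := List.cons.inj h1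
    exact ⟨(⟨p.length, hle⟩, i), by simp [← h3, ← h4]⟩
  · left
    rw [rung_mem_rootCircuit.1 h1]
    rfl

/-- If the `Ψ`-matroid is a minor of the `Ψ'`-matroid, then the map `ψ` of the edges sends every
circuit to the trace of a circuit. -/
theorem MinorOf.exists_injective {Ψ Ψ' : Set (ℕ → Bool)}
    (h : MinorOf (psiMatroid Ψ) (psiMatroid Ψ')) : ∃ ψ : Edge → Edge, Function.Injective ψ ∧
      ∀ K ∈ circuits Ψ, ∃ K' ∈ circuits Ψ', K' ∩ range ψ = ψ '' K := by
  obtain ⟨N', ⟨C, D, rfl⟩, φ, hφ⟩ := h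
  have hmem : ∀ e : Edge, edgeEmb e ∈ (psiMatroid Ψ).E := fun e => ⟨e, mem_univ e, rfl⟩
  have hex : ∀ e : Edge, ∃ e' : Edge, edgeEmb e' = φ ⟨edgeEmb e, hmem e⟩ := by
    intro e
    obtain ⟨⟨⟨e', _, he'⟩, _⟩, _⟩ := (φ ⟨edgeEmb e, hmem e⟩).2
    exact ⟨e', he'⟩
  choose ψ hψ using hex
  have hinj : Function.Injective ψ := by
    intro e f hef
    have h1 := hψ e
    rw [hef, hψ f] at h1
    exact edgeEmb.injective (Subtype.mk.inj (φ.injective (Subtype.ext h1))).symm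
  have hindep : ∀ I : Set Edge, (psiMatroid Ψ).Indep (edgeEmb '' I) ↔
      (((psiMatroid Ψ').contract C).delete D).Indep (edgeEmb '' (ψ '' I)) := by
    intro I
    have h1 := hφ ((fun e => ⟨edgeEmb e, hmem e⟩) '' I)
    simp only [image_image, ← hψ] at h1
    rw [h1, image_image]
  refine ⟨ψ, hinj, fun K hK => ?_⟩
  have hK' : (psiMatroid Ψ).IsCircuit (edgeEmb '' K) :=
    mapEmbedding_isCircuit_image_iff.2 (isCircuit_edgeMatroid_iff.2 hK)
  have hsub : ∀ S : Set Edge, edgeEmb '' (ψ '' S) ⊆ (((psiMatroid Ψ').contract C).delete D).E := by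
    rintro S _ ⟨_, ⟨e, -, rfl⟩, rfl⟩
    rw [hψ e]
    exact (φ _).2
  have hcirc : (((psiMatroid Ψ').contract C).delete D).IsCircuit (edgeEmb '' (ψ '' K)) := by
    rw [Matroid.isCircuit_iff_dep_forall_sdiff_singleton_indep] at hK' ⊢
    refine ⟨(Matroid.not_indep_iff (hsub K)).1 fun h => hK'.1.not_indep ((hindep K).2 h), ?_⟩
    rintro _ ⟨_, ⟨e, he, rfl⟩, rfl⟩
    have h2 := hK'.2 _ (mem_image_of_mem _ he)
    rw [← image_singleton, ← image_sdiff edgeEmb.injective, hindep, image_sdiff hinj,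
      image_sdiff edgeEmb.injective, image_singleton, image_singleton] at h2
    exact h2
  obtain ⟨hcirc', hdis⟩ := Matroid.delete_isCircuit_iff.1 hcirc
  obtain ⟨K₁, hK₁, hle, hle'⟩ := hcirc'.exists_subset_isCircuit_of_contract
  obtain ⟨K', hK'c, rfl⟩ := mapEmbedding_isCircuit_iff.1 hK₁
  refine ⟨K', isCircuit_edgeMatroid_iff.1 hK'c, subset_antisymm ?_ ?_⟩
  · rintro _ ⟨he, e, rfl⟩
    rcases hle' (mem_image_of_mem _ he) with h | h
    · exact (edgeEmb.injective.mem_set_image).1 h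
    · have h1 := hsub univ ⟨_, ⟨e, trivial, rfl⟩, rfl⟩
      rw [Matroid.delete_ground, Matroid.contract_ground] at h1
      exact absurd h h1.1.2
  · intro e he
    exact ⟨(edgeEmb.injective.mem_set_image).1 (hle (mem_image_of_mem _ he)),
      image_subset_range _ _ he⟩

open Classical in
/-- An end at which the image of `rootCircuit x` under an injective map `ψ` accumulates. -/
noncomputable def accumulationEnd (ψ : Edge → Edge) (x : ℕ → Bool) : ℕ → Bool :=
  if h : ∃ y, ∀ n, (ψ '' rootCircuit x ∩ above (initialSegment y n)).Infinite then h.choose else x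

theorem accumulationEnd_spec {ψ : Edge → Edge} (hψ : Function.Injective ψ) (x : ℕ → Bool) (n : ℕ) :
    (ψ '' rootCircuit x ∩ above (initialSegment (accumulationEnd ψ x) n)).Infinite := by
  have h : ∃ y, ∀ n, (ψ '' rootCircuit x ∩ above (initialSegment y n)).Infinite :=
    exists_accumulation ((infinite_rootCircuit x).image hψ.injOn)
  rw [accumulationEnd, dif_pos h]
  exact h.choose_spec n

/-- The sequences `x` for which `ψ` maps the circuit `rootCircuit x` to the trace of a circuit,
possibly through ends outside `Ψ`. -/
def liftable (ψ : Edge → Edge) : Set (ℕ → Bool) :=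
  {x | ∃ K ∈ circuits univ, K ∩ range ψ = ψ '' rootCircuit x}

theorem circuits_mono {Ψ Ψ' : Set (ℕ → Bool)} (h : Ψ ⊆ Ψ') : circuits Ψ ⊆ circuits Ψ' := by
  have hv : ∀ {z : Terminal}, z.Valid Ψ → z.Valid Ψ' := fun {z} hz => by
    cases z with
    | vertex => trivial
    | seq x => exact h hz
  rintro _ ⟨z, z', hz, hz', hne, rfl⟩
  exact ⟨z, z', hv hz, hv hz', hne, rfl⟩

/-- Two circuits that accumulate at the same end agree near that end, but `rootCircuit x` and
`rootCircuit x'` have only finitely many common edges. -/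
theorem injOn_accumulationEnd {ψ : Edge → Edge} (hψ : Function.Injective ψ) :
    InjOn (accumulationEnd ψ) (liftable ψ) := by
  rintro x ⟨K, hK, hKx⟩ x' ⟨K', hK', hKx'⟩ hxx'
  by_contra hne
  have hx := accumulationEnd_spec hψ x
  have hx' := accumulationEnd_spec hψ x'
  rw [← hxx'] at hx'
  rw [← hKx] at hx
  rw [← hKx'] at hx'
  obtain ⟨-, N, hN⟩ := exists_inter_above_eq hK fun n =>
    (hx n).nonempty.mono (inter_subset_inter_left _ inter_subset_left)
  obtain ⟨-, N', hN'⟩ := exists_inter_above_eq hK' fun n =>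
    (hx' n).nonempty.mono (inter_subset_inter_left _ inter_subset_left)
  refine hx (max N N') (((finite_rootCircuit_inter hne).image ψ).subset ?_)
  rw [image_inter hψ, ← hKx, ← hKx']
  rintro e ⟨⟨he, her⟩, he'⟩
  refine ⟨⟨he, her⟩, ?_, her⟩
  have h1 := (hN _ (le_max_left N N')).le ⟨he, he'⟩
  rw [← hN' _ (le_max_right N N')] at h1
  exact h1.1

theorem MinorOf.exists_mapsTo {Ψ Ψ' : Set (ℕ → Bool)}
    (h : MinorOf (psiMatroid Ψ) (psiMatroid Ψ')) : ∃ ψ : Edge → Edge, Function.Injective ψ ∧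
      Ψ ⊆ liftable ψ ∧ MapsTo (accumulationEnd ψ) Ψ Ψ' := by
  obtain ⟨ψ, hψ, hlift⟩ := h.exists_injective
  refine ⟨ψ, hψ, fun x hx => ?_, fun x hx => ?_⟩
  · obtain ⟨K, hK, hKx⟩ := hlift _ (rootCircuit_mem_circuits hx)
    exact ⟨K, circuits_mono (subset_univ _) hK, hKx⟩
  · obtain ⟨K, hK, hKx⟩ := hlift _ (rootCircuit_mem_circuits hx)
    refine (exists_inter_above_eq hK fun n => ?_).1
    refine (accumulationEnd_spec hψ x n).nonempty.mono (inter_subset_inter_left _ ?_)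
    rw [← hKx]
    exact inter_subset_left

open Cardinal in
theorem mk_edge_fun_le : #{ψ : Edge → Edge // Function.Injective ψ} ≤ 𝔠 := by
  have h : #Edge ≤ ℵ₀ := mk_le_aleph0
  calc #{ψ : Edge → Edge // Function.Injective ψ} ≤ #(Edge → Edge) := mk_subtype_le _
    _ = #Edge ^ #Edge := by simp
    _ ≤ ℵ₀ ^ #Edge := power_le_power_right h
    _ ≤ ℵ₀ ^ ℵ₀ := power_le_power_left aleph0_ne_zero h
    _ = 𝔠 := aleph0_power_aleph0

/-- Sets of ends whose matroids are pairwise not minors of each other, and that are not mapped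
into each other by continuous injections. -/
theorem exists_seq_not_minorOf : ∃ Ψ : ℕ → Set (ℕ → Bool),
    (∀ n, Cardinal.mk (Ψ n) = Cardinal.continuum) ∧ ∀ i j, i ≠ j →
      (¬ ∃ f : (ℕ → Bool) → (ℕ → Bool), Continuous f ∧ Function.Injective f ∧ f '' Ψ i ⊆ Ψ j) ∧
      ¬ MinorOf (psiMatroid (Ψ i)) (psiMatroid (Ψ j)) := by
  let ι := {ψ : Edge → Edge // Function.Injective ψ} ⊕
    {f : (ℕ → Bool) → (ℕ → Bool) // Continuous f}
  obtain ⟨Ψ, hcard, hΨ⟩ := exists_seq_not_mapsTo (R := ℕ → Bool) (ι := ι) (by simp) (by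
      rw [Cardinal.mk_sum, Cardinal.lift_id, Cardinal.lift_id]
      exact Cardinal.add_le_of_le Cardinal.aleph0_le_continuum mk_edge_fun_le mk_continuous_le)
    (Sum.elim (fun ψ => liftable ψ.1) fun f => {x | Function.Injective f.1})
    (Sum.elim (fun ψ => accumulationEnd ψ.1) fun f => f.1) (by
      rintro (ψ | f)
      · exact injOn_accumulationEnd ψ.2
      · exact fun x hx y _ hxy => hx hxy)
  refine ⟨Ψ, hcard, fun i j hij => ⟨?_, fun h => ?_⟩⟩
  · rintro ⟨f, hf, hinj, hsub⟩
    exact hΨ i j hij (Sum.inr ⟨f, hf⟩) (fun _ _ => hinj) (mapsTo_iff_image_subset.2 hsub)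
  · obtain ⟨ψ, hψ, h1, h2⟩ := h.exists_mapsTo
    exact hΨ i j hij (Sum.inl ⟨ψ, hψ⟩) h1 h2

theorem countable_psiMatroid_ground (Ψ : Set (ℕ → Bool)) : (psiMatroid Ψ).E.Countable :=
  (countable_univ (α := Edge)).image edgeEmb

end InfMatroid

/-- The countable binary matroids of branch-width at most 2 are not well-quasi-ordered under the
minor relation, as witnessed by `Ψₙ`-matroids of `T₂ × K₂`. -/
theorem corollary1p5 :
    ¬ WellQuasiOrdered (fun M N : {M : (α : Type) × Matroid α //
        M.2.E.Countable ∧ InfMatroid.IsBinary M.2 ∧ InfMatroid.branchWidth M.2 ≤ 2} =>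
      InfMatroid.MinorOf M.1.2 N.1.2) ∧
    ∃ Ψ : ℕ → Set (ℕ → Bool),
      (∀ n, Cardinal.mk (Ψ n) = Cardinal.continuum) ∧
      (∀ i j, i < j → ¬ ∃ f : (ℕ → Bool) → (ℕ → Bool),
        Continuous f ∧ Function.Injective f ∧ f '' Ψ i ⊆ Ψ j) ∧
      ∃ M : ℕ → Matroid (Sym2 (List Bool × Bool)),
        (∀ n, InfMatroid.IsPsiMatroid InfMatroid.doubleTree (InfMatroid.endsOf (Ψ n)) (M n)) ∧
        (∀ n, (M n).E.Countable ∧ InfMatroid.IsBinary (M n) ∧ InfMatroid.branchWidth (M n) ≤ 2) ∧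
        ∀ i j, i < j → ¬ InfMatroid.MinorOf (M i) (M j) := by
  obtain ⟨Ψ, hcard, hΨ⟩ := InfMatroid.exists_seq_not_minorOf
  have hM : ∀ n, (InfMatroid.psiMatroid (Ψ n)).E.Countable ∧
      InfMatroid.IsBinary (InfMatroid.psiMatroid (Ψ n)) ∧
      InfMatroid.branchWidth (InfMatroid.psiMatroid (Ψ n)) ≤ 2 := fun n =>
    ⟨InfMatroid.countable_psiMatroid_ground _, InfMatroid.isBinary_psiMatroid _,
      InfMatroid.branchWidth_psiMatroid_le _⟩
  refine ⟨fun hwqo => ?_, Ψ, hcard, fun i j hij => (hΨ i j hij.ne).1,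
    fun n => InfMatroid.psiMatroid (Ψ n), fun n => InfMatroid.isPsiMatroid_psiMatroid _, hM,
    fun i j hij => (hΨ i j hij.ne).2⟩
  obtain ⟨i, j, hij, h⟩ := hwqo fun n => ⟨⟨_, InfMatroid.psiMatroid (Ψ n)⟩, hM n⟩
  exact (hΨ i j hij.ne).2 h
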